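/- Let $n\ge 2$. **Matchings.** An arc $(i,j)$ on $\{1,\dots,N\}$ has $i<j$; $(i,j)$ and $(i',j')$ cross if $i<i'<j<j'$. A multicolored noncrossing matching (NCM) $\mathcal M=(\mathcal M_1,\dots,\mathcal M_{n-1})$ on $\{1,\dots,N\}$ consists of matchings $\mathcal M_x$ (sets of arcs with pairwise disjoint endpoints), each without crossings, that together cover $\{1,\dots,N\}$; arcs in $\mathcal M_x$ have color $x$. It is *standard rectangular* if every arc $(i,j)\in\mathcal M_x$ satisfies: if $x>1$, it shares $i$ with exactly one other arc, which is in $\mathcal M_{x-1}$; if $x<n-1$, it shares $j$ with exactly one other arc, which is in $\mathcal M_{x+1}$; if $x=1$, then $i$ is on no other arc; if $x=n-1$, then $j$ is on no other arc. The reflection $\varphi(\mathcal M)$ has the arc $(N+1-j,N+1-i)$ of color $n-x$ for each arc $(i,j)\in\mathcal M_x$. **Webs.** An $\mathfrak{sl}_n$-web is a finite directed plane graph in the upper half plane, with univalent boundary vertices $(1,0),\dots,(N,0)$, trivalent interior vertices, and edge weights in $\{1,\dots,n-1\}$ such that at each interior vertex the incoming weights minus the outgoing weights sum to $0$ modulo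 $n$. An *edge-flip* reverses an edge and replaces its weight $\ell$ by $n-\ell$; $w\sim w'$ means that $w,w'$ are $\mathfrak{sl}_n$-webs and $w'$ is obtained from $w$ by flipping some edges. For a web $w$, $\varphi(w)$ is its reflection over the vertical line through $(\frac{N+1}{2},0)$ (weights are kept). **The web $w_{\mathcal M}$.** Let $\mathcal M$ be standard rectangular. Draw each arc $(i,j)$ as a triangle over $[i,j]$ with sides of slopes $m$ and $-m$, where $m>0$ is fixed. At each boundary vertex shared by two arcs insert a Y: a vertical edge from the boundary vertex to a new interior vertex from which the two arcs diverge. At each crossing of arcs $(i,j)$ and $(i',j')$ with $i<i'<j<j'$, replace the crossing point by a vertical edge; its upper vertex is on the segments towards $i$ and $j'$, its lower vertex on the segments towards $i'$ and $j$. An edge coming from a single arc of color $x$ is directed clockwise along the arc (left to right) and weighted $x$. An inserted vertical edge, which has two arcs of colors $x<x'$ running over it in opposite directions, follows the clockwise direction of the arc of color $x'$ and is weighted $x'-x$. Finally, every boundary edge, that is, every edge joining a boundary vertex to an interior vertex, is replaced by the edge directed out of the boundary with weight $1$. All webs are drawn with the same slope $m$ and the same height $\varepsilon$, $0<\varepsilon<m/4$: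 the Y vertices are at height $\varepsilon$, the two vertices at a crossing are at distance $\varepsilon$ above and below the crossing point, and the edges are straight except for the corners at the tops of the triangles. Let $\mathcal E_{\mathcal M}$ be the set of edges of $w_{\mathcal M}$ that come from a single arc and are internal, that is, not boundary edges. (Only for $n=2$ do edges join two boundary vertices. They are the arcs themselves; no direction out of the boundary is distinguished for them, so they keep the clockwise direction and belong to $\mathcal E_{\mathcal M}$.) **Tableaux.** Let $T$ be a standard Young tableau with $n$ rows and $k$ columns, $N=nk$. In $\mathcal M^T$, the arcs of color $x$ are obtained by reading row $x+1$ from left to right and pairing each entry $j$ with the rightmost entry $i<j$ of row $x$ not yet paired. Put $w_T=w_{\mathcal M^T}$ and $\mathcal E_T=\mathcal E_{\mathcal M^T}$. The evacuation $E(T)$ is computed by $N$ times removing the northwest entry, performing jeu de taquin slides among the positive entries until the empty cell cannot move, and filling it with the negative of the removed entry, which stays fixed; at the end $N+1$ is added to all entries. **Lemma.** 1. For every $N$ and every standard rectangular multicolored NCM $\mathcal M$ on $\{1,\dots,N\}$, $\varphi(w_{\mathcal M})=w_{\varphi(\mathcal M)}$ as undirected, unweighted plane graphs, and $\varphi(w_{\mathcal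 M})\sim w_{\varphi(\mathcal M)}$. 2. For every $n\times k$ standard Young tableau $T$, $\varphi(\mathcal E_T)=\mathcal E_{E(T)}$ as sets of undirected, unweighted edges, and, writing $w_F$ for the web obtained from $w$ by flipping exactly the edges in $F$, $$\varphi(w_T)_{\varphi(\mathcal E_T)}=\varphi\big((w_T)_{\mathcal E_T}\big)=w_{E(T)}$$ as directed, weighted plane graphs. In particular $\varphi(w_T)\sim w_{E(T)}$. -/

import Mathlib

/-! ## Rectangular standard Young tableaux and evacuation -/

/-- `IsRectSYT n k T`: `T` is a standard Young tableau of rectangular shape with `n` rows and `k`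
columns. Rows and columns are indexed from `0`; outside the rectangle the value is `0`. -/
structure IsRectSYT (n k : ℕ) (T : ℕ → ℕ → ℤ) : Prop where
  bij : Set.BijOn (fun c : ℕ × ℕ => T c.1 c.2) {c | c.1 < n ∧ c.2 < k} (Set.Icc 1 ((n : ℤ) * k))
  row_lt : ∀ r c c' : ℕ, r < n → c < c' → c' < k → T r c < T r c'
  col_lt : ∀ r r' c : ℕ, r < r' → r' < n → c < k → T r c < T r' c
  zeros : ∀ r c : ℕ, ¬ (r < n ∧ c < k) → T r c = 0

/-- A filling together with the position (row, column) of its empty cell.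
The value stored at the empty cell is never read. -/
structure SlideState where
  T : ℕ → ℕ → ℤ
  r : ℕ
  c : ℕ

/-- Overwrite the entry of one cell. -/
def setCell (T : ℕ → ℕ → ℤ) (r c : ℕ) (v : ℤ) : ℕ → ℕ → ℤ :=
  fun r' c' => if r' = r ∧ c' = c then v else T r' c'

/-- One jeu de taquin slide: of the entries below and to the right of the empty cell, the lesser
moves into the empty cell. Only positive entries move: cells outside the shape hold `0` and cells
that are already fixed hold negative numbers. If nothing can move, the state does not change. -/
def jdtStep (s : SlideState) : SlideState :=
  let a := s.T (s.r + 1) s.c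
  let b := s.T s.r (s.c + 1)
  if 0 < b ∧ (a ≤ 0 ∨ b < a) then ⟨setCell s.T s.r s.c b, s.r, s.c + 1⟩
  else if 0 < a then ⟨setCell s.T s.r s.c a, s.r + 1, s.c⟩
  else s

/-- One round of evacuation: remove the entry of the northwest corner, slide until the empty cell
cannot move any more (fewer than `n + k` slides), and put the negative of the removed entry there. -/
def evacStep (n k : ℕ) (T : ℕ → ℕ → ℤ) : ℕ → ℕ → ℤ :=
  let s := jdtStep^[n + k] ⟨T, 0, 0⟩
  setCell s.T s.r s.c (-(T 0 0))

/-- Evacuation of an `n × k` tableau. Each round makes one more entry negative, so that all are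
negative after `n * k` rounds; then `n * k + 1` is added to all entries. -/
def evacuation (n k : ℕ) (T : ℕ → ℕ → ℤ) : ℕ → ℕ → ℤ :=
  fun r c => if r < n ∧ c < k then ((evacStep n k)^[n * k] T) r c + ((n : ℤ) * k + 1) else 0

/-! ## Multicolored noncrossing matchings -/

/-- The arc `(start, finish)` with color `color`. -/
@[ext] structure ColoredArc where
  start : ℤ
  finish : ℤ
  color : ℤ

/-- `p` is a boundary point of the arc. -/
def ColoredArc.Touches (a : ColoredArc) (p : ℤ) : Prop := a.start = p ∨ a.finish = p

/-- `a` and `b` cross, with `a` the arc that starts further left. -/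
def ColoredArc.Crosses (a b : ColoredArc) : Prop :=
  a.start < b.start ∧ b.start < a.finish ∧ a.finish < b.finish

/-- `M` is a multicolored noncrossing matching on `{1, …, N}` with colors `1, …, n - 1`:
the matching of color `x` consists of the arcs of `M` with that color. -/
structure IsMulticoloredNCM (n N : ℕ) (M : Set ColoredArc) : Prop where
  arc : ∀ a ∈ M, 1 ≤ a.start ∧ a.start < a.finish ∧ a.finish ≤ N
  color : ∀ a ∈ M, 1 ≤ a.color ∧ a.color ≤ (n : ℤ) - 1
  disjoint : ∀ a ∈ M, ∀ b ∈ M, a.color = b.color → a ≠ b → ∀ p, a.Touches p → ¬ b.Touches p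
  noncrossing : ∀ a ∈ M, ∀ b ∈ M, a.color = b.color → ¬ a.Crosses b
  covers : ∀ p : ℤ, 1 ≤ p → p ≤ N → ∃ a ∈ M, a.Touches p

/-- The standard rectangular condition:
if `x > 1`, an arc `(i, j)` of color `x` shares `i` with exactly one other arc, of color `x - 1`;
if `x < n - 1`, it shares `j` with exactly one other arc, of color `x + 1`;
if `x = 1`, then `i` is on no other arc; if `x = n - 1`, then `j` is on no other arc. -/
structure IsStandardRectangular (n : ℕ) (M : Set ColoredArc) : Prop where
  start_shared : ∀ a ∈ M, 1 < a.color →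
    ∃ b : ColoredArc, b.color = a.color - 1 ∧ ∀ c, (c ∈ M ∧ c ≠ a ∧ c.Touches a.start) ↔ c = b
  end_shared : ∀ a ∈ M, a.color < (n : ℤ) - 1 →
    ∃ b : ColoredArc, b.color = a.color + 1 ∧ ∀ c, (c ∈ M ∧ c ≠ a ∧ c.Touches a.finish) ↔ c = b
  start_free : ∀ a ∈ M, a.color = 1 → ∀ c ∈ M, c.Touches a.start → c = a
  end_free : ∀ a ∈ M, a.color = (n : ℤ) - 1 → ∀ c ∈ M, c.Touches a.finish → c = a

/-- The reflected arc `(N + 1 - j, N + 1 - i)`, of color `n - x`. -/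
def ColoredArc.reflect (n N : ℕ) (a : ColoredArc) : ColoredArc :=
  ⟨(N : ℤ) + 1 - a.finish, (N : ℤ) + 1 - a.start, (n : ℤ) - a.color⟩

/-- The reflection of a multicolored matching. -/
def reflectMatching (n N : ℕ) (M : Set ColoredArc) : Set ColoredArc :=
  ColoredArc.reflect n N '' M

/-- The pairs made when the first `c` entries of the row `bot` are read from left to right and each
is paired with the rightmost smaller entry of the row `top` (of length `k`) not yet paired. -/
def rowPairs (k : ℕ) (top bot : ℕ → ℤ) : ℕ → Finset (ℤ × ℤ)
  | 0 => ∅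
  | c + 1 =>
    let P := rowPairs k top bot c
    let cand := (Finset.range k).filter (fun d => top d < bot c ∧ ∀ p ∈ P, p.1 ≠ top d)
    if h : cand.Nonempty then insert (top (cand.max' h), bot c) P else P

/-- The multicolored noncrossing matching of an `n × k` tableau: the arcs of color `x` pair the
entries of the `x`-th and `(x + 1)`-st rows (which have the indices `x - 1` and `x` here). -/
def tableauMatching (n k : ℕ) (T : ℕ → ℕ → ℤ) : Set ColoredArc :=
  {a | ∃ r : ℕ, r + 1 < n ∧ a.color = (r : ℤ) + 1 ∧
    (a.start, a.finish) ∈ rowPairs k (T r) (T (r + 1)) k}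

/-! ## Directed weighted plane graphs and webs -/

/-- A directed weighted edge drawn in the plane: source, target, the curve, the weight. -/
@[ext] structure WebEdge where
  src : ℝ × ℝ
  tgt : ℝ × ℝ
  curve : Set (ℝ × ℝ)
  weight : ℤ

/-- A directed weighted graph with boundary, drawn in the plane. -/
@[ext] structure PlaneGraph where
  boundary : Set (ℝ × ℝ)
  interior : Set (ℝ × ℝ)
  edges : Set WebEdge

/-- The curve of an edge is a simple arc (or a simple closed curve, if the edge is a loop) from
source to target. -/
def WebEdge.IsSimpleCurve (e : WebEdge) : Prop :=
  ∃ γ : ℝ → ℝ × ℝ, ContinuousOn γ (Set.Icc 0 1) ∧ γ 0 = e.src ∧ γ 1 = e.tgt ∧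
    γ '' Set.Icc 0 1 = e.curve ∧ Set.InjOn γ (Set.Ico 0 1) ∧ Set.InjOn γ (Set.Ioc 0 1)

/-- The number of edge ends at the point `v`. -/
noncomputable def PlaneGraph.degree (w : PlaneGraph) (v : ℝ × ℝ) : ℕ :=
  {e | e ∈ w.edges ∧ e.src = v}.ncard + {e | e ∈ w.edges ∧ e.tgt = v}.ncard

/-- `w` is an `𝔰𝔩ₙ`-web in the upper half plane with boundary vertices `(1, 0), …, (N, 0)`. -/
structure IsWeb (n N : ℕ) (w : PlaneGraph) : Prop where
  boundary_eq : w.boundary = {p | ∃ i : ℤ, 1 ≤ i ∧ i ≤ N ∧ p = ((i : ℝ), 0)}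
  interior_pos : ∀ p ∈ w.interior, 0 < p.2
  finite_interior : w.interior.Finite
  finite_edges : w.edges.Finite
  endpoints : ∀ e ∈ w.edges, e.src ∈ w.boundary ∪ w.interior ∧ e.tgt ∈ w.boundary ∪ w.interior
  simple : ∀ e ∈ w.edges, e.IsSimpleCurve
  upper : ∀ e ∈ w.edges, ∀ p ∈ e.curve, p ∈ w.boundary ∨ 0 < p.2
  avoids : ∀ e ∈ w.edges, ∀ p ∈ e.curve, p ∈ w.boundary ∪ w.interior → p = e.src ∨ p = e.tgt
  planar : ∀ e ∈ w.edges, ∀ f ∈ w.edges, e ≠ f → e.curve ∩ f.curve ⊆ w.boundary ∪ w.interior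
  univalent : ∀ v ∈ w.boundary, w.degree v = 1
  trivalent : ∀ v ∈ w.interior, w.degree v = 3
  weight_mem : ∀ e ∈ w.edges, 1 ≤ e.weight ∧ e.weight ≤ (n : ℤ) - 1
  flow : ∀ v ∈ w.interior,
    (∑ᶠ e ∈ {e | e ∈ w.edges ∧ e.tgt = v}, e.weight) -
      (∑ᶠ e ∈ {e | e ∈ w.edges ∧ e.src = v}, e.weight) ≡ 0 [ZMOD n]

/-- An edge without its direction and weight: unordered pair of endpoints, and the curve. -/
def WebEdge.shape (e : WebEdge) : Sym2 (ℝ × ℝ) × Set (ℝ × ℝ) := (s(e.src, e.tgt), e.curve)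

/-- The underlying undirected, unweighted plane graph: boundary vertices, interior vertices and
edges without direction and weight. -/
def PlaneGraph.undirected (w : PlaneGraph) :
    Set (ℝ × ℝ) × Set (ℝ × ℝ) × Set (Sym2 (ℝ × ℝ) × Set (ℝ × ℝ)) :=
  (w.boundary, w.interior, WebEdge.shape '' w.edges)

/-- The edge-flip: reverse the direction and replace the weight `ℓ` by `n - ℓ`. -/
def WebEdge.flip (n : ℕ) (e : WebEdge) : WebEdge := ⟨e.tgt, e.src, e.curve, (n : ℤ) - e.weight⟩

open Classical in
/-- The graph obtained from `w` by flipping exactly the edges in `F`. -/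
noncomputable def PlaneGraph.flip (n : ℕ) (F : Set WebEdge) (w : PlaneGraph) : PlaneGraph :=
  ⟨w.boundary, w.interior, (fun e => if e ∈ F then e.flip n else e) '' w.edges⟩

/-- Two `𝔰𝔩ₙ`-webs are equivalent if one is obtained from the other by flipping some edges. -/
def EdgeFlipEquiv (n N : ℕ) (w w' : PlaneGraph) : Prop :=
  IsWeb n N w ∧ IsWeb n N w' ∧ ∃ F ⊆ w.edges, w.flip n F = w'

/-- Reflection of the plane over the vertical line with abscissa `(N + 1) / 2`. -/
def reflectPoint (N : ℕ) (p : ℝ × ℝ) : ℝ × ℝ := ((N : ℝ) + 1 - p.1, p.2)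

/-- The reflected edge, with the same weight. -/
def WebEdge.reflect (N : ℕ) (e : WebEdge) : WebEdge :=
  ⟨reflectPoint N e.src, reflectPoint N e.tgt, reflectPoint N '' e.curve, e.weight⟩

/-- The reflected graph. -/
def PlaneGraph.reflect (N : ℕ) (w : PlaneGraph) : PlaneGraph :=
  ⟨reflectPoint N '' w.boundary, reflectPoint N '' w.interior, WebEdge.reflect N '' w.edges⟩

/-! ## The web of a multicolored noncrossing matching

Arcs are drawn as triangles with sides of slope `m` and `-m` above the horizontal axis. The vertex
of a Y is put at height `ε` above its boundary vertex, and the two vertices of a dumbbell at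
distance `ε` above and below the crossing point that it replaces. -/

/-- The top of the triangle that represents the arc. -/
noncomputable def ColoredArc.apex (m : ℝ) (a : ColoredArc) : ℝ × ℝ :=
  (((a.start : ℝ) + a.finish) / 2, m * ((a.finish : ℝ) - a.start) / 2)

/-- At height `h` above the intersection point of the triangles of two arcs `a` and `b` with
`a.Crosses b`. -/
noncomputable def crossingPoint (m h : ℝ) (a b : ColoredArc) : ℝ × ℝ :=
  (((b.start : ℝ) + a.finish) / 2, m * ((a.finish : ℝ) - b.start) / 2 + h)

/-- There is a Y at the boundary vertex `p`: one arc ends and another one starts there. -/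
def HasY (M : Set ColoredArc) (p : ℤ) : Prop := (∃ a ∈ M, a.finish = p) ∧ ∃ b ∈ M, b.start = p

open Classical in
/-- The vertex at which an arc with boundary point `p` starts or ends after Y's are inserted. -/
noncomputable def foot (ε : ℝ) (M : Set ColoredArc) (p : ℤ) : ℝ × ℝ :=
  if HasY M p then ((p : ℝ), ε) else ((p : ℝ), 0)

/-- The vertices met when following the arc `a` clockwise, that is, from left to right.
`ArcNode m ε M a t p q` says that at abscissa `t` the arc arrives at the vertex `p` and leaves from
the vertex `q`. These differ at a dumbbell, which `a` climbs on the rising side of its triangle and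
descends on the falling side. -/
inductive ArcNode (m ε : ℝ) (M : Set ColoredArc) (a : ColoredArc) :
    ℝ → ℝ × ℝ → ℝ × ℝ → Prop
  | first : ArcNode m ε M a a.start (foot ε M a.start) (foot ε M a.start)
  | rising (b : ColoredArc) (hb : b ∈ M) (h : b.Crosses a) :
      ArcNode m ε M a (((a.start : ℝ) + b.finish) / 2)
        (crossingPoint m (-ε) b a) (crossingPoint m ε b a)
  | falling (b : ColoredArc) (hb : b ∈ M) (h : a.Crosses b) :
      ArcNode m ε M a (((b.start : ℝ) + a.finish) / 2)
        (crossingPoint m ε a b) (crossingPoint m (-ε) a b)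
  | last : ArcNode m ε M a a.finish (foot ε M a.finish) (foot ε M a.finish)

open Classical in
/-- The drawing of the part of the arc `a` from the vertex `p` at abscissa `t` to the vertex `q` at
abscissa `t'`: a straight segment, or two segments meeting at the apex if that lies between. -/
noncomputable def arcPiece (m : ℝ) (a : ColoredArc) (t t' : ℝ) (p q : ℝ × ℝ) : Set (ℝ × ℝ) :=
  if t < (a.apex m).1 ∧ (a.apex m).1 < t' then segment ℝ p (a.apex m) ∪ segment ℝ (a.apex m) q
  else segment ℝ p q

/-- The edges created from a single arc: they join consecutive vertices of an arc, are directed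
clockwise along it and weighted by its color. -/
def arcEdges (m ε : ℝ) (M : Set ColoredArc) : Set WebEdge :=
  {e | ∃ a ∈ M, ∃ (t t' : ℝ) (p q p' q' : ℝ × ℝ),
    ArcNode m ε M a t p q ∧ ArcNode m ε M a t' p' q' ∧ t < t' ∧
    (∀ s u v, ArcNode m ε M a s u v → ¬ (t < s ∧ s < t')) ∧
    e = ⟨q, p', arcPiece m a t t' q p', a.color⟩}

/-- The vertical edge over which an arc of color `x` runs upwards and one of color `y` downwards: it
follows the arc with the larger color and is weighted by the difference of the colors. -/
noncomputable def verticalEdge (bot top : ℝ × ℝ) (x y : ℤ) : WebEdge :=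
  if y < x then ⟨bot, top, segment ℝ bot top, x - y⟩ else ⟨top, bot, segment ℝ bot top, y - x⟩

/-- The vertical edges of the Y's. -/
def yEdges (ε : ℝ) (M : Set ColoredArc) : Set WebEdge :=
  {e | ∃ a ∈ M, ∃ b ∈ M, a.finish = b.start ∧
    e = verticalEdge ((b.start : ℝ), 0) ((b.start : ℝ), ε) b.color a.color}

/-- The vertical edges of the dumbbells. -/
def dumbbellEdges (m ε : ℝ) (M : Set ColoredArc) : Set WebEdge :=
  {e | ∃ a ∈ M, ∃ b ∈ M, a.Crosses b ∧
    e = verticalEdge (crossingPoint m (-ε) a b) (crossingPoint m ε a b) b.color a.color}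

/-- The web before its boundary edges are normalized. -/
def preWeb (N : ℕ) (m ε : ℝ) (M : Set ColoredArc) : PlaneGraph where
  boundary := {p | ∃ i : ℤ, 1 ≤ i ∧ i ≤ N ∧ p = ((i : ℝ), 0)}
  interior := {p | ∃ i : ℤ, HasY M i ∧ p = ((i : ℝ), ε)} ∪
    {p | ∃ a ∈ M, ∃ b ∈ M, a.Crosses b ∧
      (p = crossingPoint m ε a b ∨ p = crossingPoint m (-ε) a b)}
  edges := arcEdges m ε M ∪ yEdges ε M ∪ dumbbellEdges m ε M

/-- A boundary edge joins a boundary vertex (in `B`) to an interior vertex. -/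
def WebEdge.IsBoundaryEdge (B : Set (ℝ × ℝ)) (e : WebEdge) : Prop :=
  (e.src ∈ B ∧ e.tgt ∉ B) ∨ (e.src ∉ B ∧ e.tgt ∈ B)

open Classical in
/-- Replace a boundary edge by the edge directed out of the boundary, of weight `1`. Other edges do
not change; among them are the edges with both endpoints on the boundary, where no direction is
distinguished (in webs of standard rectangular matchings such edges occur only for `n = 2`). -/
noncomputable def WebEdge.normalize (B : Set (ℝ × ℝ)) (e : WebEdge) : WebEdge :=
  if e.IsBoundaryEdge B then
    if e.src ∈ B then ⟨e.src, e.tgt, e.curve, 1⟩ else ⟨e.tgt, e.src, e.curve, 1⟩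
  else e

/-- The web `w_M` of a (standard rectangular) multicolored noncrossing matching on `{1, …, N}`. -/
noncomputable def webOf (N : ℕ) (m ε : ℝ) (M : Set ColoredArc) : PlaneGraph where
  boundary := (preWeb N m ε M).boundary
  interior := (preWeb N m ε M).interior
  edges := WebEdge.normalize (preWeb N m ε M).boundary '' (preWeb N m ε M).edges

/-- The internal (that is, not boundary) edges of `w_M` created from a single arc. -/
def internalArcEdges (N : ℕ) (m ε : ℝ) (M : Set ColoredArc) : Set WebEdge :=
  {e | e ∈ arcEdges m ε M ∧ ¬ e.IsBoundaryEdge (preWeb N m ε M).boundary}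

/-- The web `w_T` of an `n × k` tableau. -/
noncomputable def tableauWeb (n k : ℕ) (m ε : ℝ) (T : ℕ → ℕ → ℤ) : PlaneGraph :=
  webOf (n * k) m ε (tableauMatching n k T)

/-- The set of internal edges of `w_T` created from a single arc. -/
def tableauArcEdges (n k : ℕ) (m ε : ℝ) (T : ℕ → ℕ → ℤ) : Set WebEdge :=
  internalArcEdges (n * k) m ε (tableauMatching n k T)

/-! The drawing of a matching is symmetric under reflection except for directions and weights.
Triangles, Y's and crossings are mirrored into triangles, Y's and crossings, so both webs have the
same underlying plane graph. An edge of a single arc of color `x` points from left to right with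
weight `x`; its mirror image points from right to left with weight `x`, which is exactly the flip of
the corresponding edge of the reflected arc, of color `n - x`. At a vertical edge with colors `x`
upwards and `y` downwards, reflection exchanges the two roles, and `(n - y) - (n - x) = x - y`, so
nothing has to be flipped. Normalized boundary edges agree as well. Hence the internal arc edges are
exactly the edges to flip (`ArcSystem.webOf_reflectMatching`).

Equivalence also demands that both graphs are webs. Vertices on an arc have abscissae in `ℤ / 2`, so
an edge deviates from the ideal side of its triangle by at most `ε`, and this deviation has slope at
most `4 * ε < m`. Parallel sides of different arcs have vertical distance a nonzero multiple of `m`,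
hence do not meet; a falling and a rising side come together only near their crossing point, where
the two ends of the vertical edge hold them apart. This gives planarity. The colors balance at every
interior vertex (`ArcSystem.isWeb_preWeb`). Flips preserve webs because they change the flow by
multiples of `n`, and normalizing the boundary edges is itself a flip.

For tableaux it remains to see that the matching of the evacuated tableau is the reflected matching.
This rests on two facts. First, evacuation of a rectangle is rotation by a half turn followed by
complementation (`IsRectSYT.evacuation_apply`). The proof uses an invariant in the manner of Greene:
the largest number of positions of the row word that `r` antitone functions can cover does not
change under jeu de taquin slides, even after restriction to the values above any bound. For a
straight shape this number is the sum of the first `r` row lengths; for the entries of the rectangle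
above `j`, it is the sum over the last `r` rows. So after `j` rounds the remaining shape is the
rotated shape of the entries above `j`, and the cells vacated round by round are determined.

Second, a noncrossing pairing of two given sets, with left ends in one and right ends in the other,
is unique (`IsNCPairing.unique`). The greedy pairing of two rows is such a pairing, and this
description, unlike the greedy rule, is symmetric under reflection. -/

/-! ## Covering words by antitone families

A word is a function from positions to letters. The largest number of positions of a finite set at
which `r` antitone functions agree with the word is invariant under the letter changes that occur
in jeu de taquin slides. -/

/-- The positions in `A` at which one of the first `r` functions of the family `h` agrees with the
word `w`. -/
def coverSet (r : ℕ) (A : Finset ℤ) (w : ℤ → ℤ) (h : ℕ → ℤ → ℤ) : Finset ℤ :=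
  open Classical in A.filter (fun q => ∃ a < r, h a q = w q)

/-- Some family of `r` antitone functions agrees with `w` in at least `s` positions of `A`. -/
def Coverable (r : ℕ) (A : Finset ℤ) (w : ℤ → ℤ) (s : ℕ) : Prop :=
  ∃ h : ℕ → ℤ → ℤ, (∀ a < r, Antitone (h a)) ∧ s ≤ (coverSet r A w h).card

theorem mem_coverSet {r : ℕ} {A : Finset ℤ} {w : ℤ → ℤ} {h : ℕ → ℤ → ℤ} {q : ℤ} :
    q ∈ coverSet r A w h ↔ q ∈ A ∧ ∃ a < r, h a q = w q := by
  classical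
  simp [coverSet]

theorem Coverable.congr {r : ℕ} {A : Finset ℤ} {w w' : ℤ → ℤ} {s : ℕ}
    (hw : ∀ q ∈ A, w q = w' q) (H : Coverable r A w s) : Coverable r A w' s := by
  obtain ⟨h, hh, hs⟩ := H
  refine ⟨h, hh, hs.trans (Finset.card_le_card fun q hq => ?_)⟩
  rw [mem_coverSet] at hq ⊢
  rw [← hw q hq.1]
  exact hq

/-- The first position after `p` where the function `h a` drops below `i + 1`, or another function
of the family takes the value `i`. -/
theorem exists_switch {r : ℕ} (A : Finset ℤ) {h : ℕ → ℤ → ℤ} (hh : ∀ a < r, Antitone (h a))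
    {p i : ℤ} {a : ℕ} (ha : a < r) (hap : h a p = i + 1) (hno : ∀ c < r, h c p ≠ i) :
    ∃ s₀ > p, ∃ b < r, (∀ s, p < s → s < s₀ → h a s = i + 1 ∧ ∀ c < r, h c s ≠ i) ∧
      (b = a ∨ ∀ s < s₀, i + 1 ≤ h b s) ∧ (h b s₀ ≤ i ∨ (b = a ∧ ∀ s ∈ A, s < s₀)) := by
  classical
  have key : ∀ s, p < s → ¬ (h a s ≤ i ∨ ∃ b < r, h b s = i) →
      h a s = i + 1 ∧ ∀ c < r, h c s ≠ i := by
    intro s hs hn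
    push Not at hn
    refine ⟨?_, hn.2⟩
    have := hh a ha hs.le
    omega
  by_cases hex : ∃ s, p < s ∧ (h a s ≤ i ∨ ∃ b < r, h b s = i)
  · obtain ⟨s₀, ⟨hs₀, hP⟩, hmin⟩ := Int.exists_least_of_bdd
      (P := fun s => p < s ∧ (h a s ≤ i ∨ ∃ b < r, h b s = i)) ⟨p, fun z hz => hz.1.le⟩ hex
    have hlt : ∀ s, p < s → s < s₀ → h a s = i + 1 ∧ ∀ c < r, h c s ≠ i := fun s hs hss =>
      key s hs fun hn => absurd (hmin s ⟨hs, hn⟩) (by omega)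
    by_cases has : h a s₀ ≤ i
    · exact ⟨s₀, hs₀, a, ha, hlt, Or.inl rfl, Or.inl has⟩
    · obtain ⟨b, hb, hbs⟩ := hP.resolve_left has
      -- By minimality `h b` does not have the value `i` at `s₀ - 1`. It has it at `s₀`, so by
      -- monotonicity it is at least `i + 1` at `s₀ - 1` and everywhere before.
      refine ⟨s₀, hs₀, b, hb, hlt, Or.inr fun s hs => ?_, Or.inl hbs.le⟩
      have h1 : h b (s₀ - 1) ≠ i := by
        rcases eq_or_lt_of_le (show p ≤ s₀ - 1 by omega) with h2 | h2
        · rw [← h2]; exact hno b hb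
        · exact (hlt _ h2 (by omega)).2 b hb
      have h2 := hh b hb (show s₀ - 1 ≤ s₀ by omega)
      have h3 := hh b hb (show s ≤ s₀ - 1 by omega)
      omega
  · push Not at hex
    obtain ⟨m, hm⟩ := A.exists_le
    -- No switch occurs at all, so any position beyond `p` and beyond all of `A` serves as `s₀`.
    refine ⟨max (p + 1) (m + 1), by simp, a, ha, fun s hs _ => key s hs ?_,
      Or.inl rfl, Or.inr ⟨rfl, fun s hs => ?_⟩⟩
    · push Not
      exact hex s hs
    · have := hm s hs
      omega

/-- A function that covers `p` with the value `i + 1` is lowered to `i` from `p` up to the next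
switch. It loses letters `i + 1` and gains letters `i` that were uncovered, and the counting
hypothesis says that the gain is no smaller than the loss. -/
theorem Coverable.update_down {r : ℕ} {A : Finset ℤ} {w : ℤ → ℤ} {s : ℕ} {p i : ℤ}
    (hp : w p = i + 1)
    (hcount : ∀ q, p ≤ q → (A.filter fun s => p < s ∧ s ≤ q ∧ w s = i + 1).card ≤
      (A.filter fun s => p < s ∧ s ≤ q ∧ w s = i).card)
    (H : Coverable r A w s) : Coverable r A (Function.update w p i) s := by
  classical
  obtain ⟨h, hh, hs⟩ := H
  -- In these cases the old family suffices: either the new letter at `p` is covered, or the old one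
  -- was not.
  by_cases h0 : (∃ b < r, h b p = i) ∨ ¬ ∃ a < r, h a p = i + 1
  · refine ⟨h, hh, hs.trans (Finset.card_le_card fun q hq => ?_)⟩
    rw [mem_coverSet] at hq ⊢
    refine ⟨hq.1, ?_⟩
    by_cases hqp : q = p
    · subst hqp
      rw [Function.update_self]
      rcases h0 with h0 | h0
      · exact h0
      · rw [hp] at hq; exact absurd hq.2 h0
    · rw [Function.update_of_ne hqp]; exact hq.2
  push Not at h0
  obtain ⟨hno, a, ha, hap⟩ := h0
  obtain ⟨s₀, hs₀, b, hb, hmid, hbef, haft⟩ := exists_switch A hh ha hap hno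
  -- From `s₀` on, `a` and `b` exchange their tails; this keeps both antitone, since `h b` is at
  -- least `i + 1` before `s₀` and `h a` at most `i + 1` after `p`. If `b = a`, the tail is kept.
  -- The minimum with `i` changes something only if `h a` never drops while `A` lasts, and then only
  -- beyond `A`.
  let h' : ℕ → ℤ → ℤ := fun c s =>
    if c = a then (if s < p then h a s else if s < s₀ then i else min i (h b s))
    else if c = b then (if s < s₀ then h b s else h a s) else h c s
  refine ⟨h', ?_, hs.trans ?_⟩
  · intro c hc
    by_cases hca : c = a
    · intro x y hxy
      have h1 := hh a ha hxy
      have h2 := hh b hb hxy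
      simp only [h', hca, if_true]
      by_cases hxp : x < p
      · have h3 := hh a ha hxp.le
        split_ifs <;> omega
      · split_ifs <;> omega
    · by_cases hcb : c = b
      · have hba : ¬ b = a := fun e => hca (hcb.trans e)
        intro x y hxy
        simp only [h', hcb, hba, if_true, if_false]
        have h1 := hh a ha hxy
        have h2 := hh b hb hxy
        split_ifs with h3 h4 h4
        · exact h2
        · omega
        · have h5 := hbef.resolve_left hba x (by omega)
          have h6 := hh a ha (show p ≤ y by omega)
          omega
        · exact h1
      · have : h' c = h c := by
          funext x
          simp [h', hca, hcb]
        rw [this]; exact hh c hc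
  · -- compare the two sets
    have hA : ∀ q, (q < p ∨ s₀ ≤ q) → q ∈ coverSet r A w h →
        q ∈ coverSet r A (Function.update w p i) h' := by
      intro q hq hc
      rw [mem_coverSet] at hc ⊢
      obtain ⟨hqA, c, hc, hcq⟩ := hc
      have hqp : q ≠ p := by omega
      rw [Function.update_of_ne hqp]
      refine ⟨hqA, ?_⟩
      rcases hq with hq | hq
      · refine ⟨c, hc, ?_⟩
        rw [← hcq]
        have : q < s₀ := by omega
        by_cases hca : c = a
        · subst hca; simp [h', hq]
        · by_cases hcb : c = b <;> simp_all [h']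
      · have hn1 : ¬ q < p := by omega
        have hn2 : ¬ q < s₀ := by omega
        have hbs : h b s₀ ≤ i := by
          rcases haft with h1 | ⟨_, h1⟩
          · exact h1
          · exact absurd (h1 q hqA) hn2
        have hbq : min i (h b q) = h b q := min_eq_right ((hh b hb hq).trans hbs)
        by_cases hca : c = a
        · by_cases hba : b = a
          · refine ⟨a, ha, ?_⟩
            subst hba; subst hca
            simp only [h', if_true, hn1, hn2, if_false, ← hcq, hbq]
          · refine ⟨b, hb, ?_⟩
            simp only [h', hba, if_false, if_true, hn2]
            rw [← hca, hcq]
        · by_cases hcb : c = b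
          · refine ⟨a, ha, ?_⟩
            simp only [h', if_true, hn1, hn2, if_false, hbq]
            rw [← hcb, hcq]
          · refine ⟨c, hc, ?_⟩
            simp only [h', hca, hcb, if_false, hcq]
    have hmidcov : ∀ q, p < q → q < s₀ → q ∈ coverSet r A w h → w q ≠ i + 1 →
        q ∈ coverSet r A (Function.update w p i) h' := by
      intro q h1 h2 hc hne
      rw [mem_coverSet] at hc ⊢
      obtain ⟨hqA, c, hc, hcq⟩ := hc
      rw [Function.update_of_ne (by omega)]
      refine ⟨hqA, c, hc, ?_⟩
      have hca : c ≠ a := by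
        rintro rfl
        exact hne (hcq ▸ (hmid q h1 h2).1)
      by_cases hcb : c = b
      · subst hcb; simp [h', hca, h2, hcq]
      · simp [h', hca, hcb, hcq]
    have hnew : ∀ q ∈ A, p ≤ q → q < s₀ → (q = p ∨ w q = i) →
        q ∈ coverSet r A (Function.update w p i) h' := by
      intro q hqA h1 h2 h3
      rw [mem_coverSet]
      refine ⟨hqA, a, ha, ?_⟩
      have hn1 : ¬ q < p := by omega
      simp only [h', if_true, hn1, h2, if_false]
      by_cases hqp : q = p
      · subst hqp; rw [Function.update_self]
      · rw [Function.update_of_ne hqp, h3.resolve_left hqp]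
    have hold : ∀ q, p < q → q < s₀ → w q = i → q ∉ coverSet r A w h := by
      intro q h1 h2 h3 hc
      rw [mem_coverSet] at hc
      obtain ⟨_, c, hc, hcq⟩ := hc
      exact (hmid q h1 h2).2 c hc (hcq.trans h3)
    -- `R` contains everything that may be lost, and all of `G` is gained, because no function had
    -- the value `i` strictly between `p` and `s₀`.
    let R := A.filter fun s => p < s ∧ s ≤ s₀ - 1 ∧ w s = i + 1
    let G := A.filter fun s => p < s ∧ s ≤ s₀ - 1 ∧ w s = i
    have hRG : R.card ≤ G.card := hcount (s₀ - 1) (by omega)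
    have hdisj : Disjoint (coverSet r A w h \ R) G := by
      rw [Finset.disjoint_left]
      intro q hq hqG
      simp only [G, Finset.mem_filter] at hqG
      exact hold q hqG.2.1 (by omega) hqG.2.2.2 (Finset.mem_sdiff.1 hq).1
    have hsub : (coverSet r A w h \ R) ∪ G ⊆ coverSet r A (Function.update w p i) h' := by
      intro q hq
      rw [Finset.mem_union] at hq
      rcases hq with hq | hq
      · rw [Finset.mem_sdiff] at hq
        obtain ⟨hq, hqR⟩ := hq
        have hqA := (mem_coverSet.1 hq).1
        by_cases h1 : q < p ∨ s₀ ≤ q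
        · exact hA q h1 hq
        · by_cases h2 : q = p
          · exact hnew q hqA (by omega) (by omega) (Or.inl h2)
          · refine hmidcov q (by omega) (by omega) hq fun h3 => hqR ?_
            simp only [R, Finset.mem_filter]
            exact ⟨hqA, by omega, by omega, h3⟩
      · simp only [G, Finset.mem_filter] at hq
        exact hnew q hq.1 (by omega) (by omega) (Or.inr hq.2.2.2)
    have h1 := Finset.card_le_card hsub
    rw [Finset.card_union_of_disjoint hdisj] at h1
    have h2 := Finset.le_card_sdiff R (coverSet r A w h)
    omega

/-- Antitone functions stay antitone when positions and letters are both negated. This turns the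
raising of a letter into the lowering of one. -/
theorem Coverable.neg {r : ℕ} {A : Finset ℤ} {w : ℤ → ℤ} {s : ℕ} (H : Coverable r A w s) :
    Coverable r (A.image Neg.neg) (fun q => - w (-q)) s := by
  classical
  obtain ⟨h, hh, hs⟩ := H
  refine ⟨fun a q => - h a (-q), fun a ha x y hxy => ?_, hs.trans ?_⟩
  · have := hh a ha (neg_le_neg hxy)
    simpa using this
  · rw [← Finset.card_image_of_injective (coverSet r A w h) neg_injective]
    refine Finset.card_le_card fun q hq => ?_
    obtain ⟨x, hx, rfl⟩ := Finset.mem_image.1 hq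
    rw [mem_coverSet] at hx ⊢
    refine ⟨Finset.mem_image_of_mem _ hx.1, ?_⟩
    simpa using hx.2

theorem Coverable.update_up {r : ℕ} {A : Finset ℤ} {w : ℤ → ℤ} {s : ℕ} {p i : ℤ}
    (hp : w p = i)
    (hcount : ∀ q, q ≤ p → (A.filter fun s => q ≤ s ∧ s < p ∧ w s = i).card ≤
      (A.filter fun s => q ≤ s ∧ s < p ∧ w s = i + 1).card)
    (H : Coverable r A w s) : Coverable r A (Function.update w p (i + 1)) s := by
  classical
  have hcard : ∀ q j : ℤ, ((A.image Neg.neg).filter fun s => -p < s ∧ s ≤ q ∧ - w (-s) = -j).card =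
      (A.filter fun s => -q ≤ s ∧ s < p ∧ w s = j).card := by
    intro q j
    rw [← Finset.card_image_of_injective (A.filter fun s => -q ≤ s ∧ s < p ∧ w s = j)
      neg_injective]
    congr 1
    ext x
    simp only [Finset.mem_filter, Finset.mem_image]
    constructor
    · rintro ⟨⟨y, hy, rfl⟩, h1, h2, h3⟩
      rw [neg_neg] at h3
      exact ⟨y, ⟨hy, by omega, by omega, by omega⟩, rfl⟩
    · rintro ⟨y, ⟨hy, h1, h2, h3⟩, rfl⟩
      refine ⟨⟨y, hy, rfl⟩, by omega, by omega, ?_⟩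
      rw [neg_neg, h3]
  -- In the negated word the letter at `-p` is `-i = -(i + 1) + 1`, and it has to become `-(i + 1)`.
  have h1 := H.neg.update_down (p := -p) (i := -(i + 1)) (by rw [neg_neg, hp]; ring) (by
    intro q hq
    have h2 := hcard q i
    have h3 := hcard q (i + 1)
    have h4 := hcount (-q) (by omega)
    rw [← h2, ← h3] at h4
    simpa using h4)
  have h5 := h1.neg
  have hA : (A.image Neg.neg).image Neg.neg = A := by
    rw [Finset.image_image]
    simp
  rw [hA] at h5
  refine h5.congr fun q _ => ?_
  by_cases hq : q = p
  · subst hq; simp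
  · rw [Function.update_of_ne hq, Function.update_of_ne (by omega)]
    simp

/-! ## Jeu de taquin on fillings -/

/-- The values in `(lo, N]` fill the cells of `D` bijectively, increasing along rows and columns;
`w` maps each value to its row. -/
structure Filling (D : ℕ → ℕ → Prop) (lo N : ℤ) (F : ℕ → ℕ → ℤ) (w : ℤ → ℤ) : Prop where
  range : ∀ r c, D r c → lo < F r c ∧ F r c ≤ N
  row : ∀ r c c', D r c → D r c' → c < c' → F r c < F r c'
  col : ∀ r r' c, D r c → D r' c → r < r' → F r c < F r' c
  word : ∀ r c, D r c → w (F r c) = r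
  surj : ∀ q, lo < q → q ≤ N → ∃ r c, D r c ∧ F r c = q

theorem Filling.inj {D : ℕ → ℕ → Prop} {lo N : ℤ} {F : ℕ → ℕ → ℤ} {w : ℤ → ℤ}
    (H : Filling D lo N F w) {r c r' c' : ℕ} (h : D r c) (h' : D r' c') (e : F r c = F r' c') :
    r = r' ∧ c = c' := by
  have h1 := H.word _ _ h
  rw [e, H.word _ _ h'] at h1
  have h2 : r' = r := by exact_mod_cast h1
  subst h2
  refine ⟨rfl, ?_⟩
  rcases lt_trichotomy c c' with h3 | h3 | h3
  · have := H.row _ _ _ h h' h3; omega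
  · exact h3
  · have := H.row _ _ _ h' h h3; omega

/-- The number of positions that `r` antitone functions can cover in the row word of a filling whose
columns are initial segments with respect to the order `σ 0, σ 1, …` of the rows. -/
theorem Filling.coverable_iff {D : ℕ → ℕ → Prop} {lo N : ℤ} {F : ℕ → ℕ → ℤ} {w : ℤ → ℤ}
    (H : Filling D lo N F w) {n k : ℕ} {σ : ℕ → ℕ} (hσ : Set.InjOn σ (Set.Iio n))
    (hDσ : ∀ x c, D x c → ∃ a < n, σ a = x) (hDk : ∀ x c, D x c → c < k)
    (hdown : ∀ a a' c, a ≤ a' → a' < n → D (σ a') c → D (σ a) c) (l : ℕ → ℕ)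
    (hl : ∀ a < n, ∀ [DecidablePred fun c => D (σ a) c],
      l a = ((Finset.range k).filter fun c => D (σ a) c).card)
    {r : ℕ} (hr : r ≤ n) (s : ℕ) :
    Coverable r (Finset.Ioc lo N) w s ↔ s ≤ ∑ a ∈ Finset.range r, l a := by
  classical
  have hl' : ∀ a ∈ Finset.range r, l a = ((Finset.range k).filter fun c => D (σ a) c).card :=
    fun a ha => hl a (by have := Finset.mem_range.1 ha; omega)
  rw [Finset.sum_congr rfl hl']
  constructor
  · rintro ⟨h, hh, hs⟩
    refine hs.trans ?_
    have hcell : ∀ q, ∃ x c, q ∈ coverSet r (Finset.Ioc lo N) w h → D x c ∧ F x c = q := by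
      intro q
      by_cases hq : q ∈ coverSet r (Finset.Ioc lo N) w h
      · have h1 := Finset.mem_Ioc.1 (mem_coverSet.1 hq).1
        obtain ⟨x, c, h2⟩ := H.surj q h1.1 h1.2
        exact ⟨x, c, fun _ => h2⟩
      · exact ⟨0, 0, fun h => absurd h hq⟩
    choose ρ κ hcell using hcell
    have hmaps : Set.MapsTo κ (coverSet r (Finset.Ioc lo N) w h) (Finset.range k) := by
      intro q hq
      exact Finset.mem_coe.2 (Finset.mem_range.2 (hDk _ _ (hcell q hq).1))
    -- Both sides are counted by columns: in each column, the covered entries have to be bounded by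
    -- the number of rows `σ a` with `a < r` that meet it.
    rw [Finset.card_eq_sum_card_fiberwise hmaps]
    have hswap : ∑ a ∈ Finset.range r, ((Finset.range k).filter fun c => D (σ a) c).card =
        ∑ c ∈ Finset.range k, ((Finset.range r).filter fun a => D (σ a) c).card := by
      simp only [Finset.card_filter]
      exact Finset.sum_comm
    rw [hswap]
    refine Finset.sum_le_sum fun c _ => ?_
    have hρ : ∀ q ∈ coverSet r (Finset.Ioc lo N) w h, w q = ρ q := by
      intro q hq
      have h1 := H.word _ _ (hcell q hq).1
      rwa [(hcell q hq).2] at h1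
    have hdet : ∀ q ∈ coverSet r (Finset.Ioc lo N) w h, ∀ q' ∈ coverSet r (Finset.Ioc lo N) w h,
        κ q = κ q' → ρ q = ρ q' → q = q' := by
      intro q hq q' hq' h1 h2
      rw [← (hcell q hq).2, ← (hcell q' hq').2, h1, h2]
    -- If the column meets all `r` rows, the bound is `r`. Down a column the entries and their
    -- letters both increase strictly, so an antitone function covers at most one entry of it.
    by_cases hall : ∀ a < r, D (σ a) c
    · rw [Finset.filter_true_of_mem fun a ha => hall a (Finset.mem_range.1 ha), Finset.card_range]
      have hidx : ∀ q, ∃ a, q ∈ coverSet r (Finset.Ioc lo N) w h → a < r ∧ h a q = w q := by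
        intro q
        by_cases hq : q ∈ coverSet r (Finset.Ioc lo N) w h
        · obtain ⟨a, ha⟩ := (mem_coverSet.1 hq).2
          exact ⟨a, fun _ => ha⟩
        · exact ⟨0, fun h => absurd h hq⟩
      choose α hα using hidx
      refine (Finset.card_le_card_of_injOn (t := Finset.range r) α ?_ ?_).trans_eq
        (Finset.card_range r)
      · intro q hq
        rw [Finset.mem_coe, Finset.mem_filter] at hq
        exact Finset.mem_coe.2 (Finset.mem_range.2 (hα q hq.1).1)
      · have key : ∀ q ∈ coverSet r (Finset.Ioc lo N) w h,
            ∀ q' ∈ coverSet r (Finset.Ioc lo N) w h, κ q = κ q' → α q = α q' → q ≤ q' → q = q' := by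
          intro q hq q' hq' hk ha hle
          refine hdet q hq q' hq' hk ?_
          have h1 := hh _ (hα q hq).1 hle
          rw [(hα q hq).2, ha, (hα q' hq').2, hρ q hq, hρ q' hq'] at h1
          by_contra hne
          have h2 : ρ q' < ρ q := by omega
          have h3 := H.col _ _ (κ q) (hk ▸ (hcell q' hq').1) (hcell q hq).1 h2
          rw [(hcell q hq).2, hk, (hcell q' hq').2] at h3
          omega
        intro q hq q' hq' ha
        rw [Finset.mem_coe, Finset.mem_filter] at hq hq'
        rcases le_total q q' with hle | hle
        · exact key q hq.1 q' hq'.1 (hq.2.trans hq'.2.symm) ha hle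
        · exact (key q' hq'.1 q hq.1 (hq'.2.trans hq.2.symm) ha.symm hle).symm
    -- Otherwise the column is confined to rows `σ a` with `a < a₀ < r`, and even the number of all
    -- its cells satisfies the bound.
    · push Not at hall
      obtain ⟨a₀, ha₀, hn⟩ := hall
      have hidx : ∀ q, ∃ a, q ∈ coverSet r (Finset.Ioc lo N) w h → a < n ∧ σ a = ρ q := by
        intro q
        by_cases hq : q ∈ coverSet r (Finset.Ioc lo N) w h
        · obtain ⟨a, ha⟩ := hDσ _ _ (hcell q hq).1
          exact ⟨a, fun _ => ha⟩
        · exact ⟨0, fun h => absurd h hq⟩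
      choose α hα using hidx
      refine Finset.card_le_card_of_injOn α ?_ ?_
      · intro q hq
        rw [Finset.mem_coe, Finset.mem_filter] at hq
        have h1 := (hcell q hq.1).1
        rw [hq.2, ← (hα q hq.1).2] at h1
        have h2 : α q < a₀ := by
          by_contra h3
          exact hn (hdown _ _ _ (not_lt.1 h3) (hα q hq.1).1 h1)
        simp only [Finset.coe_filter, Finset.mem_range, Set.mem_ofPred_eq]
        exact ⟨by omega, h1⟩
      · intro q hq q' hq' ha
        rw [Finset.mem_coe, Finset.mem_filter] at hq hq'
        refine hdet q hq.1 q' hq'.1 (hq.2.trans hq'.2.symm) ?_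
        rw [← (hα q hq.1).2, ← (hα q' hq'.1).2, ha]
  · intro hs
    -- The constant functions cover the rows `σ 0, …, σ (r - 1)` completely, which attains the
    -- bound.
    refine ⟨fun a _ => (σ a : ℤ), fun a _ => antitone_const, hs.trans ?_⟩
    rw [← Finset.card_sigma]
    refine Finset.card_le_card_of_injOn (fun x => F (σ x.1) x.2) ?_ ?_
    · rintro ⟨a, c⟩ hx
      simp only [Finset.coe_sigma, Set.mem_sigma_iff, Finset.mem_coe, Finset.mem_range,
        Finset.mem_filter] at hx
      rw [Finset.mem_coe, mem_coverSet, Finset.mem_Ioc]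
      exact ⟨H.range _ _ hx.2.2, a, hx.1, (H.word _ _ hx.2.2).symm⟩
    · rintro ⟨a, c⟩ hx ⟨a', c'⟩ hx' e
      simp only [Finset.coe_sigma, Set.mem_sigma_iff, Finset.mem_coe, Finset.mem_range,
        Finset.mem_filter] at hx hx'
      obtain ⟨h1, rfl⟩ := H.inj hx.2.2 hx'.2.2 e
      obtain rfl := hσ (show a < n by omega) (show a' < n by omega) h1
      rfl

/-- The cells of the shape with row lengths `L`, except the cell `(r₀, c₀)`. -/
def holed (L : ℕ → ℕ) (r₀ c₀ : ℕ) (r c : ℕ) : Prop := c < L r ∧ ¬ (r = r₀ ∧ c = c₀)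

theorem setCell_self (T : ℕ → ℕ → ℤ) (r c : ℕ) (v : ℤ) : setCell T r c v r c = v := by
  simp [setCell]

theorem setCell_of_ne {T : ℕ → ℕ → ℤ} {r c : ℕ} {v : ℤ} {r' c' : ℕ} (h : ¬ (r' = r ∧ c' = c)) :
    setCell T r c v r' c' = T r' c' := by
  simp [setCell, h]

section Slides

variable {L : ℕ → ℕ} {r₀ c₀ : ℕ} {lo N : ℤ} {F : ℕ → ℕ → ℤ} {w : ℤ → ℤ}

/-- The moved value stays in its row, so the word is the same. Entries above its new cell are
smaller because they precede the entries of the next column; entries below are larger by the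
comparison `hlt`. -/
theorem Filling.slide_right (hL : Antitone L) (H : Filling (holed L r₀ c₀) lo N F w)
    (hc : c₀ + 1 < L r₀) (hlt : c₀ < L (r₀ + 1) → F r₀ (c₀ + 1) < F (r₀ + 1) c₀) :
    Filling (holed L r₀ (c₀ + 1)) lo N (setCell F r₀ c₀ (F r₀ (c₀ + 1))) w := by
  have hb : holed L r₀ c₀ r₀ (c₀ + 1) := ⟨hc, by omega⟩
  have hcell : ∀ r c, holed L r₀ (c₀ + 1) r c → ¬ (r = r₀ ∧ c = c₀) →
      holed L r₀ c₀ r c ∧ setCell F r₀ c₀ (F r₀ (c₀ + 1)) r c = F r c :=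
    fun r c h h' => ⟨⟨h.1, h'⟩, setCell_of_ne h'⟩
  constructor
  · intro r c h
    by_cases h0 : r = r₀ ∧ c = c₀
    · rw [h0.1, h0.2, setCell_self]; exact H.range _ _ hb
    · rw [(hcell r c h h0).2]; exact H.range _ _ (hcell r c h h0).1
  · intro r c c' h h' hcc
    have h2 := h.2
    have h2' := h'.2
    by_cases h0 : r = r₀ ∧ c = c₀
    · rw [(hcell r c' h' (by omega)).2, h0.1, h0.2, setCell_self]
      rw [h0.1] at h' h2'
      exact H.row _ _ _ hb (hcell r₀ c' h' (by omega)).1 (by omega)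
    · rw [(hcell r c h h0).2]
      by_cases h1 : r = r₀ ∧ c' = c₀
      · rw [h1.1, h1.2, setCell_self]
        have := (hcell r c h h0).1
        rw [h1.1] at this
        exact H.row _ _ _ this hb (by omega)
      · rw [(hcell r c' h' h1).2]
        exact H.row _ _ _ (hcell r c h h0).1 (hcell r c' h' h1).1 hcc
  · intro r r' c h h' hrr
    by_cases h0 : r = r₀ ∧ c = c₀
    · have h3 := hcell r' c h' (by omega)
      rw [h3.2, h0.1, h0.2, setCell_self]
      rw [h0.2] at h3 h'
      have h4 : c₀ < L (r₀ + 1) := lt_of_lt_of_le h'.1 (hL (by omega))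
      refine (hlt h4).trans_le ?_
      rcases eq_or_lt_of_le (show r₀ + 1 ≤ r' by omega) with h5 | h5
      · rw [h5]
      · exact (H.col _ _ _ ⟨h4, by omega⟩ h3.1 h5).le
    · rw [(hcell r c h h0).2]
      by_cases h1 : r' = r₀ ∧ c = c₀
      · have h3 := (hcell r c h h0).1
        rw [h1.1, h1.2, setCell_self]
        rw [h1.2] at h3
        have h4 : holed L r₀ c₀ r (c₀ + 1) := ⟨hc.trans_le (hL (by omega)), by omega⟩
        exact (H.row _ _ _ h3 h4 (by omega)).trans (H.col _ _ _ h4 hb (by omega))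
      · rw [(hcell r' c h' h1).2]
        exact H.col _ _ _ (hcell r c h h0).1 (hcell r' c h' h1).1 hrr
  · intro r c h
    by_cases h0 : r = r₀ ∧ c = c₀
    · rw [h0.1, h0.2, setCell_self]; exact H.word _ _ hb
    · rw [(hcell r c h h0).2]; exact H.word _ _ (hcell r c h h0).1
  · intro q h1 h2
    obtain ⟨r, c, h3, h4⟩ := H.surj q h1 h2
    by_cases h0 : r = r₀ ∧ c = c₀ + 1
    · refine ⟨r₀, c₀, ⟨by omega, by omega⟩, ?_⟩
      rw [setCell_self, ← h4, h0.1, h0.2]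
    · exact ⟨r, c, ⟨h3.1, h0⟩, by rw [setCell_of_ne h3.2, h4]⟩

/-- The moved value changes its row, so exactly one letter of the word drops by one. -/
theorem Filling.slide_down (hL : Antitone L) (H : Filling (holed L r₀ c₀) lo N F w)
    (hc : c₀ < L (r₀ + 1)) (hlt : c₀ + 1 < L r₀ → F (r₀ + 1) c₀ < F r₀ (c₀ + 1)) :
    Filling (holed L (r₀ + 1) c₀) lo N (setCell F r₀ c₀ (F (r₀ + 1) c₀))
      (Function.update w (F (r₀ + 1) c₀) r₀) := by
  have hb : holed L r₀ c₀ (r₀ + 1) c₀ := ⟨hc, by omega⟩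
  have hcell : ∀ r c, holed L (r₀ + 1) c₀ r c → ¬ (r = r₀ ∧ c = c₀) →
      holed L r₀ c₀ r c ∧ setCell F r₀ c₀ (F (r₀ + 1) c₀) r c = F r c :=
    fun r c h h' => ⟨⟨h.1, h'⟩, setCell_of_ne h'⟩
  constructor
  · intro r c h
    by_cases h0 : r = r₀ ∧ c = c₀
    · rw [h0.1, h0.2, setCell_self]; exact H.range _ _ hb
    · rw [(hcell r c h h0).2]; exact H.range _ _ (hcell r c h h0).1
  · intro r c c' h h' hcc
    by_cases h0 : r = r₀ ∧ c = c₀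
    · have h3 := hcell r c' h' (by omega)
      rw [h3.2, h0.1, h0.2, setCell_self]
      rw [h0.1] at h3 h'
      have h4 : c₀ + 1 < L r₀ := lt_of_le_of_lt (by omega) h'.1
      refine (hlt h4).trans_le ?_
      rcases eq_or_lt_of_le (show c₀ + 1 ≤ c' by omega) with h5 | h5
      · rw [h5]
      · exact (H.row _ _ _ ⟨h4, by omega⟩ h3.1 h5).le
    · rw [(hcell r c h h0).2]
      by_cases h1 : r = r₀ ∧ c' = c₀
      · have h3 := (hcell r c h h0).1
        rw [h1.1, h1.2, setCell_self]
        rw [h1.1] at h3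
        have h4 : holed L r₀ c₀ (r₀ + 1) c := ⟨by omega, by omega⟩
        exact (H.col _ _ _ h3 h4 (by omega)).trans (H.row _ _ _ h4 hb (by omega))
      · rw [(hcell r c' h' h1).2]
        exact H.row _ _ _ (hcell r c h h0).1 (hcell r c' h' h1).1 hcc
  · intro r r' c h h' hrr
    have h2' := h'.2
    by_cases h0 : r = r₀ ∧ c = c₀
    · have h3 := hcell r' c h' (by omega)
      rw [h3.2, h0.1, h0.2, setCell_self]
      rw [h0.2] at h3
      exact H.col _ _ _ hb h3.1 (by omega)
    · rw [(hcell r c h h0).2]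
      by_cases h1 : r' = r₀ ∧ c = c₀
      · have h3 := (hcell r c h h0).1
        rw [h1.1, h1.2, setCell_self]
        rw [h1.2] at h3
        exact H.col _ _ _ h3 hb (by omega)
      · rw [(hcell r' c h' h1).2]
        exact H.col _ _ _ (hcell r c h h0).1 (hcell r' c h' h1).1 hrr
  · intro r c h
    by_cases h0 : r = r₀ ∧ c = c₀
    · rw [h0.1, h0.2, setCell_self, Function.update_self]
    · rw [(hcell r c h h0).2, Function.update_of_ne]
      · exact H.word _ _ (hcell r c h h0).1
      · intro e
        exact h.2 (H.inj (hcell r c h h0).1 hb e)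
  · intro q h1 h2
    obtain ⟨r, c, h3, h4⟩ := H.surj q h1 h2
    by_cases h0 : r = r₀ + 1 ∧ c = c₀
    · refine ⟨r₀, c₀, ⟨hc.trans_le (hL (by omega)), by omega⟩, ?_⟩
      rw [setCell_self, ← h4, h0.1, h0.2]
    · exact ⟨r, c, ⟨h3.1, h0⟩, by rw [setCell_of_ne h3.2, h4]⟩

/-- The two directions lower and raise one letter. The counting hypotheses hold because columns
increase: to the right of the hole, entries of row `r₀ + 1` are matched with the entries above them,
to the left of the hole, entries of row `r₀` with those below. The bound `j` allows the comparison
of shapes to be made again after each later round. -/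
theorem Filling.coverable_slide_down (hL : Antitone L) (H : Filling (holed L r₀ c₀) lo N F w)
    (hc : c₀ < L (r₀ + 1)) (hlt : c₀ + 1 < L r₀ → F (r₀ + 1) c₀ < F r₀ (c₀ + 1))
    {j : ℤ} (hj : lo ≤ j) (r s : ℕ) :
    Coverable r (Finset.Ioc j N) w s ↔
      Coverable r (Finset.Ioc j N) (Function.update w (F (r₀ + 1) c₀) r₀) s := by
  classical
  set p := F (r₀ + 1) c₀ with hp
  have hb : holed L r₀ c₀ (r₀ + 1) c₀ := ⟨hc, by omega⟩
  have hwp : w p = (r₀ : ℤ) + 1 := by rw [hp, H.word _ _ hb]; push_cast; rfl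
  by_cases hpj : p ≤ j
  · have : ∀ q ∈ Finset.Ioc j N, w q = Function.update w p r₀ q := by
      intro q hq
      have := (Finset.mem_Ioc.1 hq).1
      rw [Function.update_of_ne (by omega)]
    exact ⟨Coverable.congr this, Coverable.congr fun q hq => (this q hq).symm⟩
  have hlive : ∀ c, c < L (r₀ + 1) → c < L r₀ := fun c h => h.trans_le (hL (by omega))
  have hcell : ∀ q, q ∈ Finset.Ioc j N → ∀ x : ℕ, w q = x →
      ∃ c, holed L r₀ c₀ x c ∧ F x c = q := by
    intro q hq x hx
    rw [Finset.mem_Ioc] at hq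
    obtain ⟨x', c, h1, h2⟩ := H.surj q (by omega) hq.2
    have h3 := H.word _ _ h1
    rw [h2, hx] at h3
    obtain rfl : x = x' := by exact_mod_cast h3
    exact ⟨c, h1, h2⟩
  constructor
  · refine Coverable.update_down hwp fun q hq => ?_
    -- The letters `r₀ + 1` in `(p, q]` sit in the columns of `C`. The entries above them are
    -- smaller than they are, and still exceed `p`, since already `F r₀ (c₀ + 1)` does.
    let C := (Finset.range (L (r₀ + 1))).filter fun c => c₀ < c ∧ F (r₀ + 1) c ≤ q
    have hC : ∀ c ∈ C, c < L (r₀ + 1) ∧ c₀ < c ∧ F (r₀ + 1) c ≤ q := fun c h => by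
      simpa [C] using h
    have h1 : ((Finset.Ioc j N).filter fun s => p < s ∧ s ≤ q ∧ w s = (r₀ : ℤ) + 1) ⊆
        C.image (F (r₀ + 1)) := by
      intro s hs
      rw [Finset.mem_filter] at hs
      obtain ⟨c, h2, h3⟩ := hcell s hs.1 (r₀ + 1) (by rw [hs.2.2.2]; push_cast; rfl)
      refine Finset.mem_image.2 ⟨c, ?_, h3⟩
      simp only [C, Finset.mem_filter, Finset.mem_range]
      refine ⟨h2.1, ?_, by omega⟩
      by_contra h4
      rcases eq_or_lt_of_le (not_lt.1 h4) with h5 | h5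
      · rw [h5] at h3; omega
      · have := H.row _ _ _ h2 hb h5; omega
    have h2 : C.image (F r₀) ⊆
        ((Finset.Ioc j N).filter fun s => p < s ∧ s ≤ q ∧ w s = (r₀ : ℤ)) := by
      intro s hs
      obtain ⟨c, hcC, rfl⟩ := Finset.mem_image.1 hs
      obtain ⟨h3, h4, h5⟩ := hC c hcC
      have h6 : holed L r₀ c₀ r₀ c := ⟨hlive c h3, by omega⟩
      have h7 : holed L r₀ c₀ r₀ (c₀ + 1) := ⟨by have := h6.1; omega, by omega⟩
      have h8 := hlt h7.1
      have h9 : F r₀ (c₀ + 1) ≤ F r₀ c := by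
        rcases eq_or_lt_of_le (show c₀ + 1 ≤ c by omega) with h5 | h5
        · rw [h5]
        · exact (H.row _ _ _ h7 h6 h5).le
      have h10 := H.col _ _ _ h6 (⟨h3, by omega⟩ : holed L r₀ c₀ (r₀ + 1) c) (by omega)
      rw [Finset.mem_filter, Finset.mem_Ioc]
      exact ⟨⟨by omega, (H.range _ _ h6).2⟩, by omega, by omega, H.word _ _ h6⟩
    have h3 : (C.image (F r₀)).card = C.card := by
      refine Finset.card_image_of_injOn fun c h c' h' e => ?_
      have h4 := hC c h
      have h5 := hC c' h'
      exact (H.inj (⟨hlive c h4.1, by omega⟩ : holed L r₀ c₀ r₀ c)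
        (⟨hlive c' h5.1, by omega⟩ : holed L r₀ c₀ r₀ c') e).2
    calc _ ≤ _ := Finset.card_le_card h1
      _ ≤ C.card := Finset.card_image_le
      _ = _ := h3.symm
      _ ≤ _ := Finset.card_le_card h2
  · intro h
    have hback : Function.update (Function.update w p (r₀ : ℤ)) p ((r₀ : ℤ) + 1) = w := by
      rw [Function.update_idem, ← hwp, Function.update_eq_self]
    rw [← hback]
    refine h.update_up (Function.update_self _ _ _) fun q hq => ?_
    -- The letters `r₀` in `[q, p)` lie to the left of the hole, as `F r₀ (c₀ + 1)` exceeds `p`. The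
    -- entries below them are larger and precede `p` in row `r₀ + 1`.
    let C := (Finset.range c₀).filter fun c => q ≤ F r₀ c ∧ j < F r₀ c
    have hC : ∀ c ∈ C, c < c₀ ∧ q ≤ F r₀ c ∧ j < F r₀ c := fun c h => by
      simpa [C] using h
    have h1 : ((Finset.Ioc j N).filter fun s => q ≤ s ∧ s < p ∧
        Function.update w p (r₀ : ℤ) s = (r₀ : ℤ)) ⊆ C.image (F r₀) := by
      intro s hs
      rw [Finset.mem_filter] at hs
      rw [Function.update_of_ne (by omega)] at hs
      obtain ⟨c, h2, h3⟩ := hcell s hs.1 r₀ hs.2.2.2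
      have hjs := Finset.mem_Ioc.1 hs.1
      refine Finset.mem_image.2 ⟨c, ?_, h3⟩
      simp only [C, Finset.mem_filter, Finset.mem_range]
      refine ⟨?_, by omega, by omega⟩
      by_contra h4
      have h5 := h2.2
      have h7 : holed L r₀ c₀ r₀ (c₀ + 1) := ⟨by have := h2.1; omega, by omega⟩
      have h8 := hlt h7.1
      have h9 : F r₀ (c₀ + 1) ≤ F r₀ c := by
        rcases eq_or_lt_of_le (show c₀ + 1 ≤ c by omega) with h5 | h5
        · rw [h5]
        · exact (H.row _ _ _ h7 h2 h5).le
      omega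
    have h2 : C.image (F (r₀ + 1)) ⊆ ((Finset.Ioc j N).filter fun s => q ≤ s ∧ s < p ∧
        Function.update w p (r₀ : ℤ) s = (r₀ : ℤ) + 1) := by
      intro s hs
      obtain ⟨c, hcC, rfl⟩ := Finset.mem_image.1 hs
      obtain ⟨h3, h4, h5⟩ := hC c hcC
      have h6 : holed L r₀ c₀ (r₀ + 1) c := ⟨by omega, by omega⟩
      have h7 : holed L r₀ c₀ r₀ c := ⟨hlive c h6.1, by omega⟩
      have h8 := H.row _ _ _ h6 hb h3
      have h9 := H.col _ _ _ h7 h6 (by omega)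
      rw [Finset.mem_filter, Finset.mem_Ioc, Function.update_of_ne (by omega)]
      refine ⟨⟨by omega, (H.range _ _ h6).2⟩, by omega, by omega, ?_⟩
      rw [H.word _ _ h6]; push_cast; rfl
    have h3 : (C.image (F (r₀ + 1))).card = C.card := by
      refine Finset.card_image_of_injOn fun c h c' h' e => ?_
      have h4 := hC c h
      have h5 := hC c' h'
      exact (H.inj (⟨by omega, by omega⟩ : holed L r₀ c₀ (r₀ + 1) c)
        (⟨by omega, by omega⟩ : holed L r₀ c₀ (r₀ + 1) c') e).2
    calc _ ≤ _ := Finset.card_le_card h1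
      _ ≤ C.card := Finset.card_image_le
      _ = _ := h3.symm
      _ ≤ _ := Finset.card_le_card h2

end Slides

/-! ### One round of evacuation -/

/-- The state after some jeu de taquin slides of one round: everything but the cell of the hole is
filled, dead cells are untouched, and the covering numbers of the row word are unchanged. -/
structure SlideInv (L : ℕ → ℕ) (lo N : ℤ) (F₀ : ℕ → ℕ → ℤ) (w₀ : ℤ → ℤ) (s : SlideState) :
    Prop where
  hole : s.c < L s.r
  dead : ∀ r c, L r ≤ c → s.T r c = F₀ r c
  filling : ∃ w, Filling (holed L s.r s.c) lo N s.T w ∧ ∀ j, lo ≤ j → ∀ r t,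
    Coverable r (Finset.Ioc j N) w₀ t ↔ Coverable r (Finset.Ioc j N) w t

/-- Live cells hold values above `lo ≥ 0` and dead cells hold nonpositive ones, so the sign tests of
`jdtStep` decide which neighbors belong to the shape. A hole that cannot move is therefore at an
outer corner. -/
theorem SlideInv.step {L : ℕ → ℕ} {lo N : ℤ} {F₀ : ℕ → ℕ → ℤ} {w₀ : ℤ → ℤ} {s : SlideState}
    (hL : Antitone L) (hlo : 0 ≤ lo) (hdead : ∀ r c, L r ≤ c → F₀ r c ≤ 0)
    (H : SlideInv L lo N F₀ w₀ s) :
    SlideInv L lo N F₀ w₀ (jdtStep s) ∧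
      ((jdtStep s).r + (jdtStep s).c = s.r + s.c + 1 ∨
        (jdtStep s = s ∧ L s.r ≤ s.c + 1 ∧ L (s.r + 1) ≤ s.c)) := by
  obtain ⟨T, r₀, c₀⟩ := s
  obtain ⟨hhole, hd, w, hF, hw⟩ := H
  simp only at hhole hd hF hw
  have ha : c₀ < L (r₀ + 1) ↔ 0 < T (r₀ + 1) c₀ := by
    constructor
    · intro h
      have := (hF.range (r₀ + 1) c₀ ⟨h, by omega⟩).1
      omega
    · intro h
      by_contra h1
      have h2 := hd _ _ (not_lt.1 h1)
      have h3 := hdead _ _ (not_lt.1 h1)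
      omega
  have hb : c₀ + 1 < L r₀ ↔ 0 < T r₀ (c₀ + 1) := by
    constructor
    · intro h
      have := (hF.range r₀ (c₀ + 1) ⟨h, by omega⟩).1
      omega
    · intro h
      by_contra h1
      have h2 := hd _ _ (not_lt.1 h1)
      have h3 := hdead _ _ (not_lt.1 h1)
      omega
  by_cases h1 : 0 < T r₀ (c₀ + 1) ∧ (T (r₀ + 1) c₀ ≤ 0 ∨ T r₀ (c₀ + 1) < T (r₀ + 1) c₀)
  · have e : jdtStep ⟨T, r₀, c₀⟩ = ⟨setCell T r₀ c₀ (T r₀ (c₀ + 1)), r₀, c₀ + 1⟩ := by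
      simp only [jdtStep, h1, and_self, if_true]
    rw [e]
    refine ⟨⟨hb.2 h1.1, fun r c h => ?_, w, ?_, hw⟩, Or.inl (by simp only; omega)⟩
    · simp only
      rw [setCell_of_ne, hd r c h]
      rintro ⟨rfl, rfl⟩; omega
    · refine hF.slide_right hL (hb.2 h1.1) fun h => ?_
      have := ha.1 h
      rcases h1.2 with h2 | h2
      · omega
      · exact h2
  · by_cases h2 : 0 < T (r₀ + 1) c₀
    · have e : jdtStep ⟨T, r₀, c₀⟩ = ⟨setCell T r₀ c₀ (T (r₀ + 1) c₀), r₀ + 1, c₀⟩ := by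
        simp only [jdtStep, h1, h2, if_true, if_false]
      rw [e]
      have hlt : c₀ + 1 < L r₀ → T (r₀ + 1) c₀ < T r₀ (c₀ + 1) := by
        intro h
        have h3 := hb.1 h
        have h4 : T (r₀ + 1) c₀ ≠ T r₀ (c₀ + 1) := by
          intro e
          have := (hF.inj (⟨ha.2 h2, by omega⟩ : holed L r₀ c₀ (r₀ + 1) c₀)
            (⟨h, by omega⟩ : holed L r₀ c₀ r₀ (c₀ + 1)) e).1
          omega
        by_contra h5
        exact h1 ⟨h3, Or.inr (by omega)⟩
      refine ⟨⟨ha.2 h2, fun r c h => ?_, _, hF.slide_down hL (ha.2 h2) hlt, fun j hj r t => ?_⟩,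
        Or.inl (by simp only; omega)⟩
      · simp only
        rw [setCell_of_ne, hd r c h]
        rintro ⟨rfl, rfl⟩; omega
      · rw [hw j hj]
        exact hF.coverable_slide_down hL (ha.2 h2) hlt hj r t
    · have e : jdtStep ⟨T, r₀, c₀⟩ = ⟨T, r₀, c₀⟩ := by
        simp only [jdtStep, h1, h2, if_false]
      rw [e]
      refine ⟨⟨hhole, hd, w, hF, hw⟩, Or.inr ⟨rfl, ?_, ?_⟩⟩
      · by_contra h3
        have h4 := hb.1 (not_le.1 h3)
        exact h1 ⟨h4, Or.inl (not_lt.1 h2)⟩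
      · by_contra h3
        exact h2 (ha.1 (not_le.1 h3))

/-- The sum of the coordinates of the hole grows with every slide until the hole is stuck, which
bounds the number of slides needed. -/
theorem SlideInv.iterate {L : ℕ → ℕ} {lo N : ℤ} {F₀ : ℕ → ℕ → ℤ} {w₀ : ℤ → ℤ} {s : SlideState}
    (hL : Antitone L) (hlo : 0 ≤ lo) (hdead : ∀ r c, L r ≤ c → F₀ r c ≤ 0)
    (H : SlideInv L lo N F₀ w₀ s) (t : ℕ) :
    SlideInv L lo N F₀ w₀ (jdtStep^[t] s) ∧
      ((jdtStep^[t] s).r + (jdtStep^[t] s).c = s.r + s.c + t ∨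
        (jdtStep (jdtStep^[t] s) = jdtStep^[t] s ∧
          L (jdtStep^[t] s).r ≤ (jdtStep^[t] s).c + 1 ∧
            L ((jdtStep^[t] s).r + 1) ≤ (jdtStep^[t] s).c)) := by
  induction t with
  | zero => exact ⟨H, Or.inl rfl⟩
  | succ t ih =>
    rw [Function.iterate_succ_apply']
    obtain ⟨h1, h2⟩ := ih
    obtain ⟨h3, h4⟩ := h1.step hL hlo hdead
    refine ⟨h3, ?_⟩
    rcases h2 with h2 | h2
    · rcases h4 with h4 | h4
      · left; omega
      · right; rw [h4.1]; exact h4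
    · right; rw [h2.1]; exact h2

/-- The state between two rounds of evacuation: a standard filling of the shape with row lengths
`L`, and nonpositive entries elsewhere. -/
structure RoundState (n k : ℕ) (lo N : ℤ) (L : ℕ → ℕ) (F : ℕ → ℕ → ℤ) (w : ℤ → ℤ) : Prop where
  anti : Antitone L
  le_width : ∀ r, L r ≤ k
  height : ∀ r, n ≤ r → L r = 0
  filling : Filling (fun r c => c < L r) lo N F w
  dead : ∀ r c, L r ≤ c → F r c ≤ 0

/-- The northwest entry is the least value `lo + 1`. Without it the shape has a hole, which slides
to an outer corner; that corner is the cell lost in this round. -/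
theorem RoundState.round {n k : ℕ} {lo N : ℤ} {L : ℕ → ℕ} {F : ℕ → ℕ → ℤ} {w : ℤ → ℤ}
    (H : RoundState n k lo N L F w) (hlo : 0 ≤ lo) (hN : lo < N) :
    ∃ r₀ c₀ w', L r₀ = c₀ + 1 ∧
      RoundState n k (lo + 1) N (Function.update L r₀ c₀) (evacStep n k F) w' ∧
      (∀ j, lo + 1 ≤ j → ∀ r t,
        Coverable r (Finset.Ioc j N) w t ↔ Coverable r (Finset.Ioc j N) w' t) ∧
      (∀ r c, L r ≤ c → evacStep n k F r c = F r c) ∧ evacStep n k F r₀ c₀ = -(lo + 1) := by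
  have hF := H.filling
  obtain ⟨r₁, c₁, h1, h2⟩ := hF.surj (lo + 1) (by omega) (by omega)
  have hmin : ∀ r c, c < L r → F 0 0 ≤ F r c := by
    intro r c h
    have h3 : 0 < L r := by omega
    have h4 : 0 < L 0 := h3.trans_le (H.anti (Nat.zero_le r))
    have h5 : F 0 0 ≤ F r 0 := by
      rcases Nat.eq_zero_or_pos r with rfl | h6
      · exact le_rfl
      · exact (hF.col _ _ _ h4 h3 h6).le
    refine h5.trans ?_
    rcases Nat.eq_zero_or_pos c with rfl | h6
    · exact le_rfl
    · exact (hF.row _ _ _ h3 h h6).le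
  have h00 : 0 < L 0 := lt_of_le_of_lt (Nat.zero_le c₁) (h1.trans_le (H.anti (Nat.zero_le r₁)))
  have hF00 : F 0 0 = lo + 1 := by
    have h3 := hmin _ _ h1
    have h4 := (hF.range _ _ h00).1
    omega
  have hfill : Filling (holed L 0 0) (lo + 1) N F w := by
    refine ⟨?_, ?_, ?_, ?_, ?_⟩
    · intro r c h
      have h3 := hF.range _ _ h.1
      refine ⟨lt_of_le_of_ne (by omega) fun e => h.2 ?_, h3.2⟩
      exact hF.inj h.1 h00 (by rw [← e, hF00])
    · exact fun r c c' h h' => hF.row _ _ _ h.1 h'.1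
    · exact fun r r' c h h' => hF.col _ _ _ h.1 h'.1
    · exact fun r c h => hF.word _ _ h.1
    · intro q h3 h4
      obtain ⟨r, c, h5, h6⟩ := hF.surj q (by omega) h4
      refine ⟨r, c, ⟨h5, ?_⟩, h6⟩
      rintro ⟨rfl, rfl⟩
      omega
  have hinit : SlideInv L (lo + 1) N F w ⟨F, 0, 0⟩ :=
    ⟨h00, fun _ _ _ => rfl, w, hfill, fun _ _ _ _ => Iff.rfl⟩
  obtain ⟨hinv, hlast⟩ := hinit.iterate H.anti (by omega) H.dead (n + k)
  set s := jdtStep^[n + k] ⟨F, 0, 0⟩ with hs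
  have hev : evacStep n k F = setCell s.T s.r s.c (-(lo + 1)) := by
    rw [← hF00]; rfl
  obtain ⟨hhole, hd, w', hw', hcov⟩ := hinv
  have hrn : s.r < n := by
    by_contra h
    have := H.height _ (not_lt.1 h)
    omega
  have hck := hhole.trans_le (H.le_width s.r)
  -- The hole is inside the rectangle, so its coordinates cannot add up to `n + k`; it must have got
  -- stuck.
  have hcorner : L s.r ≤ s.c + 1 ∧ L (s.r + 1) ≤ s.c := by
    rcases hlast with h | h
    · simp only at h; omega
    · exact h.2
  have hLr : L s.r = s.c + 1 := by omega
  have hiff : ∀ r c, c < Function.update L s.r s.c r ↔ holed L s.r s.c r c := by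
    intro r c
    unfold holed
    by_cases h : r = s.r
    · subst h; rw [Function.update_self]; constructor
      · intro h; exact ⟨by omega, by omega⟩
      · intro h; have := h.2; omega
    · rw [Function.update_of_ne h]; constructor
      · intro h'; exact ⟨h', fun h'' => h h''.1⟩
      · exact fun h => h.1
  have hcell : ∀ r c, holed L s.r s.c r c → evacStep n k F r c = s.T r c := by
    intro r c h
    rw [hev, setCell_of_ne h.2]
  refine ⟨s.r, s.c, w', hLr, ⟨?_, ?_, ?_, ⟨?_, ?_, ?_, ?_, ?_⟩, ?_⟩, hcov, ?_, ?_⟩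
  · refine antitone_nat_of_succ_le fun r => ?_
    have h3 := H.anti (Nat.le_succ r)
    by_cases h : r = s.r
    · subst h
      rw [Function.update_self, Function.update_of_ne (by omega)]; exact hcorner.2
    · rw [Function.update_of_ne h]
      by_cases h' : r + 1 = s.r
      · rw [h', Function.update_self]; rw [Nat.succ_eq_add_one, h'] at h3; omega
      · rw [Function.update_of_ne h']; exact h3
  · intro r
    by_cases h : r = s.r
    · subst h; rw [Function.update_self]; omega
    · rw [Function.update_of_ne h]; exact H.le_width r
  · intro r hr
    rw [Function.update_of_ne (by omega)]; exact H.height r hr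
  · intro r c h
    rw [hiff] at h; rw [hcell _ _ h]; exact hw'.range _ _ h
  · intro r c c' h h'
    rw [hiff] at h h'; rw [hcell _ _ h, hcell _ _ h']; exact hw'.row _ _ _ h h'
  · intro r r' c h h'
    rw [hiff] at h h'; rw [hcell _ _ h, hcell _ _ h']; exact hw'.col _ _ _ h h'
  · intro r c h
    rw [hiff] at h; rw [hcell _ _ h]; exact hw'.word _ _ h
  · intro q h3 h4
    obtain ⟨r, c, h5, h6⟩ := hw'.surj q h3 h4
    exact ⟨r, c, (hiff r c).2 h5, by rw [hcell _ _ h5, h6]⟩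
  · intro r c h
    by_cases h3 : r = s.r ∧ c = s.c
    · rw [hev, h3.1, h3.2, setCell_self]; omega
    · have h4 : L r ≤ c := by
        by_contra h5
        have := (hiff r c).2 ⟨not_le.1 h5, h3⟩
        omega
      rw [hev, setCell_of_ne h3, hd r c h4]; exact H.dead r c h4
  · intro r c h
    rw [hev, setCell_of_ne, hd r c h]
    rintro ⟨rfl, rfl⟩; omega
  · rw [hev, setCell_self]

/-! ### Evacuation of rectangles -/

/-- The number of entries greater than `j` in row `r`. -/
noncomputable def rowCount (k : ℕ) (T : ℕ → ℕ → ℤ) (j : ℤ) (r : ℕ) : ℕ :=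
  open Classical in ((Finset.range k).filter fun c => j < T r c).card

theorem IsRectSYT.mem_Icc {n k : ℕ} {T : ℕ → ℕ → ℤ} (H : IsRectSYT n k T) {r c : ℕ} (hr : r < n)
    (hc : c < k) : 1 ≤ T r c ∧ T r c ≤ (n : ℤ) * k :=
  H.bij.1 (show (r, c) ∈ {c : ℕ × ℕ | c.1 < n ∧ c.2 < k} from ⟨hr, hc⟩)

theorem IsRectSYT.exists_cell {n k : ℕ} {T : ℕ → ℕ → ℤ} (H : IsRectSYT n k T) {q : ℤ} (h1 : 1 ≤ q)
    (h2 : q ≤ (n : ℤ) * k) : ∃ r c, r < n ∧ c < k ∧ T r c = q := by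
  obtain ⟨⟨r, c⟩, h3, h4⟩ := H.bij.2.2 (show q ∈ Set.Icc 1 ((n : ℤ) * k) from ⟨h1, h2⟩)
  exact ⟨r, c, h3.1, h3.2, h4⟩

theorem IsRectSYT.inj {n k : ℕ} {T : ℕ → ℕ → ℤ} (H : IsRectSYT n k T) {r c r' c' : ℕ} (hr : r < n)
    (hc : c < k) (hr' : r' < n) (hc' : c' < k) (e : T r c = T r' c') : r = r' ∧ c = c' := by
  have := H.bij.2.1 (show (r, c) ∈ {c : ℕ × ℕ | c.1 < n ∧ c.2 < k} from ⟨hr, hc⟩)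
    (show (r', c') ∈ {c : ℕ × ℕ | c.1 < n ∧ c.2 < k} from ⟨hr', hc'⟩) e
  exact Prod.ext_iff.1 this

/-- The row word of a tableau. -/
theorem IsRectSYT.exists_word {n k : ℕ} {T : ℕ → ℕ → ℤ} (H : IsRectSYT n k T) :
    ∃ w : ℤ → ℤ, ∀ r c, r < n → c < k → w (T r c) = r := by
  have : ∀ q : ℤ, ∃ r : ℕ, ∀ r' c, r' < n → c < k → T r' c = q → r' = r := by
    intro q
    by_cases h : ∃ r c, r < n ∧ c < k ∧ T r c = q
    · obtain ⟨r, c, hr, hc, rfl⟩ := h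
      exact ⟨r, fun r' c' hr' hc' e => (H.inj hr' hc' hr hc e).1⟩
    · exact ⟨0, fun r' c hr' hc e => absurd ⟨r', c, hr', hc, e⟩ h⟩
  choose ρ hρ using this
  exact ⟨fun q => ρ q, fun r c hr hc => congrArg _ (hρ _ r c hr hc rfl).symm⟩

theorem IsRectSYT.filling {n k : ℕ} {T : ℕ → ℕ → ℤ} (H : IsRectSYT n k T) {w : ℤ → ℤ}
    (hw : ∀ r c, r < n → c < k → w (T r c) = r) {j : ℤ} (hj : 0 ≤ j) :
    Filling (fun r c => r < n ∧ c < k ∧ j < T r c) j ((n : ℤ) * k) T w where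
  range _ _ h := ⟨h.2.2, (H.mem_Icc h.1 h.2.1).2⟩
  row _ _ _ h h' hcc := H.row_lt _ _ _ h.1 hcc h'.2.1
  col _ _ _ h h' hrr := H.col_lt _ _ _ hrr h'.1 h.2.1
  word _ _ h := hw _ _ h.1 h.2.1
  surj q h1 h2 := by
    obtain ⟨r, c, hr, hc, h⟩ := H.exists_cell (by omega) h2
    exact ⟨r, c, ⟨hr, hc, by omega⟩, h⟩

/-- Covering numbers determine row lengths, as differences of consecutive partial sums. The slid
tableau has columns justified at the top, so its rows are taken in the order `id`; the entries of
`T` above `j` form columns justified at the bottom, so there the rows are taken from below. -/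
theorem IsRectSYT.rowLength_eq {n k : ℕ} {T : ℕ → ℕ → ℤ} (H : IsRectSYT n k T) {w : ℤ → ℤ}
    (hw : ∀ r c, r < n → c < k → w (T r c) = r) {j : ℤ} (hj : 0 ≤ j) {L : ℕ → ℕ} {F : ℕ → ℕ → ℤ}
    {w' : ℤ → ℤ} (hR : RoundState n k j ((n : ℤ) * k) L F w')
    (hcov : ∀ r t, Coverable r (Finset.Ioc j ((n : ℤ) * k)) w t ↔
      Coverable r (Finset.Ioc j ((n : ℤ) * k)) w' t) {a : ℕ} (ha : a < n) :
    L a = rowCount k T j (n - 1 - a) := by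
  classical
  have h1 : ∀ r ≤ n, ∑ a ∈ Finset.range r, L a =
      ∑ a ∈ Finset.range r, rowCount k T j (n - 1 - a) := by
    intro r hr
    have h2 := hR.filling.coverable_iff (n := n) (k := k) (σ := id) (Set.injOn_id _)
      (fun x c h => ⟨x, by by_contra h'; have := hR.height x (not_lt.1 h'); omega, rfl⟩)
      (fun x c h => h.trans_le (hR.le_width x))
      (fun a a' c h _ h' => lt_of_lt_of_le h' (hR.anti h)) L
      (by
        intro a _ _
        have : ((Finset.range k).filter fun c => c < L (id a)) = Finset.range (L a) := by
          ext c
          have := hR.le_width a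
          simp only [Finset.mem_filter, Finset.mem_range, id]
          omega
        rw [this, Finset.card_range]) hr
    have h3 := (H.filling hw hj).coverable_iff (n := n) (k := k) (σ := fun a => n - 1 - a)
      (fun x hx y hy e => by
        simp only [Set.mem_Iio] at hx hy e; omega)
      (fun x c h => ⟨n - 1 - x, by omega, by omega⟩) (fun x c h => h.2.1)
      (fun a a' c h h' h'' => by
        refine ⟨by omega, h''.2.1, ?_⟩
        rcases eq_or_lt_of_le h with h4 | h4
        · rw [h4]; exact h''.2.2
        · exact h''.2.2.trans (H.col_lt _ _ _ (by omega) (by omega) h''.2.1))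
      (fun a => rowCount k T j (n - 1 - a))
      (by
        intro a ha' _
        unfold rowCount
        congr 1
        ext c
        simp only [Finset.mem_filter, Finset.mem_range]
        constructor
        · rintro ⟨h4, h5⟩; exact ⟨h4, by omega, h4, h5⟩
        · rintro ⟨h4, h5⟩; exact ⟨h4, h5.2.2⟩) hr
    refine le_antisymm ?_ ?_
    · exact (h3 _).1 ((hcov _ _).2 ((h2 _).2 le_rfl))
    · exact (h2 _).1 ((hcov _ _).1 ((h3 _).2 le_rfl))
  have h2 := h1 (a + 1) (by omega)
  rw [Finset.sum_range_succ, Finset.sum_range_succ, h1 a (by omega)] at h2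
  omega

theorem IsRectSYT.rowCount_apply {n k : ℕ} {T : ℕ → ℕ → ℤ} (H : IsRectSYT n k T) {r c : ℕ}
    (hr : r < n) (hc : c < k) : rowCount k T (T r c) r = k - 1 - c := by
  classical
  have : ((Finset.range k).filter fun c' => T r c < T r c') = Finset.Ioo c k := by
    ext c'
    simp only [Finset.mem_filter, Finset.mem_range, Finset.mem_Ioo]
    constructor
    · rintro ⟨h1, h2⟩
      refine ⟨?_, h1⟩
      by_contra h3
      rcases eq_or_lt_of_le (not_lt.1 h3) with rfl | h4
      · omega
      · have := H.row_lt _ _ _ hr h4 hc; omega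
    · rintro ⟨h1, h2⟩; exact ⟨h2, H.row_lt _ _ _ hr h1 h2⟩
  unfold rowCount
  rw [this, Nat.card_Ioo]
  omega

theorem IsRectSYT.rowCount_pred {n k : ℕ} {T : ℕ → ℕ → ℤ} (H : IsRectSYT n k T) {r c : ℕ}
    (hr : r < n) (hc : c < k) : rowCount k T (T r c - 1) r = k - c := by
  classical
  have : ((Finset.range k).filter fun c' => T r c - 1 < T r c') = Finset.Ico c k := by
    ext c'
    simp only [Finset.mem_filter, Finset.mem_range, Finset.mem_Ico]
    constructor
    · rintro ⟨h1, h2⟩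
      refine ⟨?_, h1⟩
      by_contra h3
      have := H.row_lt _ _ _ hr (not_le.1 h3) hc; omega
    · rintro ⟨h1, h2⟩
      refine ⟨h2, ?_⟩
      rcases eq_or_lt_of_le h1 with rfl | h4
      · omega
      · have := H.row_lt _ _ _ hr h4 h2; omega
  unfold rowCount
  rw [this, Nat.card_Ico]

/-- The state after `i` rounds of evacuation. -/
theorem IsRectSYT.rounds {n k : ℕ} {T : ℕ → ℕ → ℤ} (H : IsRectSYT n k T) {w : ℤ → ℤ}
    (hw : ∀ r c, r < n → c < k → w (T r c) = r) (i : ℕ) (hi : i ≤ n * k) :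
    ∃ L w', RoundState n k i ((n : ℤ) * k) L ((evacStep n k)^[i] T) w' ∧
      (∀ j : ℤ, i ≤ j → ∀ r t, Coverable r (Finset.Ioc j ((n : ℤ) * k)) w t ↔
        Coverable r (Finset.Ioc j ((n : ℤ) * k)) w' t) ∧
      ∀ r c, r < n → c < k → T r c ≤ i →
        (evacStep n k)^[i] T (n - 1 - r) (k - 1 - c) = - T r c := by
  classical
  induction i with
  | zero =>
    refine ⟨fun r => if r < n then k else 0, w, ⟨?_, ?_, ?_, ?_, ?_⟩, fun _ _ _ _ => Iff.rfl, ?_⟩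
    · intro a b hab
      simp only
      split_ifs <;> omega
    · intro r; split_ifs <;> omega
    · intro r hr; simp [not_lt.2 hr]
    · have h1 := H.filling hw le_rfl
      have h2 : (fun r c => c < if r < n then k else 0) =
          fun r c => r < n ∧ c < k ∧ (0 : ℤ) < T r c := by
        funext r c
        by_cases hr : r < n
        · simp only [hr, if_true, true_and, eq_iff_iff]
          constructor
          · intro hc; have := (H.mem_Icc hr hc).1; exact ⟨hc, by omega⟩
          · exact fun h => h.1
        · simp [hr]
      rw [h2]
      exact h1
    · intro r c h
      have := H.zeros r c (by rintro ⟨h1, h2⟩; simp only [h1, if_true] at h; omega)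
      exact this.le
    · intro r c hr hc h
      have := (H.mem_Icc hr hc).1
      push_cast at h
      omega
  | succ i ih =>
    obtain ⟨L, w', hR, hcov, hneg⟩ := ih (by omega)
    have hiN : (i : ℤ) < (n : ℤ) * k := by exact_mod_cast hi
    obtain ⟨r₀, c₀, w'', hL, hR', hcov', hdead, hnew⟩ := hR.round (by omega) hiN
    rw [Function.iterate_succ_apply']
    have hcov'' : ∀ j : ℤ, ((i : ℤ) + 1) ≤ j → ∀ r t,
        Coverable r (Finset.Ioc j ((n : ℤ) * k)) w t ↔
        Coverable r (Finset.Ioc j ((n : ℤ) * k)) w'' t := fun j hj r t =>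
      (hcov j (by omega) r t).trans (hcov' j hj r t)
    refine ⟨_, w'', by push_cast; exact hR', by push_cast; exact hcov'', ?_⟩
    intro r c hr hc hle
    push_cast at hle
    have hl1 := fun a (ha : a < n) =>
      H.rowLength_eq hw (Int.natCast_nonneg i) hR (hcov i le_rfl) ha
    have hl2 := fun a (ha : a < n) =>
      H.rowLength_eq hw (by omega) hR' (hcov'' _ le_rfl) ha
    rcases eq_or_lt_of_le hle with he | hlt
    -- When `T r c = i + 1` is removed, the number of larger or equal entries `k - c` in row `r`
    -- gives way to `k - 1 - c`. So the shape loses its last cell in row `n - 1 - r`, at column `k -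
    -- 1 - c`.
    · have h1 := hl1 (n - 1 - r) (by omega)
      have h2 := hl2 (n - 1 - r) (by omega)
      have h3 : n - 1 - (n - 1 - r) = r := by omega
      have h4 := H.rowCount_pred hr hc
      have h5 := H.rowCount_apply hr hc
      rw [he, add_sub_cancel_right] at h4
      rw [he] at h5
      rw [h3, h4] at h1
      rw [h3, h5] at h2
      have h6 : n - 1 - r = r₀ := by
        by_contra h7
        rw [Function.update_of_ne h7] at h2
        omega
      have h8 : k - 1 - c = c₀ := by
        rw [h6] at h1; omega
      rw [h6, h8, hnew, he]
    -- A value removed earlier is stored as a negative number, so its cell is dead and stays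
    -- untouched.
    · have h1 := hneg r c hr hc (by omega)
      rw [hdead, h1]
      by_contra h2
      have h3 := (hR.filling.range _ _ (not_le.1 h2)).1
      have h4 := (H.mem_Icc hr hc).1
      omega

/-- Evacuation of a rectangular tableau is rotation and complementation. -/
theorem IsRectSYT.evacuation_apply {n k : ℕ} {T : ℕ → ℕ → ℤ} (H : IsRectSYT n k T) {r c : ℕ}
    (hr : r < n) (hc : c < k) :
    evacuation n k T r c = (n : ℤ) * k + 1 - T (n - 1 - r) (k - 1 - c) := by
  obtain ⟨w, hw⟩ := H.exists_word
  obtain ⟨L, w', -, -, h⟩ := H.rounds hw (n * k) le_rfl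
  have h1 : n - 1 - r < n := by omega
  have h2 : k - 1 - c < k := by omega
  have h3 := h _ _ h1 h2 (by push_cast; exact (H.mem_Icc h1 h2).2)
  have e1 : n - 1 - (n - 1 - r) = r := by omega
  have e2 : k - 1 - (k - 1 - c) = c := by omega
  rw [e1, e2] at h3
  unfold evacuation
  rw [if_pos ⟨hr, hc⟩, h3]
  ring

/-! ## Noncrossing pairings of two rows -/

/-- `P` is a noncrossing perfect pairing of `A` with `B` in which every element of `A` comes before
its partner. -/
structure IsNCPairing (A B : Set ℤ) (P : Set (ℤ × ℤ)) : Prop where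
  mem : ∀ p ∈ P, p.1 ∈ A ∧ p.2 ∈ B ∧ p.1 < p.2
  left : ∀ a ∈ A, ∃ b, (a, b) ∈ P
  right : ∀ b ∈ B, ∃ a, (a, b) ∈ P
  left_unique : ∀ a b b', (a, b) ∈ P → (a, b') ∈ P → b = b'
  right_unique : ∀ a a' b, (a, b) ∈ P → (a', b) ∈ P → a = a'
  noncrossing : ∀ p ∈ P, ∀ q ∈ P, p.1 < q.1 → q.1 < p.2 → ¬ p.2 < q.2

/-- Induction on the length of a pair `(i, j)` of `P`. If `Q` pairs `j` with some `i₂ > i`, then the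
partner of `i₂` in `P` lies before `j`; this shorter pair is in `Q`, which contradicts the partner
`j` of `i₂`. If `i₂ < i`, the partner `j₂` of `i` in `Q` lies before `j`, and the partner of `j₂` in
`P` lies after `i`; again a shorter pair gives a contradiction. -/
theorem IsNCPairing.subset {A B : Set ℤ} {P Q : Set (ℤ × ℤ)} (hP : IsNCPairing A B P)
    (hQ : IsNCPairing A B Q) : P ⊆ Q := by
  have key : ∀ l : ℕ, ∀ i j : ℤ, (i, j) ∈ P → j - i ≤ l → (i, j) ∈ Q := by
    intro l
    induction l with
    | zero =>
      intro i j h hl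
      have := (hP.mem _ h).2.2
      simp only at this
      omega
    | succ l ih =>
      intro i j h hl
      obtain ⟨hiA, hjB, hij⟩ := hP.mem _ h
      simp only at hiA hjB hij
      push_cast at hl
      obtain ⟨i₂, h2⟩ := hQ.right j hjB
      obtain ⟨j₂, h3⟩ := hQ.left i hiA
      have hi2 := hQ.mem _ h2
      have hj2 := hQ.mem _ h3
      simp only at hi2 hj2
      rcases lt_trichotomy i₂ i with h4 | h4 | h4
      · exfalso
        have h5 : j₂ ≤ j := not_lt.1 (hQ.noncrossing _ h2 _ h3 h4 hij)
        rcases eq_or_lt_of_le h5 with h5 | h5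
        · subst h5
          have := hQ.right_unique _ _ _ h2 h3; omega
        · obtain ⟨i₄, h6⟩ := hP.right j₂ hj2.2.1
          have h7 := hP.mem _ h6
          simp only at h7
          rcases lt_trichotomy i₄ i with h8 | h8 | h8
          · exact hP.noncrossing _ h6 _ h h8 hj2.2.2 h5
          · subst h8; have := hP.left_unique _ _ _ h6 h; omega
          · have h9 := ih i₄ j₂ h6 (by omega)
            have := hQ.right_unique _ _ _ h9 h3; omega
      · subst h4; exact h2
      · exfalso
        obtain ⟨j₄, h6⟩ := hP.left i₂ hi2.1
        have h7 : j₄ ≤ j := not_lt.1 (hP.noncrossing _ h _ h6 h4 hi2.2.2)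
        rcases eq_or_lt_of_le h7 with h7 | h7
        · subst h7
          have := hP.right_unique _ _ _ h6 h; omega
        · have h9 := ih i₂ j₄ h6 (by omega)
          have := hQ.left_unique _ _ _ h9 h2; omega
  rintro ⟨i, j⟩ h
  exact key (j - i).toNat i j h (by omega)

theorem IsNCPairing.unique {A B : Set ℤ} {P Q : Set (ℤ × ℤ)} (hP : IsNCPairing A B P)
    (hQ : IsNCPairing A B Q) : P = Q :=
  (hP.subset hQ).antisymm (hQ.subset hP)

theorem IsNCPairing.reflect {A B : Set ℤ} {P : Set (ℤ × ℤ)} (hP : IsNCPairing A B P) (s : ℤ) :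
    IsNCPairing {b | s - b ∈ B} {a | s - a ∈ A} {p | (s - p.2, s - p.1) ∈ P} where
  mem p h := by
    have := hP.mem _ h
    exact ⟨this.2.1, this.1, by have := this.2.2; simp only at this; omega⟩
  left a h := by
    obtain ⟨b, hb⟩ := hP.right _ h
    exact ⟨s - b, by simpa using hb⟩
  right b h := by
    obtain ⟨a, ha⟩ := hP.left _ h
    exact ⟨s - a, by simpa using ha⟩
  left_unique a b b' h h' := by
    have := hP.right_unique _ _ _ h h'; omega
  right_unique a a' b h h' := by
    have := hP.left_unique _ _ _ h h'; omega
  noncrossing p hp q hq h1 h2 h3 :=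
    hP.noncrossing _ hq _ hp (by simp only; omega) (by simp only; omega) (by simp only; omega)

/-- Invariant of the greedy pairing after `c` entries of the bottom row. -/
structure PairInv (k : ℕ) (top bot : ℕ → ℤ) (c : ℕ) (P : Finset (ℤ × ℤ)) : Prop where
  mem : ∀ p ∈ P, ∃ d < k, ∃ e < c, p = (top d, bot e) ∧ top d < bot e
  right : ∀ e < c, ∃ a, (a, bot e) ∈ P
  left_unique : ∀ a b b', (a, b) ∈ P → (a, b') ∈ P → b = b'
  right_unique : ∀ a a' b, (a, b) ∈ P → (a', b) ∈ P → a = a'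
  greedy : ∀ p ∈ P, ∀ d < k, p.1 < top d → top d < p.2 → ∃ b, (top d, b) ∈ P ∧ b < p.2
  card : P.card = c

/-- The field `greedy` is what yields noncrossing: a top entry under a new pair was passed over
because it was already paired, hence with an earlier bottom entry. -/
theorem pairInv_rowPairs {k : ℕ} {top bot : ℕ → ℤ}
    (htop : ∀ c c', c < c' → c' < k → top c < top c')
    (hbot : ∀ c c', c < c' → c' < k → bot c < bot c') (hlt : ∀ c < k, top c < bot c) (c : ℕ)
    (hc : c ≤ k) : PairInv k top bot c (rowPairs k top bot c) := by
  classical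
  induction c with
  | zero => constructor <;> simp [rowPairs]
  | succ c ih =>
    have H := ih (by omega)
    have htopinj : ∀ d d', d < k → d' < k → top d = top d' → d = d' := by
      intro d d' hd hd' e
      rcases lt_trichotomy d d' with h | h | h
      · have := htop _ _ h hd'; omega
      · exact h
      · have := htop _ _ h hd; omega
    set P := rowPairs k top bot c with hPdef
    set cand := (Finset.range k).filter (fun d => top d < bot c ∧ ∀ p ∈ P, p.1 ≠ top d)
      with hcand
    -- The `c + 1` entries `top 0, …, top c` all lie below `bot c`, and only `c` pairs have been
    -- made.
    have hne : cand.Nonempty := by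
      by_contra hemp
      rw [Finset.not_nonempty_iff_eq_empty] at hemp
      have h1 : ∀ d ∈ Finset.range (c + 1), top d ∈ P.image Prod.fst := by
        intro d hd
        rw [Finset.mem_range] at hd
        by_contra h2
        have : d ∈ cand := by
          rw [hcand, Finset.mem_filter, Finset.mem_range]
          refine ⟨by omega, ?_, ?_⟩
          · rcases eq_or_lt_of_le (show d ≤ c by omega) with h | h
            · rw [h]; exact hlt c (by omega)
            · exact (htop _ _ h (by omega)).trans (hlt c (by omega))
          · intro p hp e
            exact h2 (Finset.mem_image.2 ⟨p, hp, e⟩)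
        rw [hemp] at this
        simp at this
      have h2 := Finset.card_le_card_of_injOn top h1 (by
        intro d hd d' hd' e
        rw [Finset.mem_coe, Finset.mem_range] at hd hd'
        exact htopinj _ _ (by omega) (by omega) e)
      have h3 := Finset.card_image_le (s := P) (f := Prod.fst)
      rw [Finset.card_range] at h2
      have := H.card
      omega
    have hP' : rowPairs k top bot (c + 1) = insert (top (cand.max' hne), bot c) P := by
      rw [rowPairs]
      exact dif_pos hne
    set d₀ := cand.max' hne
    have hd₀ : d₀ ∈ cand := cand.max'_mem hne
    rw [hcand, Finset.mem_filter, Finset.mem_range] at hd₀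
    obtain ⟨hd₀k, hd₀lt, hd₀free⟩ := hd₀
    have hfreshR : ∀ a, (a, bot c) ∉ P := by
      intro a h
      obtain ⟨d, hd, e, he, heq, -⟩ := H.mem _ h
      have h1 := (Prod.ext_iff.1 heq).2
      have := hbot e c he (by omega)
      simp only at h1
      omega
    have hfreshL : ∀ b, (top d₀, b) ∉ P := fun b h => hd₀free _ h rfl
    rw [hP']
    constructor
    · intro p hp
      rcases Finset.mem_insert.1 hp with rfl | hp
      · exact ⟨d₀, hd₀k, c, by omega, rfl, hd₀lt⟩
      · obtain ⟨d, hd, e, he, h⟩ := H.mem p hp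
        exact ⟨d, hd, e, by omega, h⟩
    · intro e he
      rcases Nat.lt_succ_iff_lt_or_eq.1 he with he | rfl
      · obtain ⟨a, ha⟩ := H.right e he
        exact ⟨a, Finset.mem_insert_of_mem ha⟩
      · exact ⟨_, Finset.mem_insert_self _ _⟩
    · intro a b b' h h'
      rcases Finset.mem_insert.1 h with h | h <;> rcases Finset.mem_insert.1 h' with h' | h'
      · rw [Prod.ext_iff] at h h'; exact h.2.trans h'.2.symm
      · rw [(Prod.mk.inj h).1] at h'; exact absurd h' (hfreshL _)
      · rw [(Prod.mk.inj h').1] at h; exact absurd h (hfreshL _)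
      · exact H.left_unique _ _ _ h h'
    · intro a a' b h h'
      rcases Finset.mem_insert.1 h with h | h <;> rcases Finset.mem_insert.1 h' with h' | h'
      · rw [Prod.ext_iff] at h h'; exact h.1.trans h'.1.symm
      · rw [(Prod.mk.inj h).2] at h'; exact absurd h' (hfreshR _)
      · rw [(Prod.mk.inj h').2] at h; exact absurd h (hfreshR _)
      · exact H.right_unique _ _ _ h h'
    · intro p hp d hd h1 h2
      rcases Finset.mem_insert.1 hp with rfl | hp
      · simp only at h1 h2
        have h3 : d ∉ cand := by
          intro h3
          have h4 := cand.le_max' _ h3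
          rcases eq_or_lt_of_le h4 with h5 | h5
          · rw [h5] at h1; exact lt_irrefl _ h1
          · have : top d < top d₀ := htop _ _ h5 hd₀k
            omega
        rw [hcand, Finset.mem_filter, Finset.mem_range] at h3
        push Not at h3
        obtain ⟨⟨a, b⟩, hp, hpe⟩ := h3 hd h2
        simp only at hpe
        refine ⟨b, Finset.mem_insert_of_mem (by rw [← hpe]; exact hp), ?_⟩
        obtain ⟨d', hd', e, he, heq, -⟩ := H.mem _ hp
        have h4 := (Prod.ext_iff.1 heq).2
        simp only at h4 ⊢
        rw [h4]
        exact hbot e c he (by omega)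
      · obtain ⟨b, h3, h4⟩ := H.greedy p hp d hd h1 h2
        exact ⟨b, Finset.mem_insert_of_mem h3, h4⟩
    · rw [Finset.card_insert_of_notMem (hfreshR _), H.card]

theorem isNCPairing_rowPairs {k : ℕ} {top bot : ℕ → ℤ}
    (htop : ∀ c c', c < c' → c' < k → top c < top c')
    (hbot : ∀ c c', c < c' → c' < k → bot c < bot c') (hlt : ∀ c < k, top c < bot c) :
    IsNCPairing {a | ∃ c < k, top c = a} {b | ∃ c < k, bot c = b}
      {p | p ∈ rowPairs k top bot k} := by
  classical
  have H := pairInv_rowPairs htop hbot hlt k le_rfl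
  refine ⟨?_, ?_, ?_, H.left_unique, H.right_unique, ?_⟩
  · intro p hp
    obtain ⟨d, hd, e, he, rfl, h⟩ := H.mem p hp
    exact ⟨⟨d, hd, rfl⟩, ⟨e, he, rfl⟩, h⟩
  -- The `k` pairs have `k` different left ends among the `k` top entries, so every top entry is
  -- used.
  · have h1 : ((rowPairs k top bot k).image Prod.fst) ⊆ (Finset.range k).image top := by
      intro a ha
      obtain ⟨p, hp, rfl⟩ := Finset.mem_image.1 ha
      obtain ⟨d, hd, e, he, rfl, h⟩ := H.mem p hp
      exact Finset.mem_image.2 ⟨d, Finset.mem_range.2 hd, rfl⟩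
    have h2 : ((rowPairs k top bot k).image Prod.fst).card = k := by
      rw [Finset.card_image_of_injOn, H.card]
      rintro ⟨a, b⟩ hp ⟨a', b'⟩ hp' e
      simp only at e
      subst e
      rw [H.left_unique _ _ _ hp hp']
    have h3 := Finset.eq_of_subset_of_card_le h1
      (by rw [h2]; exact Finset.card_image_le.trans (Finset.card_range k).le)
    rintro a ⟨c, hc, rfl⟩
    have h4 : top c ∈ (Finset.range k).image top :=
      Finset.mem_image_of_mem _ (Finset.mem_range.2 hc)
    rw [← h3, Finset.mem_image] at h4
    obtain ⟨⟨a, b⟩, hp, rfl⟩ := h4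
    exact ⟨b, hp⟩
  · rintro b ⟨c, hc, rfl⟩
    exact H.right c hc
  · intro p hp q hq h1 h2 h3
    obtain ⟨d, hd, e, he, rfl, h⟩ := H.mem q hq
    simp only at h1 h2 h3
    obtain ⟨b, h4, h5⟩ := H.greedy p hp d hd h1 h2
    have := H.left_unique _ _ _ h4 hq
    omega

/-! ### Matchings of rectangular tableaux -/

namespace IsRectSYT

variable {n k : ℕ} {T : ℕ → ℕ → ℤ}

theorem pairing (H : IsRectSYT n k T) {r : ℕ} (hr : r + 1 < n) :
    IsNCPairing {a | ∃ c < k, T r c = a} {b | ∃ c < k, T (r + 1) c = b}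
      {p | p ∈ rowPairs k (T r) (T (r + 1)) k} :=
  isNCPairing_rowPairs (fun c c' => H.row_lt r c c' (by omega))
    (fun c c' => H.row_lt (r + 1) c c' hr) fun c hc => H.col_lt r (r + 1) c (by omega) hr hc

theorem evacuation (H : IsRectSYT n k T) : IsRectSYT n k (evacuation n k T) := by
  have hx : ∀ r : ℕ, r < n → n - 1 - r < n := fun r h => by omega
  have hy : ∀ c : ℕ, c < k → k - 1 - c < k := fun c h => by omega
  refine ⟨⟨?_, ?_, ?_⟩, ?_, ?_, ?_⟩
  · rintro ⟨r, c⟩ ⟨hr, hc⟩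
    simp only at hr hc
    simp only [H.evacuation_apply hr hc, Set.mem_Icc]
    have := H.mem_Icc (hx r hr) (hy c hc)
    omega
  · rintro ⟨r, c⟩ ⟨hr, hc⟩ ⟨r', c'⟩ ⟨hr', hc'⟩ e
    simp only at hr hc hr' hc' e
    rw [H.evacuation_apply hr hc, H.evacuation_apply hr' hc'] at e
    have := H.inj (hx r hr) (hy c hc) (hx r' hr') (hy c' hc') (by omega)
    rw [Prod.ext_iff]
    simp only
    omega
  · intro q hq
    obtain ⟨r, c, hr, hc, h⟩ := H.exists_cell (q := (n : ℤ) * k + 1 - q)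
      (by have := hq.2; omega) (by have := hq.1; omega)
    refine ⟨(n - 1 - r, k - 1 - c), ⟨hx r hr, hy c hc⟩, ?_⟩
    simp only
    rw [H.evacuation_apply (hx r hr) (hy c hc)]
    rw [show n - 1 - (n - 1 - r) = r by omega, show k - 1 - (k - 1 - c) = c by omega, h]
    ring
  · intro r c c' hr hcc hc'
    rw [H.evacuation_apply hr (by omega), H.evacuation_apply hr hc']
    have := H.row_lt (n - 1 - r) (k - 1 - c') (k - 1 - c) (by omega) (by omega) (by omega)
    omega
  · intro r r' c hrr hr' hc
    rw [H.evacuation_apply (by omega) hc, H.evacuation_apply hr' hc]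
    have := H.col_lt (n - 1 - r') (n - 1 - r) (k - 1 - c) (by omega) (by omega) (by omega)
    omega
  · intro r c h
    simp only [_root_.evacuation]
    rw [if_neg h]

theorem row_evacuation (H : IsRectSYT n k T) {r : ℕ} (hr : r < n) :
    {a | ∃ c < k, _root_.evacuation n k T r c = a} =
      {a : ℤ | ((n : ℤ) * k + 1) - a ∈ {b | ∃ c < k, T (n - 1 - r) c = b}} := by
  ext a
  constructor
  · rintro ⟨c, hc, rfl⟩
    refine ⟨k - 1 - c, by omega, ?_⟩
    rw [H.evacuation_apply hr hc]
    ring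
  · rintro ⟨c, hc, h⟩
    refine ⟨k - 1 - c, by omega, ?_⟩
    rw [H.evacuation_apply hr (by omega), show k - 1 - (k - 1 - c) = c by omega, h]
    ring

/-- The matching of the evacuated tableau is the reflected matching. -/
theorem tableauMatching_evacuation (H : IsRectSYT n k T) :
    tableauMatching n k (_root_.evacuation n k T) =
      reflectMatching n (n * k) (tableauMatching n k T) := by
  have key : ∀ r, r + 1 < n → ∀ i j : ℤ,
      (i, j) ∈ rowPairs k (_root_.evacuation n k T r) (_root_.evacuation n k T (r + 1)) k ↔
        ((n : ℤ) * k + 1 - j, (n : ℤ) * k + 1 - i) ∈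
          rowPairs k (T (n - 2 - r)) (T (n - 2 - r + 1)) k := by
    intro r hr i j
    have h1 := H.evacuation.pairing hr
    have h2 := (H.pairing (r := n - 2 - r) (by omega)).reflect ((n : ℤ) * k + 1)
    rw [H.row_evacuation (by omega), H.row_evacuation hr,
      show n - 1 - r = n - 2 - r + 1 by omega, show n - 1 - (r + 1) = n - 2 - r by omega] at h1
    -- Rows of the evacuated tableau are complements of the opposite rows of `T`. Both pairings are
    -- thus noncrossing pairings of the same two sets.
    have h3 := h1.unique h2
    exact Set.ext_iff.1 h3 (i, j)
  ext a
  constructor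
  · rintro ⟨r, hr, hc, h⟩
    rw [key r hr] at h
    refine ⟨⟨(n : ℤ) * k + 1 - a.finish, (n : ℤ) * k + 1 - a.start, n - a.color⟩,
      ⟨n - 2 - r, by omega, ?_, h⟩, ?_⟩
    · simp only; omega
    · ext <;> simp [ColoredArc.reflect]
  · rintro ⟨b, ⟨r, hr, hc, h⟩, rfl⟩
    refine ⟨n - 2 - r, by omega, ?_, ?_⟩
    · simp only [ColoredArc.reflect]; omega
    · rw [key _ (by omega), show n - 2 - (n - 2 - r) = r by omega]
      simpa [ColoredArc.reflect] using h

theorem matching_cases (H : IsRectSYT n k T) {a : ColoredArc} (ha : a ∈ tableauMatching n k T) :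
    ∃ r : ℕ, r + 1 < n ∧ a.color = (r : ℤ) + 1 ∧
      (a.start, a.finish) ∈ rowPairs k (T r) (T (r + 1)) k ∧
      (∃ c < k, T r c = a.start) ∧ (∃ c < k, T (r + 1) c = a.finish) ∧ a.start < a.finish := by
  obtain ⟨r, hr, hc, h⟩ := ha
  exact ⟨r, hr, hc, h, (H.pairing hr).mem _ h⟩

theorem row_eq (H : IsRectSYT n k T) {r r' : ℕ} {x y : ℤ} (hr : r < n) (hr' : r' < n)
    (h : ∃ c < k, T r c = x) (h' : ∃ c < k, T r' c = y) (e : x = y) : r = r' := by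
  obtain ⟨c, hc, rfl⟩ := h
  obtain ⟨c', hc', rfl⟩ := h'
  exact (H.inj hr hc hr' hc' e).1

theorem start_unique (H : IsRectSYT n k T) {a b : ColoredArc} (ha : a ∈ tableauMatching n k T)
    (hb : b ∈ tableauMatching n k T) (e : a.start = b.start) : a = b := by
  obtain ⟨r, hr, hc, h, h1, h2, h3⟩ := H.matching_cases ha
  obtain ⟨r', hr', hc', h', h1', h2', h3'⟩ := H.matching_cases hb
  obtain rfl := H.row_eq (by omega) (by omega) h1 h1' e
  rw [← e] at h'
  exact ColoredArc.ext e ((H.pairing hr).left_unique _ _ _ h h') (hc.trans hc'.symm)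

theorem finish_unique (H : IsRectSYT n k T) {a b : ColoredArc} (ha : a ∈ tableauMatching n k T)
    (hb : b ∈ tableauMatching n k T) (e : a.finish = b.finish) : a = b := by
  obtain ⟨r, hr, hc, h, h1, h2, h3⟩ := H.matching_cases ha
  obtain ⟨r', hr', hc', h', h1', h2', h3'⟩ := H.matching_cases hb
  have := H.row_eq (by omega) (by omega) h2 h2' e
  obtain rfl : r = r' := by omega
  rw [← e] at h'
  exact ColoredArc.ext ((H.pairing hr).right_unique _ _ _ h h') e (hc.trans hc'.symm)

theorem color_succ (H : IsRectSYT n k T) {a b : ColoredArc} (ha : a ∈ tableauMatching n k T)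
    (hb : b ∈ tableauMatching n k T) (e : a.finish = b.start) : b.color = a.color + 1 := by
  obtain ⟨r, hr, hc, h, h1, h2, h3⟩ := H.matching_cases ha
  obtain ⟨r', hr', hc', h', h1', h2', h3'⟩ := H.matching_cases hb
  have := H.row_eq (by omega) (by omega) h2 h1' e
  rw [hc, hc', ← this]
  push_cast
  rfl

theorem isMulticoloredNCM (H : IsRectSYT n k T) (hn : 2 ≤ n) :
    IsMulticoloredNCM n (n * k) (tableauMatching n k T) := by
  constructor
  · intro a ha
    obtain ⟨r, hr, hc, h, ⟨c, hc1, h1⟩, ⟨c', hc2, h2⟩, h3⟩ := H.matching_cases ha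
    have h4 := H.mem_Icc (show r < n by omega) hc1
    have h5 := H.mem_Icc hr hc2
    push_cast
    omega
  · intro a ha
    obtain ⟨r, hr, hc, h⟩ := H.matching_cases ha
    omega
  · intro a ha b hb hcol hne p hp hp'
    rcases hp with hp | hp <;> rcases hp' with hp' | hp'
    · exact hne (H.start_unique ha hb (by omega))
    · have := H.color_succ hb ha (by omega); omega
    · have := H.color_succ ha hb (by omega); omega
    · exact hne (H.finish_unique ha hb (by omega))
  · intro a ha b hb hcol hcross
    obtain ⟨r, hr, hc, h, h1, h2, h3⟩ := H.matching_cases ha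
    obtain ⟨r', hr', hc', h', h1', h2', h3'⟩ := H.matching_cases hb
    obtain rfl : r = r' := by omega
    exact (H.pairing hr).noncrossing _ h _ h' hcross.1 hcross.2.1 hcross.2.2
  · intro p h1 h2
    obtain ⟨r, c, hr, hc, h⟩ := H.exists_cell h1 (by exact_mod_cast h2)
    by_cases hr' : r + 1 < n
    · obtain ⟨b, hb⟩ := (H.pairing hr').left p ⟨c, hc, h⟩
      exact ⟨⟨p, b, r + 1⟩, ⟨r, hr', rfl, hb⟩, Or.inl rfl⟩
    · obtain ⟨r, rfl⟩ : ∃ r', r = r' + 1 := ⟨r - 1, by omega⟩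
      obtain ⟨a, ha⟩ := (H.pairing hr).right p ⟨c, hc, h⟩
      exact ⟨⟨a, p, r + 1⟩, ⟨r, hr, rfl, ha⟩, Or.inr rfl⟩

theorem isStandardRectangular (H : IsRectSYT n k T) :
    IsStandardRectangular n (tableauMatching n k T) := by
  constructor
  · intro a ha hcol
    obtain ⟨r, hr, hc, h, h1, h2, h3⟩ := H.matching_cases ha
    obtain ⟨r, rfl⟩ : ∃ r', r = r' + 1 := ⟨r - 1, by omega⟩
    obtain ⟨i, hi⟩ := (H.pairing (show r + 1 < n by omega)).right _ h1
    have hb : (⟨i, a.start, r + 1⟩ : ColoredArc) ∈ tableauMatching n k T :=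
      ⟨r, by omega, rfl, hi⟩
    refine ⟨⟨i, a.start, r + 1⟩, by simp only; push_cast at hc; omega, fun c => ?_⟩
    constructor
    · rintro ⟨hcM, hne, hs | hf⟩
      · exact absurd (H.start_unique hcM ha hs) hne
      · exact H.finish_unique hcM hb hf
    · rintro rfl
      refine ⟨hb, fun e => ?_, Or.inr rfl⟩
      have := congrArg ColoredArc.color e
      simp only at this
      push_cast at hc
      omega
  · intro a ha hcol
    obtain ⟨r, hr, hc, h, h1, h2, h3⟩ := H.matching_cases ha
    obtain ⟨j, hj⟩ := (H.pairing (show r + 1 + 1 < n by omega)).left _ h2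
    have hb : (⟨a.finish, j, r + 2⟩ : ColoredArc) ∈ tableauMatching n k T :=
      ⟨r + 1, by omega, by simp only; push_cast; ring, hj⟩
    refine ⟨⟨a.finish, j, r + 2⟩, by simp only; omega, fun c => ?_⟩
    constructor
    · rintro ⟨hcM, hne, hs | hf⟩
      · exact H.start_unique hcM hb hs
      · exact absurd (H.finish_unique hcM ha hf) hne
    · rintro rfl
      refine ⟨hb, fun e => ?_, Or.inl rfl⟩
      have := congrArg ColoredArc.color e
      simp only at this
      omega
  · intro a ha hcol c hc ht
    rcases ht with ht | ht
    · exact H.start_unique hc ha ht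
    · have := H.color_succ hc ha ht
      obtain ⟨r, hr, h, _⟩ := H.matching_cases hc
      omega
  · intro a ha hcol c hc ht
    rcases ht with ht | ht
    · have := H.color_succ ha hc ht.symm
      obtain ⟨r, hr, h, _⟩ := H.matching_cases hc
      omega
    · exact H.finish_unique hc ha ht

end IsRectSYT

/-! ## Arc systems -/

/-- The properties of standard rectangular multicolored noncrossing matchings on which the
construction of their webs depends. -/
structure ArcSystem (n N : ℕ) (M : Set ColoredArc) : Prop where
  finite : M.Finite
  arc : ∀ a ∈ M, 1 ≤ a.start ∧ a.start < a.finish ∧ a.finish ≤ N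
  color : ∀ a ∈ M, 1 ≤ a.color ∧ a.color ≤ (n : ℤ) - 1
  start_inj : ∀ a ∈ M, ∀ b ∈ M, a.start = b.start → a = b
  finish_inj : ∀ a ∈ M, ∀ b ∈ M, a.finish = b.finish → a = b
  color_succ : ∀ a ∈ M, ∀ b ∈ M, a.finish = b.start → b.color = a.color + 1
  cross_color : ∀ a ∈ M, ∀ b ∈ M, a.Crosses b → a.color ≠ b.color
  start_color : ∀ a ∈ M, ¬ HasY M a.start → a.color = 1
  finish_color : ∀ a ∈ M, ¬ HasY M a.finish → a.color = (n : ℤ) - 1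
  covers : ∀ p : ℤ, 1 ≤ p → p ≤ N → ∃ a ∈ M, a.Touches p

theorem IsMulticoloredNCM.finite {n N : ℕ} {M : Set ColoredArc} (H : IsMulticoloredNCM n N M) :
    M.Finite := by
  have h1 := ((Set.finite_Icc (1 : ℤ) N).prod ((Set.finite_Icc (1 : ℤ) N).prod
    (Set.finite_Icc (1 : ℤ) ((n : ℤ) - 1)))).image
      fun x : ℤ × ℤ × ℤ => (⟨x.1, x.2.1, x.2.2⟩ : ColoredArc)
  refine h1.subset fun a ha => ?_
  have h2 := H.arc a ha
  have h3 := H.color a ha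
  refine ⟨(a.start, a.finish, a.color), ?_, rfl⟩
  simp only [Set.mem_prod, Set.mem_Icc]
  omega

theorem IsStandardRectangular.arcSystem {n N : ℕ} {M : Set ColoredArc}
    (H : IsMulticoloredNCM n N M) (S : IsStandardRectangular n M) : ArcSystem n N M := by
  have hstart : ∀ a ∈ M, ∀ b ∈ M, a.start = b.start → a = b := by
    intro a ha b hb e
    by_contra hne
    have h1 := H.color a ha
    have h2 := H.color b hb
    by_cases h3 : a.color = 1
    · exact hne (S.start_free a ha h3 b hb (Or.inl e.symm)).symm
    by_cases h4 : b.color = 1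
    · exact hne (S.start_free b hb h4 a ha (Or.inl e))
    -- Each arc would be the only other arc at the common point, so each color would be one less
    -- than the other.
    obtain ⟨c, hc, hc'⟩ := S.start_shared a ha (by omega)
    obtain ⟨d, hd, hd'⟩ := S.start_shared b hb (by omega)
    have h5 := (hc' b).1 ⟨hb, Ne.symm hne, Or.inl e.symm⟩
    have h6 := (hd' a).1 ⟨ha, hne, Or.inl e⟩
    rw [← h5] at hc
    rw [← h6] at hd
    omega
  have hfinish : ∀ a ∈ M, ∀ b ∈ M, a.finish = b.finish → a = b := by
    intro a ha b hb e
    by_contra hne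
    have h1 := H.color a ha
    have h2 := H.color b hb
    by_cases h3 : a.color = n - 1
    · exact hne (S.end_free a ha h3 b hb (Or.inr e.symm)).symm
    by_cases h4 : b.color = n - 1
    · exact hne (S.end_free b hb h4 a ha (Or.inr e))
    obtain ⟨c, hc, hc'⟩ := S.end_shared a ha (by omega)
    obtain ⟨d, hd, hd'⟩ := S.end_shared b hb (by omega)
    have h5 := (hc' b).1 ⟨hb, Ne.symm hne, Or.inr e.symm⟩
    have h6 := (hd' a).1 ⟨ha, hne, Or.inr e⟩
    rw [← h5] at hc
    rw [← h6] at hd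
    omega
  refine ⟨H.finite, H.arc, H.color, hstart, hfinish, ?_, ?_, ?_, ?_, H.covers⟩
  · intro a ha b hb e
    have h1 := H.arc a ha
    have h2 := H.arc b hb
    have hne : a ≠ b := by rintro rfl; omega
    have h3 := H.color b hb
    by_cases h4 : b.color = 1
    · exact absurd (S.start_free b hb h4 a ha (Or.inr e)) hne
    · obtain ⟨c, hc, hc'⟩ := S.start_shared b hb (by omega)
      rw [← (hc' a).1 ⟨ha, hne, Or.inr e⟩] at hc
      omega
  · exact fun a ha b hb hcr hc => H.noncrossing a ha b hb hc hcr
  · intro a ha hY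
    by_contra h
    have h1 := H.color a ha
    obtain ⟨c, hc, hc'⟩ := S.start_shared a ha (by omega)
    obtain ⟨h2, h3, h4 | h4⟩ := (hc' c).2 rfl
    · exact h3 (hstart c h2 a ha h4)
    · exact hY ⟨⟨c, h2, h4⟩, a, ha, rfl⟩
  · intro a ha hY
    by_contra h
    have h1 := H.color a ha
    obtain ⟨c, hc, hc'⟩ := S.end_shared a ha (by omega)
    obtain ⟨h2, h3, h4 | h4⟩ := (hc' c).2 rfl
    · exact hY ⟨⟨a, ha, rfl⟩, c, h2, h4⟩
    · exact h3 (hfinish c h2 a ha h4)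

theorem ColoredArc.reflect_reflect (n N : ℕ) (a : ColoredArc) :
    (a.reflect n N).reflect n N = a := by
  ext <;> simp [ColoredArc.reflect]

theorem reflectMatching_reflectMatching (n N : ℕ) (M : Set ColoredArc) :
    reflectMatching n N (reflectMatching n N M) = M := by
  simp [reflectMatching, Set.image_image, ColoredArc.reflect_reflect]

theorem mem_reflectMatching {n N : ℕ} {M : Set ColoredArc} {a : ColoredArc} (ha : a ∈ M) :
    a.reflect n N ∈ reflectMatching n N M :=
  Set.mem_image_of_mem _ ha

theorem HasY.reflect {n N : ℕ} {M : Set ColoredArc} {p : ℤ} (h : HasY M p) :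
    HasY (reflectMatching n N M) ((N : ℤ) + 1 - p) := by
  obtain ⟨⟨a, ha, rfl⟩, b, hb, e⟩ := h
  refine ⟨⟨_, mem_reflectMatching hb, ?_⟩, _, mem_reflectMatching ha, ?_⟩
  · simp [ColoredArc.reflect, e]
  · simp [ColoredArc.reflect]

theorem hasY_reflectMatching {n N : ℕ} {M : Set ColoredArc} {p : ℤ} :
    HasY (reflectMatching n N M) ((N : ℤ) + 1 - p) ↔ HasY M p := by
  refine ⟨fun h => ?_, HasY.reflect⟩
  have := h.reflect (n := n) (N := N)
  rw [reflectMatching_reflectMatching] at this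
  simpa using this

theorem ColoredArc.Crosses.reflect {n N : ℕ} {a b : ColoredArc} (h : a.Crosses b) :
    (b.reflect n N).Crosses (a.reflect n N) := by
  have h1 := h.1
  have h2 := h.2.1
  have h3 := h.2.2
  refine ⟨?_, ?_, ?_⟩ <;> simp only [ColoredArc.reflect] <;> omega

theorem ColoredArc.crosses_reflect_iff {n N : ℕ} {a b : ColoredArc} :
    (b.reflect n N).Crosses (a.reflect n N) ↔ a.Crosses b := by
  refine ⟨fun h => ?_, ColoredArc.Crosses.reflect⟩
  have := h.reflect (n := n) (N := N)
  rwa [ColoredArc.reflect_reflect, ColoredArc.reflect_reflect] at this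

theorem ArcSystem.reflect {n N : ℕ} {M : Set ColoredArc} (H : ArcSystem n N M) :
    ArcSystem n N (reflectMatching n N M) := by
  refine ⟨H.finite.image _, ?_, ?_, ?_, ?_, ?_, ?_, ?_, ?_, ?_⟩
  · rintro _ ⟨a, ha, rfl⟩
    have := H.arc a ha
    simp only [ColoredArc.reflect]; omega
  · rintro _ ⟨a, ha, rfl⟩
    have := H.color a ha
    simp only [ColoredArc.reflect]; omega
  · rintro _ ⟨a, ha, rfl⟩ _ ⟨b, hb, rfl⟩ e
    rw [H.finish_inj a ha b hb (by simp only [ColoredArc.reflect] at e; omega)]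
  · rintro _ ⟨a, ha, rfl⟩ _ ⟨b, hb, rfl⟩ e
    rw [H.start_inj a ha b hb (by simp only [ColoredArc.reflect] at e; omega)]
  · rintro _ ⟨a, ha, rfl⟩ _ ⟨b, hb, rfl⟩ e
    have := H.color_succ b hb a ha (by simp only [ColoredArc.reflect] at e; omega)
    simp only [ColoredArc.reflect]; omega
  · rintro _ ⟨a, ha, rfl⟩ _ ⟨b, hb, rfl⟩ h
    have := H.cross_color b hb a ha (ColoredArc.crosses_reflect_iff.1 h)
    simp only [ColoredArc.reflect]; omega
  · rintro _ ⟨a, ha, rfl⟩ h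
    have := H.finish_color a ha fun h' => h h'.reflect
    simp only [ColoredArc.reflect]; omega
  · rintro _ ⟨a, ha, rfl⟩ h
    have := H.start_color a ha fun h' => h h'.reflect
    simp only [ColoredArc.reflect]; omega
  · intro p h1 h2
    obtain ⟨a, ha, h⟩ := H.covers (N + 1 - p) (by omega) (by omega)
    refine ⟨_, mem_reflectMatching ha, ?_⟩
    simp only [ColoredArc.Touches, ColoredArc.reflect] at h ⊢
    omega

/-! ## General facts on webs -/

theorem reflectPoint_reflectPoint (N : ℕ) (p : ℝ × ℝ) : reflectPoint N (reflectPoint N p) = p := by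
  ext <;> simp [reflectPoint]

theorem reflectPoint_injective (N : ℕ) : Function.Injective (reflectPoint N) :=
  Function.LeftInverse.injective (reflectPoint_reflectPoint N)

theorem continuous_reflectPoint (N : ℕ) : Continuous (reflectPoint N) := by
  unfold reflectPoint; fun_prop

theorem WebEdge.reflect_reflect (N : ℕ) (e : WebEdge) : (e.reflect N).reflect N = e := by
  ext1 <;> simp [WebEdge.reflect, reflectPoint_reflectPoint, Set.image_image]

theorem WebEdge.reflect_injective (N : ℕ) : Function.Injective (WebEdge.reflect N) :=
  Function.LeftInverse.injective (WebEdge.reflect_reflect N)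

theorem WebEdge.flip_flip (n : ℕ) (e : WebEdge) : (e.flip n).flip n = e := by
  ext1 <;> simp [WebEdge.flip]

theorem WebEdge.reflect_flip (n N : ℕ) (e : WebEdge) :
    (e.flip n).reflect N = (e.reflect N).flip n := rfl

theorem WebEdge.shape_flip (n : ℕ) (e : WebEdge) : (e.flip n).shape = e.shape := by
  simp [WebEdge.shape, WebEdge.flip, Sym2.eq_swap]

theorem PlaneGraph.undirected_flip (n : ℕ) (F : Set WebEdge) (w : PlaneGraph) :
    (w.flip n F).undirected = w.undirected := by
  simp only [PlaneGraph.undirected, PlaneGraph.flip, Set.image_image]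
  congr 2
  refine Set.image_congr fun e _ => ?_
  split_ifs
  · exact WebEdge.shape_flip n e
  · rfl

theorem PlaneGraph.reflect_flip (n N : ℕ) (F : Set WebEdge) (w : PlaneGraph) :
    (w.reflect N).flip n (WebEdge.reflect N '' F) = (w.flip n F).reflect N := by
  simp only [PlaneGraph.reflect, PlaneGraph.flip, Set.image_image]
  congr 1
  refine Set.image_congr fun e _ => ?_
  rw [(WebEdge.reflect_injective N).mem_set_image]
  split_ifs <;> rfl

theorem WebEdge.IsSimpleCurve.flip {e : WebEdge} (h : e.IsSimpleCurve) (n : ℕ) :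
    (e.flip n).IsSimpleCurve := by
  obtain ⟨γ, h1, h2, h3, h4, h5, h6⟩ := h
  have hmaps : Set.MapsTo (fun t : ℝ => 1 - t) (Set.Icc 0 1) (Set.Icc 0 1) := by
    intro t ht; simp only [Set.mem_Icc] at ht ⊢; constructor <;> linarith
  refine ⟨fun t => γ (1 - t), h1.comp (by fun_prop) hmaps, by simpa [WebEdge.flip] using h3,
    by simpa [WebEdge.flip] using h2,
    ?_, ?_, ?_⟩
  · rw [WebEdge.flip, ← h4]
    ext p
    constructor
    · rintro ⟨t, ht, rfl⟩
      exact ⟨1 - t, hmaps ht, rfl⟩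
    · rintro ⟨t, ht, rfl⟩
      exact ⟨1 - t, hmaps ht, by simp⟩
  · intro s hs t ht e
    simp only [Set.mem_Ico] at hs ht
    have := h6 (show 1 - s ∈ Set.Ioc (0 : ℝ) 1 from ⟨by linarith, by linarith⟩)
      (show 1 - t ∈ Set.Ioc (0 : ℝ) 1 from ⟨by linarith, by linarith⟩) e
    linarith
  · intro s hs t ht e
    simp only [Set.mem_Ioc] at hs ht
    have := h5 (show 1 - s ∈ Set.Ico (0 : ℝ) 1 from ⟨by linarith, by linarith⟩)
      (show 1 - t ∈ Set.Ico (0 : ℝ) 1 from ⟨by linarith, by linarith⟩) e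
    linarith

theorem WebEdge.IsSimpleCurve.reflect {e : WebEdge} (h : e.IsSimpleCurve) (N : ℕ) :
    (e.reflect N).IsSimpleCurve := by
  obtain ⟨γ, h1, h2, h3, h4, h5, h6⟩ := h
  refine ⟨fun t => reflectPoint N (γ t), (continuous_reflectPoint N).comp_continuousOn h1,
    congrArg _ h2, congrArg _ h3, ?_, ?_, ?_⟩
  · rw [WebEdge.reflect, ← h4, Set.image_image]
  · exact fun s hs t ht e => h5 hs ht (reflectPoint_injective N e)
  · exact fun s hs t ht e => h6 hs ht (reflectPoint_injective N e)

/-- Otherwise planarity would make every point of the common curve a vertex, hence an end of `e`;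
the midpoint of a simple parametrization is not one. This makes flipping injective on the edges of a
web. -/
theorem IsWeb.curve_inj {n N : ℕ} {w : PlaneGraph} (H : IsWeb n N w) {e f : WebEdge}
    (he : e ∈ w.edges) (hf : f ∈ w.edges) (h : e.curve = f.curve) : e = f := by
  by_contra hne
  have h1 := H.planar e he f hf hne
  rw [← h, Set.inter_self] at h1
  obtain ⟨γ, h2, h3, h4, h5, h6, h7⟩ := H.simple e he
  have h8 : ∀ t ∈ Set.Icc (0 : ℝ) 1, γ t = γ 0 ∨ γ t = γ 1 := by
    intro t ht
    have h9 : γ t ∈ e.curve := h5 ▸ Set.mem_image_of_mem γ ht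
    rw [h3, h4]
    exact H.avoids e he _ h9 (h1 h9)
  have h9 := h8 (1 / 2) (by constructor <;> norm_num)
  rcases h9 with h9 | h9
  · have := h6 (by constructor <;> norm_num) (by constructor <;> norm_num) h9
    norm_num at this
  · have := h7 (by constructor <;> norm_num) (by constructor <;> norm_num) h9
    norm_num at this

theorem IsWeb.reflect {n N : ℕ} {w : PlaneGraph} (H : IsWeb n N w) : IsWeb n N (w.reflect N) := by
  have hinj := reflectPoint_injective N
  have hV : ∀ p, reflectPoint N p ∈ (w.reflect N).boundary ∪ (w.reflect N).interior ↔
      p ∈ w.boundary ∪ w.interior := by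
    intro p
    simp only [PlaneGraph.reflect, Set.mem_union, hinj.mem_set_image]
  have hsrc : ∀ v, {e | e ∈ (w.reflect N).edges ∧ e.src = reflectPoint N v} =
      WebEdge.reflect N '' {e | e ∈ w.edges ∧ e.src = v} := by
    intro v
    ext e
    constructor
    · rintro ⟨⟨f, hf, rfl⟩, h⟩
      exact ⟨f, ⟨hf, hinj h⟩, rfl⟩
    · rintro ⟨f, ⟨hf, rfl⟩, rfl⟩
      exact ⟨⟨f, hf, rfl⟩, rfl⟩
  have htgt : ∀ v, {e | e ∈ (w.reflect N).edges ∧ e.tgt = reflectPoint N v} =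
      WebEdge.reflect N '' {e | e ∈ w.edges ∧ e.tgt = v} := by
    intro v
    ext e
    constructor
    · rintro ⟨⟨f, hf, rfl⟩, h⟩
      exact ⟨f, ⟨hf, hinj h⟩, rfl⟩
    · rintro ⟨f, ⟨hf, rfl⟩, rfl⟩
      exact ⟨⟨f, hf, rfl⟩, rfl⟩
  have hdeg : ∀ v, (w.reflect N).degree (reflectPoint N v) = w.degree v := by
    intro v
    rw [PlaneGraph.degree, hsrc, htgt, Set.ncard_image_of_injective _ (WebEdge.reflect_injective N),
      Set.ncard_image_of_injective _ (WebEdge.reflect_injective N), PlaneGraph.degree]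
  constructor
  · ext p
    constructor
    · rintro ⟨q, hq, rfl⟩
      rw [H.boundary_eq] at hq
      obtain ⟨i, h1, h2, rfl⟩ := hq
      exact ⟨N + 1 - i, by omega, by omega, by simp [reflectPoint]⟩
    · rintro ⟨i, h1, h2, rfl⟩
      refine ⟨(((N + 1 - i : ℤ) : ℝ), 0), ?_, by simp [reflectPoint]⟩
      rw [H.boundary_eq]
      exact ⟨N + 1 - i, by omega, by omega, rfl⟩
  · rintro _ ⟨p, hp, rfl⟩
    exact H.interior_pos p hp
  · exact H.finite_interior.image _
  · exact H.finite_edges.image _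
  · rintro _ ⟨e, he, rfl⟩
    exact ⟨(hV _).2 (H.endpoints e he).1, (hV _).2 (H.endpoints e he).2⟩
  · rintro _ ⟨e, he, rfl⟩
    exact (H.simple e he).reflect N
  · rintro _ ⟨e, he, rfl⟩ _ ⟨p, hp, rfl⟩
    rcases H.upper e he p hp with h | h
    · exact Or.inl (Set.mem_image_of_mem _ h)
    · exact Or.inr h
  · rintro _ ⟨e, he, rfl⟩ _ ⟨p, hp, rfl⟩ hv
    rcases H.avoids e he p hp ((hV p).1 hv) with h | h
    · exact Or.inl (congrArg _ h)
    · exact Or.inr (congrArg _ h)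
  · rintro _ ⟨e, he, rfl⟩ _ ⟨f, hf, rfl⟩ hne p hp
    obtain ⟨⟨q, hq, rfl⟩, h2⟩ := hp
    rw [hV]
    refine H.planar e he f hf (fun h => hne (h ▸ rfl)) ⟨hq, ?_⟩
    obtain ⟨q', hq', h3⟩ := h2
    rwa [← hinj h3]
  · rintro _ ⟨v, hv, rfl⟩
    rw [hdeg]; exact H.univalent v hv
  · rintro _ ⟨v, hv, rfl⟩
    rw [hdeg]; exact H.trivalent v hv
  · rintro _ ⟨e, he, rfl⟩
    exact H.weight_mem e he
  · rintro _ ⟨v, hv, rfl⟩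
    rw [hsrc, htgt, finsum_mem_image (WebEdge.reflect_injective N).injOn,
      finsum_mem_image (WebEdge.reflect_injective N).injOn]
    exact H.flow v hv

/-- Curves are unchanged, so only degrees and flow need an argument. The edges of `F` move from the
incoming to the outgoing side of a vertex or back, which keeps the total degree and changes the flow
by a multiple of `n`. -/
theorem IsWeb.flip {n N : ℕ} {w : PlaneGraph} (H : IsWeb n N w) (F : Set WebEdge) :
    IsWeb n N (w.flip n F) := by
  classical
  let φ : WebEdge → WebEdge := fun e => if e ∈ F then e.flip n else e
  have hedges : (w.flip n F).edges = φ '' w.edges := by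
    simp only [PlaneGraph.flip, φ]
  have hF : ∀ e ∈ F, φ e = e.flip n := fun e h => if_pos h
  have hnF : ∀ e ∉ F, φ e = e := fun e h => if_neg h
  have hcurve : ∀ e, (φ e).curve = e.curve := by
    intro e
    by_cases h : e ∈ F
    · rw [hF e h]; rfl
    · rw [hnF e h]
  have hinj : Set.InjOn φ w.edges := fun e he f hf h =>
    H.curve_inj he hf (by rw [← hcurve e, ← hcurve f, h])
  have hends : ∀ e, ((φ e).src = e.src ∧ (φ e).tgt = e.tgt) ∨
      ((φ e).src = e.tgt ∧ (φ e).tgt = e.src) := by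
    intro e
    by_cases h : e ∈ F
    · rw [hF e h]; exact Or.inr ⟨rfl, rfl⟩
    · rw [hnF e h]; exact Or.inl ⟨rfl, rfl⟩
  let S : ℝ × ℝ → Set WebEdge := fun v => {e | e ∈ w.edges ∧ e.src = v}
  let T : ℝ × ℝ → Set WebEdge := fun v => {e | e ∈ w.edges ∧ e.tgt = v}
  have hS : ∀ v, (S v).Finite := fun v => H.finite_edges.subset fun e h => h.1
  have hT : ∀ v, (T v).Finite := fun v => H.finite_edges.subset fun e h => h.1
  have hsrc : ∀ v, {e | e ∈ (w.flip n F).edges ∧ e.src = v} = φ '' (S v \ F ∪ T v ∩ F) := by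
    intro v
    rw [hedges]
    ext f
    constructor
    · rintro ⟨⟨e, he, rfl⟩, h⟩
      refine ⟨e, ?_, rfl⟩
      by_cases h' : e ∈ F
      · rw [hF e h'] at h; exact Or.inr ⟨⟨he, h⟩, h'⟩
      · rw [hnF e h'] at h; exact Or.inl ⟨⟨he, h⟩, h'⟩
    · rintro ⟨e, ⟨⟨he, h⟩, h'⟩ | ⟨⟨he, h⟩, h'⟩, rfl⟩
      · exact ⟨⟨e, he, rfl⟩, by rw [hnF e h']; exact h⟩
      · exact ⟨⟨e, he, rfl⟩, by rw [hF e h']; exact h⟩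
  have htgt : ∀ v, {e | e ∈ (w.flip n F).edges ∧ e.tgt = v} = φ '' (T v \ F ∪ S v ∩ F) := by
    intro v
    rw [hedges]
    ext f
    constructor
    · rintro ⟨⟨e, he, rfl⟩, h⟩
      refine ⟨e, ?_, rfl⟩
      by_cases h' : e ∈ F
      · rw [hF e h'] at h; exact Or.inr ⟨⟨he, h⟩, h'⟩
      · rw [hnF e h'] at h; exact Or.inl ⟨⟨he, h⟩, h'⟩
    · rintro ⟨e, ⟨⟨he, h⟩, h'⟩ | ⟨⟨he, h⟩, h'⟩, rfl⟩
      · exact ⟨⟨e, he, rfl⟩, by rw [hnF e h']; exact h⟩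
      · exact ⟨⟨e, he, rfl⟩, by rw [hF e h']; exact h⟩
  have hsubST : ∀ v, S v \ F ∪ T v ∩ F ⊆ w.edges := by
    rintro v e (h | h)
    · exact h.1.1
    · exact h.1.1
  have hsubTS : ∀ v, T v \ F ∪ S v ∩ F ⊆ w.edges := by
    rintro v e (h | h)
    · exact h.1.1
    · exact h.1.1
  have hdisj : ∀ A B : Set WebEdge, Disjoint (A \ F) (B ∩ F) := fun A B =>
    Set.disjoint_left.2 fun e h h' => h.2 h'.2
  have hdeg : ∀ v, (w.flip n F).degree v = w.degree v := by
    intro v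
    rw [PlaneGraph.degree, hsrc, htgt, (hinj.mono (hsubST v)).ncard_image,
      (hinj.mono (hsubTS v)).ncard_image,
      Set.ncard_union_eq (hdisj _ _) ((hS v).sdiff) ((hT v).inter_of_left F),
      Set.ncard_union_eq (hdisj _ _) ((hT v).sdiff) ((hS v).inter_of_left F)]
    have h1 := Set.ncard_inter_add_ncard_sdiff_eq_ncard (S v) F (hS v)
    have h2 := Set.ncard_inter_add_ncard_sdiff_eq_ncard (T v) F (hT v)
    have h3 : w.degree v = (S v).ncard + (T v).ncard := rfl
    omega
  have hV : (w.flip n F).boundary ∪ (w.flip n F).interior = w.boundary ∪ w.interior := rfl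
  constructor
  · exact H.boundary_eq
  · exact H.interior_pos
  · exact H.finite_interior
  · rw [hedges]; exact H.finite_edges.image _
  · rw [hedges]
    rintro _ ⟨e, he, rfl⟩
    rw [hV]
    have := H.endpoints e he
    rcases hends e with h | h
    · rw [h.1, h.2]; exact this
    · rw [h.1, h.2]; exact this.symm
  · rw [hedges]
    rintro _ ⟨e, he, rfl⟩
    by_cases h : e ∈ F
    · rw [hF e h]; exact (H.simple e he).flip n
    · rw [hnF e h]; exact H.simple e he
  · rw [hedges]
    rintro _ ⟨e, he, rfl⟩
    rw [hcurve]; exact H.upper e he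
  · rw [hedges]
    rintro _ ⟨e, he, rfl⟩ p hp hv
    rw [hcurve] at hp
    have := H.avoids e he p hp hv
    rcases hends e with h | h
    · rw [h.1, h.2]; exact this
    · rw [h.1, h.2]; exact this.symm
  · rw [hedges]
    rintro _ ⟨e, he, rfl⟩ _ ⟨f, hf, rfl⟩ hne
    rw [hcurve, hcurve]
    exact H.planar e he f hf fun h => hne (h ▸ rfl)
  · intro v hv
    rw [hdeg]; exact H.univalent v hv
  · intro v hv
    rw [hdeg]; exact H.trivalent v hv
  · rw [hedges]
    rintro _ ⟨e, he, rfl⟩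
    have := H.weight_mem e he
    by_cases h : e ∈ F
    · rw [hF e h]; simp only [WebEdge.flip]; omega
    · rw [hnF e h]; exact this
  · intro v hv
    have h1 : ∀ A : Set WebEdge, A.Finite → ∑ᶠ e ∈ A \ F, (φ e).weight = ∑ᶠ e ∈ A \ F, e.weight :=
      fun A _ => finsum_mem_congr rfl fun e he => by rw [hnF e he.2]
    have h2 : ∀ A : Set WebEdge, A.Finite → ∑ᶠ e ∈ A ∩ F, (φ e).weight =
        n * (A ∩ F).ncard - ∑ᶠ e ∈ A ∩ F, e.weight := by
      intro A hA
      have hf := hA.inter_of_left F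
      have h3 : ∑ᶠ e ∈ A ∩ F, (φ e).weight = ∑ᶠ e ∈ A ∩ F, ((n : ℤ) - e.weight) :=
        finsum_mem_congr rfl fun e he => by rw [hF e he.2]; rfl
      rw [h3, finsum_mem_sub_distrib (hs := hf)]
      congr 1
      rw [finsum_mem_eq_finite_toFinset_sum _ hf, Finset.sum_const, Set.ncard_eq_toFinset_card _ hf]
      simp [mul_comm]
    have h3 : ∀ A : Set WebEdge, A.Finite → ∑ᶠ e ∈ A, e.weight =
        ∑ᶠ e ∈ A ∩ F, e.weight + ∑ᶠ e ∈ A \ F, e.weight := fun A hA =>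
      (finsum_mem_inter_add_sdiff F hA).symm
    rw [hsrc, htgt, finsum_mem_image (hinj.mono (hsubST v)),
      finsum_mem_image (hinj.mono (hsubTS v)),
      finsum_mem_union (hdisj _ _) ((hT v).sdiff) ((hS v).inter_of_left F),
      finsum_mem_union (hdisj _ _) ((hS v).sdiff) ((hT v).inter_of_left F),
      h1 _ (hS v), h1 _ (hT v), h2 _ (hS v), h2 _ (hT v)]
    have h4 := H.flow v hv
    change (∑ᶠ e ∈ T v, e.weight) - (∑ᶠ e ∈ S v, e.weight) ≡ 0 [ZMOD n] at h4
    rw [h3 _ (hS v), h3 _ (hT v)] at h4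
    rw [Int.modEq_zero_iff_dvd] at h4 ⊢
    obtain ⟨x, hx⟩ := h4
    -- A flipped outgoing edge contributes `n - ℓ` instead of `-ℓ`, a flipped incoming one `ℓ - n`
    -- instead of `ℓ`.
    refine ⟨x + (S v ∩ F).ncard - (T v ∩ F).ncard, ?_⟩
    linarith

/-! ## Points on the pieces of an arc -/

/-- The abscissa of the apex of an arc. -/
noncomputable def ColoredArc.mid (a : ColoredArc) : ℝ := ((a.start : ℝ) + a.finish) / 2

theorem ColoredArc.apex_eq (m : ℝ) (a : ColoredArc) :
    a.apex m = (a.mid, m * (a.mid - a.start)) := by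
  ext
  · rfl
  · simp only [ColoredArc.apex, ColoredArc.mid]; ring

theorem ColoredArc.apex_eq' (m : ℝ) (a : ColoredArc) :
    a.apex m = (a.mid, m * (a.finish - a.mid)) := by
  ext
  · rfl
  · simp only [ColoredArc.apex, ColoredArc.mid]; ring

theorem foot_of_hasY {ε : ℝ} {M : Set ColoredArc} {p : ℤ} (h : HasY M p) :
    foot ε M p = ((p : ℝ), ε) := by simp [foot, h]

theorem foot_of_not_hasY {ε : ℝ} {M : Set ColoredArc} {p : ℤ} (h : ¬ HasY M p) :
    foot ε M p = ((p : ℝ), 0) := by simp [foot, h]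

theorem foot_fst (ε : ℝ) (M : Set ColoredArc) (p : ℤ) : (foot ε M p).1 = p := by
  unfold foot; split_ifs <;> rfl

theorem foot_snd (ε : ℝ) (M : Set ColoredArc) (p : ℤ) :
    (foot ε M p).2 = ε ∨ (foot ε M p).2 = 0 := by
  unfold foot; split_ifs <;> simp

theorem foot_snd_bounds {ε : ℝ} (hε : 0 < ε) (M : Set ColoredArc) (p : ℤ) :
    0 ≤ (foot ε M p).2 ∧ (foot ε M p).2 ≤ ε := by
  rcases foot_snd ε M p with h | h <;> rw [h] <;> constructor <;> linarith

theorem ArcNode.fst {m ε : ℝ} {M : Set ColoredArc} {a : ColoredArc} {t : ℝ} {p q : ℝ × ℝ}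
    (h : ArcNode m ε M a t p q) : p.1 = t ∧ q.1 = t := by
  cases h with
  | first => exact ⟨foot_fst _ _ _, foot_fst _ _ _⟩
  | rising b hb h => exact ⟨rfl, rfl⟩
  | falling b hb h => exact ⟨rfl, rfl⟩
  | last => exact ⟨foot_fst _ _ _, foot_fst _ _ _⟩

theorem ArcNode.half_int {m ε : ℝ} {M : Set ColoredArc} {a : ColoredArc} {t : ℝ} {p q : ℝ × ℝ}
    (h : ArcNode m ε M a t p q) : ∃ z : ℤ, t = z / 2 := by
  cases h with
  | first => exact ⟨2 * a.start, by push_cast; ring⟩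
  | rising b hb h => exact ⟨a.start + b.finish, by push_cast; ring⟩
  | falling b hb h => exact ⟨b.start + a.finish, by push_cast; ring⟩
  | last => exact ⟨2 * a.finish, by push_cast; ring⟩

/-- The source of the constant `4`: vertical deviations at the ends of a segment differ by at most
`2 * ε` over a width of at least `1 / 2`, so the deviation has slope at most `4 * ε`, which is less
than `m`. -/
theorem half_int_gap {s t : ℝ} (hs : ∃ z : ℤ, s = z / 2) (ht : ∃ z : ℤ, t = z / 2) (h : s < t) :
    s + 1 / 2 ≤ t := by
  obtain ⟨x, rfl⟩ := hs
  obtain ⟨y, rfl⟩ := ht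
  have : (x : ℝ) < y := by linarith
  have : x + 1 ≤ y := by exact_mod_cast this
  have : (x : ℝ) + 1 ≤ y := by exact_mod_cast this
  linarith

/-- The nodes of an arc: its left foot, the rising crossings, the falling crossings, and its right
foot. -/
theorem ArcNode.cases' {m ε : ℝ} {M : Set ColoredArc} {a : ColoredArc} {t : ℝ} {p q : ℝ × ℝ}
    (h : ArcNode m ε M a t p q) (ha : a.start < a.finish) :
    (t < a.mid ∧ ((t = a.start ∧ p = foot ε M a.start ∧ q = foot ε M a.start) ∨
      (a.start < t ∧ p = (t, m * (t - a.start) - ε) ∧ q = (t, m * (t - a.start) + ε)))) ∨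
    (a.mid < t ∧ ((t = a.finish ∧ p = foot ε M a.finish ∧ q = foot ε M a.finish) ∨
      (t < a.finish ∧ p = (t, m * (a.finish - t) + ε) ∧ q = (t, m * (a.finish - t) - ε)))) := by
  have ha' : (a.start : ℝ) < a.finish := by exact_mod_cast ha
  unfold ColoredArc.mid
  cases h with
  | first => exact Or.inl ⟨by linarith, Or.inl ⟨rfl, rfl, rfl⟩⟩
  | rising b hb h =>
    have h1 : (a.start : ℝ) < b.finish := by exact_mod_cast h.2.1
    have h2 : (b.finish : ℝ) < a.finish := by exact_mod_cast h.2.2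
    refine Or.inl ⟨by linarith, Or.inr ⟨by linarith, ?_, ?_⟩⟩ <;>
    · simp only [crossingPoint]; congr 1; ring
  | falling b hb h =>
    have h1 : (b.start : ℝ) < a.finish := by exact_mod_cast h.2.1
    have h2 : (a.start : ℝ) < b.start := by exact_mod_cast h.1
    refine Or.inr ⟨by linarith, Or.inr ⟨by linarith, ?_, ?_⟩⟩ <;>
    · simp only [crossingPoint]; congr 1; ring
  | last => exact Or.inr ⟨by linarith, Or.inl ⟨rfl, rfl, rfl⟩⟩

theorem ArcNode.mem_Icc {m ε : ℝ} {M : Set ColoredArc} {a : ColoredArc} {t : ℝ} {p q : ℝ × ℝ}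
    (h : ArcNode m ε M a t p q) (ha : a.start < a.finish) : a.start ≤ t ∧ t ≤ a.finish := by
  have ha' : (a.start : ℝ) < a.finish := by exact_mod_cast ha
  rcases h.cases' ha with ⟨h1, h2⟩ | ⟨h1, h2⟩
  · unfold ColoredArc.mid at h1
    constructor
    · rcases h2 with h2 | h2
      · exact h2.1.ge
      · exact h2.1.le
    · linarith
  · unfold ColoredArc.mid at h1
    constructor
    · linarith
    · rcases h2 with h2 | h2
      · exact h2.1.le
      · exact h2.1.le

/-! ### Edges as steps between consecutive nodes -/

/-- An edge of the arc `a` runs from `q` at abscissa `t` to `p` at abscissa `t'`. -/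
structure IsArcStep (m ε : ℝ) (M : Set ColoredArc) (a : ColoredArc) (t : ℝ) (q : ℝ × ℝ) (t' : ℝ)
    (p : ℝ × ℝ) : Prop where
  mem : a ∈ M
  left : ∃ p₀, ArcNode m ε M a t p₀ q
  right : ∃ q₀, ArcNode m ε M a t' p q₀
  lt : t < t'
  consecutive : ∀ s u v, ArcNode m ε M a s u v → ¬ (t < s ∧ s < t')

/-- The edge that belongs to a step of an arc. -/
noncomputable def stepEdge (m : ℝ) (a : ColoredArc) (t : ℝ) (q : ℝ × ℝ) (t' : ℝ) (p : ℝ × ℝ) :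
    WebEdge :=
  ⟨q, p, arcPiece m a t t' q p, a.color⟩

theorem mem_arcEdges {m ε : ℝ} {M : Set ColoredArc} {e : WebEdge} :
    e ∈ arcEdges m ε M ↔
      ∃ a t q t' p, IsArcStep m ε M a t q t' p ∧ e = stepEdge m a t q t' p := by
  constructor
  · rintro ⟨a, ha, t, t', p, q, p', q', h1, h2, h3, h4, rfl⟩
    exact ⟨a, t, q, t', p', ⟨ha, ⟨p, h1⟩, ⟨q', h2⟩, h3, h4⟩, rfl⟩
  · rintro ⟨a, t, q, t', p', ⟨ha, ⟨p, h1⟩, ⟨q', h2⟩, h3, h4⟩, rfl⟩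
    exact ⟨a, ha, t, t', p, q, p', q', h1, h2, h3, h4, rfl⟩

theorem segment_eq_left {A B P : ℝ × ℝ} (h : P ∈ segment ℝ A B) (hlt : A.1 < B.1)
    (hP : P.1 = A.1) : P = A := by
  obtain ⟨u, v, hu, hv, huv, rfl⟩ := h
  simp only [Prod.fst_add, Prod.smul_fst, smul_eq_mul] at hP
  have h1 : v * (B.1 - A.1) = 0 := by
    have : u = 1 - v := by linarith
    subst this; linarith
  have h2 : v = 0 := by
    rcases mul_eq_zero.1 h1 with h | h
    · exact h
    · linarith
  subst h2
  have : u = 1 := by linarith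
  subst this
  simp

theorem segment_eq_right {A B P : ℝ × ℝ} (h : P ∈ segment ℝ A B) (hlt : A.1 < B.1)
    (hP : P.1 = B.1) : P = B := by
  obtain ⟨u, v, hu, hv, huv, rfl⟩ := h
  simp only [Prod.fst_add, Prod.smul_fst, smul_eq_mul] at hP
  have h1 : u * (B.1 - A.1) = 0 := by
    have : v = 1 - u := by linarith
    subst this; linarith
  have h2 : u = 0 := by
    rcases mul_eq_zero.1 h1 with h | h
    · exact h
    · linarith
  subst h2
  have : v = 1 := by linarith
  subst this
  simp

theorem segment_fst {A B P : ℝ × ℝ} (h : P ∈ segment ℝ A B) (hlt : A.1 ≤ B.1) :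
    A.1 ≤ P.1 ∧ P.1 ≤ B.1 := by
  obtain ⟨u, v, hu, hv, huv, rfl⟩ := h
  simp only [Prod.fst_add, Prod.smul_fst, smul_eq_mul]
  have : u = 1 - v := by linarith
  subst this
  constructor <;> nlinarith

/-- The vertical deviation of a segment from a line, in terms of the deviations at its ends. -/
theorem segment_deviation {A B P : ℝ × ℝ} {ε α β e₀ e₁ : ℝ} (h : P ∈ segment ℝ A B)
    (hlt : A.1 + 1 / 2 ≤ B.1) (hA : A.2 = α * A.1 + β + e₀) (hB : B.2 = α * B.1 + β + e₁)
    (h0 : -ε ≤ e₀ ∧ e₀ ≤ ε) (h1 : -ε ≤ e₁ ∧ e₁ ≤ ε) :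
    ∃ e, P.2 = α * P.1 + β + e ∧ -ε ≤ e ∧ e ≤ ε ∧ e₀ - 4 * ε * (P.1 - A.1) ≤ e ∧
      e ≤ e₀ + 4 * ε * (P.1 - A.1) ∧ e₁ - 4 * ε * (B.1 - P.1) ≤ e ∧
        e ≤ e₁ + 4 * ε * (B.1 - P.1) := by
  obtain ⟨u, v, hu, hv, huv, rfl⟩ := h
  have hε : 0 ≤ ε := by linarith
  simp only [Prod.fst_add, Prod.smul_fst, smul_eq_mul, Prod.snd_add, Prod.smul_snd]
  rw [hA, hB]
  have hu' : u = 1 - v := by linarith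
  have h2 : 0 ≤ ε * v * (B.1 - A.1 - 1 / 2) := by
    apply mul_nonneg (mul_nonneg hε hv); linarith
  have h3 : 0 ≤ ε * u * (B.1 - A.1 - 1 / 2) := by
    apply mul_nonneg (mul_nonneg hε hu); linarith
  have e1 : u * A.1 + v * B.1 - A.1 = v * (B.1 - A.1) := by rw [hu']; ring
  have e2 : B.1 - (u * A.1 + v * B.1) = u * (B.1 - A.1) := by
    have : v = 1 - u := by linarith
    rw [this]; ring
  rw [e1, e2]
  have a1 := mul_le_mul_of_nonneg_left h0.1 hu
  have a2 := mul_le_mul_of_nonneg_left h0.2 hu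
  have a3 := mul_le_mul_of_nonneg_left h1.1 hv
  have a4 := mul_le_mul_of_nonneg_left h1.2 hv
  have b1 := mul_le_mul_of_nonneg_left h0.1 hv
  have b2 := mul_le_mul_of_nonneg_left h0.2 hv
  have b3 := mul_le_mul_of_nonneg_left h1.1 hu
  have b4 := mul_le_mul_of_nonneg_left h1.2 hu
  have s0 : u * e₀ + v * e₀ = e₀ := by rw [← add_mul, huv, one_mul]
  have s1 : u * e₁ + v * e₁ = e₁ := by rw [← add_mul, huv, one_mul]
  have sε : u * ε + v * ε = ε := by rw [← add_mul, huv, one_mul]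
  refine ⟨u * e₀ + v * e₁, ?_, ?_, ?_, ?_, ?_, ?_, ?_⟩
  · rw [hu']; ring
  all_goals nlinarith

/-- `P` lies on the rising side of the triangle of `a`, up to a small vertical deviation, between
the nodes at `t` and `t'`. -/
structure RisePt (m ε : ℝ) (M : Set ColoredArc) (a : ColoredArc) (t t' : ℝ) (P : ℝ × ℝ) :
    Prop where
  ge : t ≤ P.1
  le : P.1 ≤ t'
  le_mid : P.1 ≤ a.mid
  deviation : ∃ e, P.2 = m * (P.1 - a.start) + e ∧ -ε ≤ e ∧ e ≤ ε ∧
    (t' < a.mid → e ≤ -ε + 4 * ε * (t' - P.1)) ∧ (a.start < t → ε - 4 * ε * (P.1 - t) ≤ e) ∧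
    (foot ε M a.start).2 - 4 * ε * (P.1 - a.start) ≤ e

/-- `P` lies on the falling side of the triangle of `a`, up to a small vertical deviation, between
the nodes at `t` and `t'`. -/
structure FallPt (m ε : ℝ) (M : Set ColoredArc) (a : ColoredArc) (t t' : ℝ) (P : ℝ × ℝ) :
    Prop where
  ge : t ≤ P.1
  le : P.1 ≤ t'
  mid_le : a.mid ≤ P.1
  deviation : ∃ e, P.2 = m * (a.finish - P.1) + e ∧ -ε ≤ e ∧ e ≤ ε ∧
    (a.mid < t → e ≤ -ε + 4 * ε * (P.1 - t)) ∧ (t' < a.finish → ε - 4 * ε * (t' - P.1) ≤ e) ∧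
    (foot ε M a.finish).2 - 4 * ε * (a.finish - P.1) ≤ e

theorem ColoredArc.mid_half_int (a : ColoredArc) : ∃ z : ℤ, a.mid = z / 2 :=
  ⟨a.start + a.finish, by unfold ColoredArc.mid; push_cast; ring⟩

theorem start_half_int (z : ℤ) : ∃ y : ℤ, (z : ℝ) = y / 2 := ⟨2 * z, by push_cast; ring⟩

/-- The right end `B` is either the apex, with deviation `0`, or the lower vertex of a rising
crossing, with deviation `-ε`. The left end is the foot or the upper vertex of a rising crossing.
The refined bounds of `RisePt` propagate these end values with slope `4 * ε`. -/
theorem risePt_of_segment {m ε : ℝ} {M : Set ColoredArc} {a : ColoredArc} {t t' s : ℝ}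
    {p₀ q B P : ℝ × ℝ} (hε : 0 < ε) (hs : a.start < a.finish) (hq : ArcNode m ε M a t p₀ q)
    (ht : t < a.mid) (hsB : B.1 = s) (hss : ∃ z : ℤ, s = z / 2) (hts : t < s) (hst : s ≤ t')
    (hsm : s ≤ a.mid) {e₁ : ℝ} (hB : B.2 = m * (s - a.start) + e₁) (he₁ : -ε ≤ e₁ ∧ e₁ ≤ ε)
    (htm : t' < a.mid → s = t' ∧ e₁ = -ε) (hP : P ∈ segment ℝ q B) :
    RisePt m ε M a t t' P := by
  have hq1 := hq.fst.2
  have hgap := half_int_gap hq.half_int hss hts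
  have hfb := foot_snd_bounds hε M a.start
  have hle := segment_fst hP (by rw [hq1, hsB]; exact hts.le)
  rw [hq1, hsB] at hle
  have hcase := hq.cases' hs
  have hnode : ∃ e₀, q.2 = m * (t - a.start) + e₀ ∧ -ε ≤ e₀ ∧ e₀ ≤ ε ∧
      (a.start < t → e₀ = ε) ∧ (t ≤ a.start → t = a.start ∧ e₀ = (foot ε M a.start).2) := by
    rcases hcase with ⟨_, ⟨h1, h2, h3⟩ | ⟨h1, h2, h3⟩⟩ | ⟨h1, _⟩
    · refine ⟨(foot ε M a.start).2, ?_, by linarith, hfb.2, fun h => ?_, fun _ => ⟨h1, rfl⟩⟩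
      · rw [h3, h1]; ring
      · rw [h1] at h; exact absurd h (lt_irrefl _)
    · exact ⟨ε, by rw [h3], by linarith, le_rfl, fun _ => rfl, fun h => by linarith⟩
    · linarith
  obtain ⟨e₀, h1, h2, h3, h4, h5⟩ := hnode
  obtain ⟨e, g1, g2, g3, g4, g5, g6, g7⟩ := segment_deviation (ε := ε) (α := m)
    (β := - m * a.start) (e₀ := e₀) (e₁ := e₁) hP (by rw [hq1, hsB]; exact hgap)
    (by rw [h1, hq1]; ring) (by rw [hB, hsB]; ring) ⟨h2, h3⟩ he₁
  rw [hq1] at g4 g5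
  rw [hsB] at g6 g7
  refine ⟨hle.1, hle.2.trans hst, hle.2.trans hsm, e, by rw [g1]; ring, g2, g3, ?_, ?_, ?_⟩
  · intro h
    obtain ⟨h6, h7⟩ := htm h
    rw [h6, h7] at g7
    exact g7
  · intro h
    rw [h4 h] at g4
    exact g4
  · by_cases h : a.start < t
    · have h6 := half_int_gap (start_half_int a.start) hq.half_int h
      have h7 : 0 ≤ ε * (P.1 - a.start - 1 / 2) := mul_nonneg hε.le (by linarith [hle.1])
      nlinarith
    · obtain ⟨h6, h7⟩ := h5 (not_lt.1 h)
      rw [h7, h6] at g4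
      exact g4

theorem fallPt_of_segment {m ε : ℝ} {M : Set ColoredArc} {a : ColoredArc} {t t' s : ℝ}
    {p q₀ A P : ℝ × ℝ} (hε : 0 < ε) (hs : a.start < a.finish) (hp : ArcNode m ε M a t' p q₀)
    (ht : a.mid < t') (hsA : A.1 = s) (hss : ∃ z : ℤ, s = z / 2) (hst : s < t') (hts : t ≤ s)
    (hsm : a.mid ≤ s) {e₀ : ℝ} (hA : A.2 = m * (a.finish - s) + e₀) (he₀ : -ε ≤ e₀ ∧ e₀ ≤ ε)
    (htm : a.mid < t → s = t ∧ e₀ = -ε) (hP : P ∈ segment ℝ A p) :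
    FallPt m ε M a t t' P := by
  have hp1 := hp.fst.1
  have hgap := half_int_gap hss hp.half_int hst
  have hfb := foot_snd_bounds hε M a.finish
  have hle := segment_fst hP (by rw [hp1, hsA]; exact hst.le)
  rw [hp1, hsA] at hle
  have hcase := hp.cases' hs
  have hnode : ∃ e₁, p.2 = m * (a.finish - t') + e₁ ∧ -ε ≤ e₁ ∧ e₁ ≤ ε ∧
      (t' < a.finish → e₁ = ε) ∧
      (a.finish ≤ t' → t' = a.finish ∧ e₁ = (foot ε M a.finish).2) := by
    rcases hcase with ⟨h1, _⟩ | ⟨_, ⟨h1, h2, h3⟩ | ⟨h1, h2, h3⟩⟩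
    · linarith
    · refine ⟨(foot ε M a.finish).2, ?_, by linarith, hfb.2, fun h => ?_, fun _ => ⟨h1, rfl⟩⟩
      · rw [h2, h1]; ring
      · rw [h1] at h; exact absurd h (lt_irrefl _)
    · exact ⟨ε, by rw [h2], by linarith, le_rfl, fun _ => rfl, fun h => by linarith⟩
  obtain ⟨e₁, h1, h2, h3, h4, h5⟩ := hnode
  obtain ⟨e, g1, g2, g3, g4, g5, g6, g7⟩ := segment_deviation (ε := ε) (α := -m)
    (β := m * a.finish) (e₀ := e₀) (e₁ := e₁) hP (by rw [hp1, hsA]; exact hgap)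
    (by rw [hA, hsA]; ring) (by rw [h1, hp1]; ring) he₀ ⟨h2, h3⟩
  rw [hsA] at g4 g5
  rw [hp1] at g6 g7
  refine ⟨hts.trans hle.1, hle.2, hsm.trans hle.1, e, by rw [g1]; ring, g2, g3, ?_, ?_, ?_⟩
  · intro h
    obtain ⟨h6, h7⟩ := htm h
    rw [h6, h7] at g5
    exact g5
  · intro h
    rw [h4 h] at g6
    exact g6
  · by_cases h : t' < a.finish
    · have h6 := half_int_gap hp.half_int (start_half_int a.finish) h
      have h7 : 0 ≤ ε * (a.finish - P.1 - 1 / 2) := mul_nonneg hε.le (by linarith [hle.2])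
      nlinarith
    · obtain ⟨h6, h7⟩ := h5 (not_lt.1 h)
      rw [h7, h6] at g6
      exact g6

section Steps

variable {n N : ℕ} {M : Set ColoredArc} {m ε : ℝ} {a : ColoredArc} {t t' : ℝ} {q p P : ℝ × ℝ}

/-- No node lies at the apex, so an edge either stays on one side of its triangle or bends at the
apex into one segment on each side. -/
theorem IsArcStep.point (H : ArcSystem n N M) (hε : 0 < ε) (S : IsArcStep m ε M a t q t' p)
    (hP : P ∈ arcPiece m a t t' q p) : RisePt m ε M a t t' P ∨ FallPt m ε M a t t' P := by
  obtain ⟨p₀, hq⟩ := S.left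
  obtain ⟨q₀, hp⟩ := S.right
  have hs := (H.arc a S.mem).2.1
  have hapex : (a.apex m).1 = a.mid := rfl
  unfold arcPiece at hP
  rw [hapex] at hP
  have hmε : -ε ≤ -ε ∧ -ε ≤ ε := ⟨le_rfl, by linarith⟩
  have h0ε : -ε ≤ 0 ∧ 0 ≤ ε := ⟨by linarith, hε.le⟩
  have hlt := S.lt
  rcases hq.cases' hs with ⟨h1, h2⟩ | ⟨h1, h2⟩
  · rcases hp.cases' hs with ⟨h3, h4⟩ | ⟨h3, h4⟩
    · rw [if_neg (by rintro ⟨-, h⟩; linarith)] at hP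
      left
      have h5 : p = (t', m * (t' - a.start) - ε) := by
        rcases h4 with h4 | h4
        · have := (hq.mem_Icc hs).1; linarith [h4.1]
        · exact h4.2.1
      exact risePt_of_segment hε hs hq h1 hp.fst.1 hp.half_int hlt le_rfl h3.le
        (by rw [h5]; rfl) hmε (fun _ => ⟨rfl, rfl⟩) hP
    · rw [if_pos ⟨h1, h3⟩] at hP
      rcases hP with hP | hP
      · left
        exact risePt_of_segment hε hs hq h1 hapex a.mid_half_int h1 h3.le le_rfl
          (by rw [ColoredArc.apex_eq]; exact (add_zero _).symm) h0ε (fun h => by linarith) hP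
      · right
        exact fallPt_of_segment hε hs hp h3 hapex a.mid_half_int h3 h1.le le_rfl
          (by rw [ColoredArc.apex_eq']; exact (add_zero _).symm) h0ε (fun h => by linarith) hP
  · rw [if_neg (by rintro ⟨h, -⟩; linarith)] at hP
    right
    have h5 : q = (t, m * (a.finish - t) - ε) := by
      rcases h2 with h2 | h2
      · have := (hp.mem_Icc hs).2; linarith [h2.1]
      · exact h2.2.2
    exact fallPt_of_segment hε hs hp (h1.trans hlt) hq.fst.2 hq.half_int hlt le_rfl h1.le
      (by rw [h5]; rfl) hmε (fun _ => ⟨rfl, rfl⟩) hP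

theorem IsArcStep.fst_mem (S : IsArcStep m ε M a t q t' p) (hP : P ∈ arcPiece m a t t' q p) :
    t ≤ P.1 ∧ P.1 ≤ t' := by
  obtain ⟨p₀, hq⟩ := S.left
  obtain ⟨q₀, hp⟩ := S.right
  have hlt := S.lt
  have hq1 := hq.fst.2
  have hp1 := hp.fst.1
  unfold arcPiece at hP
  split_ifs at hP with h
  · rcases hP with hP | hP
    · have := segment_fst hP (by rw [hq1]; exact h.1.le)
      rw [hq1] at this
      exact ⟨this.1, this.2.trans h.2.le⟩
    · have := segment_fst hP (by rw [hp1]; exact h.2.le)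
      rw [hp1] at this
      exact ⟨h.1.le.trans this.1, this.2⟩
  · have := segment_fst hP (by rw [hq1, hp1]; exact hlt.le)
    rwa [hq1, hp1] at this

theorem IsArcStep.eq_left (S : IsArcStep m ε M a t q t' p) (hP : P ∈ arcPiece m a t t' q p)
    (h1 : P.1 = t) : P = q := by
  obtain ⟨p₀, hq⟩ := S.left
  obtain ⟨q₀, hp⟩ := S.right
  have hlt := S.lt
  have hq1 := hq.fst.2
  have hp1 := hp.fst.1
  unfold arcPiece at hP
  split_ifs at hP with h
  · rcases hP with hP | hP
    · exact segment_eq_left hP (by rw [hq1]; exact h.1) (by rw [h1, hq1])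
    · have := segment_fst hP (by rw [hp1]; exact h.2.le)
      linarith [h.1]
  · exact segment_eq_left hP (by rw [hq1, hp1]; exact hlt) (by rw [h1, hq1])

theorem IsArcStep.eq_right (S : IsArcStep m ε M a t q t' p) (hP : P ∈ arcPiece m a t t' q p)
    (h1 : P.1 = t') : P = p := by
  obtain ⟨p₀, hq⟩ := S.left
  obtain ⟨q₀, hp⟩ := S.right
  have hlt := S.lt
  have hq1 := hq.fst.2
  have hp1 := hp.fst.1
  unfold arcPiece at hP
  split_ifs at hP with h
  · rcases hP with hP | hP
    · have := segment_fst hP (by rw [hq1]; exact h.1.le)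
      linarith [h.2]
    · exact segment_eq_right hP (by rw [hp1]; exact h.2) (by rw [h1, hp1])
  · exact segment_eq_right hP (by rw [hq1, hp1]; exact hlt) (by rw [h1, hp1])

/-- A node in the range of a step is one of its ends. -/
theorem IsArcStep.eq_end (S : IsArcStep m ε M a t q t' p) (hP : P ∈ arcPiece m a t t' q p)
    {u v : ℝ × ℝ} (hs : ArcNode m ε M a P.1 u v) : P = q ∨ P = p := by
  have h1 := S.fst_mem hP
  have h2 := S.consecutive _ _ _ hs
  rcases eq_or_lt_of_le h1.1 with h3 | h3
  · exact Or.inl (S.eq_left hP h3.symm)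
  · rcases eq_or_lt_of_le h1.2 with h4 | h4
    · exact Or.inr (S.eq_right hP h4)
    · exact absurd ⟨h3, h4⟩ h2

end Steps

/-! ## Planarity -/

/-- The vertices of the web. -/
def webVertices (N : ℕ) (m ε : ℝ) (M : Set ColoredArc) : Set (ℝ × ℝ) :=
  (preWeb N m ε M).boundary ∪ (preWeb N m ε M).interior

section Planarity

variable {n N : ℕ} {M : Set ColoredArc} {m ε : ℝ}

theorem bottom_mem {i : ℤ} (h1 : 1 ≤ i) (h2 : i ≤ N) :
    ((i : ℝ), (0 : ℝ)) ∈ (preWeb N m ε M).boundary := ⟨i, h1, h2, rfl⟩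

theorem foot_mem {p : ℤ} (h1 : 1 ≤ p) (h2 : p ≤ N) : foot ε M p ∈ webVertices N m ε M := by
  by_cases h : HasY M p
  · rw [foot_of_hasY h]; exact Or.inr (Or.inl ⟨p, h, rfl⟩)
  · rw [foot_of_not_hasY h]; exact Or.inl (bottom_mem h1 h2)

theorem crossingPoint_mem {a b : ColoredArc} (ha : a ∈ M) (hb : b ∈ M) (h : a.Crosses b) :
    crossingPoint m ε a b ∈ webVertices N m ε M ∧
      crossingPoint m (-ε) a b ∈ webVertices N m ε M :=
  ⟨Or.inr (Or.inr ⟨a, ha, b, hb, h, Or.inl rfl⟩), Or.inr (Or.inr ⟨a, ha, b, hb, h, Or.inr rfl⟩)⟩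

theorem ArcNode.mem_vertices (H : ArcSystem n N M) {a : ColoredArc} (ha : a ∈ M) {t : ℝ}
    {p q : ℝ × ℝ} (h : ArcNode m ε M a t p q) :
    p ∈ webVertices N m ε M ∧ q ∈ webVertices N m ε M := by
  have h1 := H.arc a ha
  cases h with
  | first =>
    have := foot_mem (N := N) (m := m) (ε := ε) (M := M) h1.1 (by omega)
    exact ⟨this, this⟩
  | rising b hb h => exact (crossingPoint_mem hb ha h).symm
  | falling b hb h => exact crossingPoint_mem ha hb h
  | last =>
    have := foot_mem (N := N) (m := m) (ε := ε) (M := M) (p := a.finish) (by omega) h1.2.2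
    exact ⟨this, this⟩

theorem IsArcStep.mem_vertices (H : ArcSystem n N M) {a : ColoredArc} {t t' : ℝ} {q p : ℝ × ℝ}
    (S : IsArcStep m ε M a t q t' p) :
    q ∈ webVertices N m ε M ∧ p ∈ webVertices N m ε M := by
  obtain ⟨p₀, hq⟩ := S.left
  obtain ⟨q₀, hp⟩ := S.right
  exact ⟨(hq.mem_vertices H S.mem).2, (hp.mem_vertices H S.mem).1⟩

theorem IsArcStep.end_mem_vertices (H : ArcSystem n N M) {a : ColoredArc} {t t' : ℝ}
    {q p P : ℝ × ℝ} (S : IsArcStep m ε M a t q t' p) (h : P = q ∨ P = p) :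
    P ∈ webVertices N m ε M := by
  rcases h with rfl | rfl
  · exact (S.mem_vertices H).1
  · exact (S.mem_vertices H).2

theorem IsArcStep.range (H : ArcSystem n N M) {a : ColoredArc} {t t' : ℝ} {q p P : ℝ × ℝ}
    (S : IsArcStep m ε M a t q t' p) (hP : P ∈ arcPiece m a t t' q p) :
    a.start ≤ P.1 ∧ P.1 ≤ a.finish := by
  obtain ⟨p₀, hq⟩ := S.left
  obtain ⟨q₀, hp⟩ := S.right
  have hs := (H.arc a S.mem).2.1
  have h1 := (hq.mem_Icc hs).1
  have h2 := (hp.mem_Icc hs).2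
  have h3 := S.fst_mem hP
  exact ⟨h1.trans h3.1, h3.2.trans h2⟩

/-- A point of low height over an integer on an arc is the end of an edge. -/
theorem IsArcStep.low_point (H : ArcSystem n N M) (hε : 0 < ε) (hεm : ε < m / 4)
    {a : ColoredArc} {t t' : ℝ} {q p P : ℝ × ℝ} (S : IsArcStep m ε M a t q t' p)
    (hP : P ∈ arcPiece m a t t' q p) {i : ℤ} (hi : P.1 = i) (hlow : P.2 ≤ ε) :
    P = q ∨ P = p := by
  have h1 := S.range H hP
  rw [hi] at h1
  have h2 : a.start ≤ i := by exact_mod_cast h1.1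
  have h3 : i ≤ a.finish := by exact_mod_cast h1.2
  rcases eq_or_lt_of_le h2 with h4 | h4
  · exact S.eq_end hP (by rw [hi, ← h4]; exact ArcNode.first)
  rcases eq_or_lt_of_le h3 with h5 | h5
  · exact S.eq_end hP (by rw [hi, h5]; exact ArcNode.last)
  -- Strictly between the feet an integral abscissa is at distance at least `1` from both, so the
  -- height is at least `m - ε > ε`.
  exfalso
  have h6 : (a.start : ℝ) + 1 ≤ i := by exact_mod_cast h4
  have h7 : (i : ℝ) + 1 ≤ a.finish := by exact_mod_cast h5
  rcases S.point H hε hP with R | R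
  · obtain ⟨e, g1, g2, -⟩ := R.deviation
    have : 0 ≤ m * (P.1 - a.start - 1) := mul_nonneg (by linarith) (by rw [hi]; linarith)
    nlinarith
  · obtain ⟨e, g1, g2, -⟩ := R.deviation
    have : 0 ≤ m * (a.finish - P.1 - 1) := mul_nonneg (by linarith) (by rw [hi]; linarith)
    nlinarith

/-- A multiple of `m` that is smaller than `m` vanishes. -/
theorem int_eq_of_mul_lt {x y : ℤ} {δ : ℝ} (hm : 0 < m) (h : m * ((x : ℝ) - y) = δ)
    (h1 : -m < δ) (h2 : δ < m) : x = y := by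
  rcases lt_trichotomy x y with h3 | h3 | h3
  · have h4 : (x : ℝ) + 1 ≤ y := by exact_mod_cast h3
    have : 0 ≤ m * ((y : ℝ) - x - 1) := mul_nonneg hm.le (by linarith)
    nlinarith
  · exact h3
  · have h4 : (y : ℝ) + 1 ≤ x := by exact_mod_cast h3
    have : 0 ≤ m * ((x : ℝ) - y - 1) := mul_nonneg hm.le (by linarith)
    nlinarith

/-- An arc that comes close to a crossing is one of the two crossing arcs, and meets the vertical
edge there in its own vertices only. -/
theorem IsArcStep.near_crossing (H : ArcSystem n N M) (hε : 0 < ε) (hεm : ε < m / 4)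
    {c : ColoredArc} {t t' : ℝ} {q p P : ℝ × ℝ} (S : IsArcStep m ε M c t q t' p)
    (hP : P ∈ arcPiece m c t t' q p) {a b : ColoredArc} (ha : a ∈ M) (hb : b ∈ M)
    (hab : a.Crosses b) (h1 : P.1 = ((b.start : ℝ) + a.finish) / 2)
    (h2 : m * ((a.finish : ℝ) - b.start) / 2 - ε ≤ P.2)
    (h3 : P.2 ≤ m * ((a.finish : ℝ) - b.start) / 2 + ε) : P = q ∨ P = p := by
  have hm : 0 < m := by linarith
  rcases S.point H hε hP with R | R
  · obtain ⟨e, g1, g2, g3, -⟩ := R.deviation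
    have h4 : m * ((b.start : ℝ) - c.start) = P.2 - e - m * ((a.finish : ℝ) - b.start) / 2 := by
      rw [g1, h1]; ring
    -- Rising sides are parallel with vertical offsets in `m * ℤ`; an offset of at most `2 * ε < m`
    -- forces equal starts.
    have h5 := int_eq_of_mul_lt hm h4 (by linarith) (by linarith)
    obtain rfl := H.start_inj _ hb _ S.mem h5
    refine S.eq_end hP (u := crossingPoint m (-ε) a b) (v := crossingPoint m ε a b) ?_
    rw [h1]
    exact ArcNode.rising a ha hab
  · obtain ⟨e, g1, g2, g3, -⟩ := R.deviation
    have h4 : m * ((c.finish : ℝ) - a.finish) = P.2 - e - m * ((a.finish : ℝ) - b.start) / 2 := by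
      rw [g1, h1]; ring
    have h5 := int_eq_of_mul_lt hm h4 (by linarith) (by linarith)
    obtain rfl := H.finish_inj _ S.mem _ ha h5
    refine S.eq_end hP (u := crossingPoint m ε c b) (v := crossingPoint m (-ε) c b) ?_
    rw [h1]
    exact ArcNode.falling b hb hab

/-- The ideal sides meet at the abscissa `x₀` halfway between `b.start` and `a.finish`. A common
point of the edges is closer to `x₀` than `1 / 2`, which forces the arcs to cross, unless they meet
at a common foot. On either side of `x₀`, the vertices at the crossing push the two edges apart in
the direction in which the ideal sides already separate, so only points over `x₀` remain, and these
are vertices. -/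
theorem fall_rise (H : ArcSystem n N M) (hε : 0 < ε) (hεm : ε < m / 4)
    {a b : ColoredArc} (hne : a ≠ b) {t t' s s' : ℝ} {q p q' p' P : ℝ × ℝ}
    (S : IsArcStep m ε M a t q t' p) (S' : IsArcStep m ε M b s q' s' p')
    (hP : P ∈ arcPiece m a t t' q p) (hP' : P ∈ arcPiece m b s s' q' p')
    (F : FallPt m ε M a t t' P) (R : RisePt m ε M b s s' P) : P ∈ webVertices N m ε M := by
  have hm : 0 < m := by linarith
  have ha := S.mem
  have hb := S'.mem
  obtain ⟨e, g1, g2, g3, g4, g5, -⟩ := F.deviation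
  obtain ⟨f, k1, k2, k3, k4, k5, -⟩ := R.deviation
  have hr := S.range H hP
  have hr' := S'.range H hP'
  have hF := F.mid_le
  have hR := R.le_mid
  unfold ColoredArc.mid at hF hR
  have hkey : 2 * m * (P.1 - ((b.start : ℝ) + a.finish) / 2) = e - f := by
    have := g1.symm.trans k1; linarith
  have hclose1 : P.1 - ((b.start : ℝ) + a.finish) / 2 < 1 / 2 := by
    by_contra h
    have : 0 ≤ m * (P.1 - ((b.start : ℝ) + a.finish) / 2 - 1 / 2) :=
      mul_nonneg hm.le (by linarith)
    nlinarith
  have hclose2 : -(1 / 2) < P.1 - ((b.start : ℝ) + a.finish) / 2 := by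
    by_contra h
    have : 0 ≤ m * (-(1 / 2) - (P.1 - ((b.start : ℝ) + a.finish) / 2)) :=
      mul_nonneg hm.le (by linarith)
    nlinarith
  rcases le_or_gt a.finish b.start with h1 | h1
  · have h2 : (a.finish : ℝ) ≤ b.start := by exact_mod_cast h1
    exact S.end_mem_vertices H (S.eq_end hP (u := foot ε M a.finish) (v := foot ε M a.finish)
      (by rw [show P.1 = a.finish by linarith [hr.2, hr'.1]]; exact ArcNode.last))
  -- `P` is not to the left of the apex of `a`. If `b` started at least `1` further left than `a`,
  -- then `hclose1` would put `P` to the left of it.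
  have h2 : a.start < b.start := by
    by_contra h
    rcases eq_or_lt_of_le (not_lt.1 h) with h | h
    · exact hne (H.start_inj a ha b hb h.symm)
    · have : (b.start : ℝ) + 1 ≤ a.start := by exact_mod_cast h
      linarith
  have h3 : a.finish < b.finish := by
    by_contra h
    rcases eq_or_lt_of_le (not_lt.1 h) with h | h
    · exact hne (H.finish_inj a ha b hb h.symm)
    · have : (b.finish : ℝ) + 1 ≤ a.finish := by exact_mod_cast h
      linarith
  have hab : a.Crosses b := ⟨h2, h1, h3⟩
  have r1 : (a.start : ℝ) < b.start := by exact_mod_cast h2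
  have r2 : (b.start : ℝ) < a.finish := by exact_mod_cast h1
  have r3 : (a.finish : ℝ) < b.finish := by exact_mod_cast h3
  have na : ArcNode m ε M a (((b.start : ℝ) + a.finish) / 2) _ _ := ArcNode.falling b hb hab
  have nb : ArcNode m ε M b (((b.start : ℝ) + a.finish) / 2) _ _ := ArcNode.rising a ha hab
  have ca := S.consecutive _ _ _ na
  have cb := S'.consecutive _ _ _ nb
  have ra := S.fst_mem hP
  have rb := S'.fst_mem hP'
  set x₀ := ((b.start : ℝ) + a.finish) / 2 with hx₀
  rcases lt_trichotomy P.1 x₀ with hx | hx | hx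
  · exfalso
    have u1 : t' ≤ x₀ := by by_contra h; exact ca ⟨by linarith, by linarith⟩
    have u2 : s' ≤ x₀ := by by_contra h; exact cb ⟨by linarith, by linarith⟩
    -- To the left of the crossing `a` heads for the upper vertex and `b` for the lower one. At
    -- distance `d`, this makes `e - f` at least `2 * ε - 8 * ε * d`, whereas `hkey` makes it `-2 *
    -- m * d`.
    have v1 := g5 (by linarith)
    have v2 := k4 (by unfold ColoredArc.mid; linarith)
    have w1 : ε * (t' - P.1) ≤ ε * (x₀ - P.1) := mul_le_mul_of_nonneg_left (by linarith) hε.le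
    have w2 : ε * (s' - P.1) ≤ ε * (x₀ - P.1) := mul_le_mul_of_nonneg_left (by linarith) hε.le
    have w3 : 0 < (m - 4 * ε) * (x₀ - P.1) := mul_pos (by linarith) (by linarith)
    nlinarith
  · exact S.end_mem_vertices H (S.eq_end hP (by rw [hx]; exact na))
  · exfalso
    have u1 : x₀ ≤ t := by by_contra h; exact ca ⟨by linarith, by linarith⟩
    have u2 : x₀ ≤ s := by by_contra h; exact cb ⟨by linarith, by linarith⟩
    have v1 := g4 (by unfold ColoredArc.mid; linarith)
    have v2 := k5 (by linarith)
    have w1 : ε * (P.1 - t) ≤ ε * (P.1 - x₀) := mul_le_mul_of_nonneg_left (by linarith) hε.le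
    have w2 : ε * (P.1 - s) ≤ ε * (P.1 - x₀) := mul_le_mul_of_nonneg_left (by linarith) hε.le
    have w3 : 0 < (m - 4 * ε) * (P.1 - x₀) := mul_pos (by linarith) (by linarith)
    nlinarith

theorem ArcNode.unique (H : ArcSystem n N M) {a : ColoredArc} (ha : a ∈ M) {t : ℝ}
    {p q p' q' : ℝ × ℝ} (h : ArcNode m ε M a t p q) (h' : ArcNode m ε M a t p' q') :
    p = p' ∧ q = q' := by
  have hs := (H.arc a ha).2.1
  rcases h.cases' hs with ⟨h1, ⟨h2, h3, h4⟩ | ⟨h2, h3, h4⟩⟩ | ⟨h1, ⟨h2, h3, h4⟩ | ⟨h2, h3, h4⟩⟩ <;>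
  rcases h'.cases' hs with ⟨k1, ⟨k2, k3, k4⟩ | ⟨k2, k3, k4⟩⟩ | ⟨k1, ⟨k2, k3, k4⟩ | ⟨k2, k3, k4⟩⟩ <;>
  first
    | exact ⟨h3.trans k3.symm, h4.trans k4.symm⟩
    | (exfalso; linarith)

/-- Different steps of one arc cover abscissa intervals that overlap at most in a node. For
different arcs, two rising or two falling sides are parallel with offset at least `m > 2 * ε`, and
mixed sides are treated by `fall_rise`. -/
theorem arc_planar (H : ArcSystem n N M) (hε : 0 < ε) (hεm : ε < m / 4)
    {a b : ColoredArc} {t t' s s' : ℝ} {q p q' p' P : ℝ × ℝ}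
    (S : IsArcStep m ε M a t q t' p) (S' : IsArcStep m ε M b s q' s' p')
    (hne : stepEdge m a t q t' p ≠ stepEdge m b s q' s' p')
    (hP : P ∈ arcPiece m a t t' q p) (hP' : P ∈ arcPiece m b s s' q' p') :
    P ∈ webVertices N m ε M := by
  have hm : 0 < m := by linarith
  by_cases hab : a = b
  · subst hab
    have ra := S.fst_mem hP
    have rb := S'.fst_mem hP'
    have hs := S.lt
    have hs' := S'.lt
    obtain ⟨p₀, hq⟩ := S.left
    obtain ⟨q₀, hp⟩ := S.right
    obtain ⟨p₁, hq'⟩ := S'.left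
    obtain ⟨q₁, hp'⟩ := S'.right
    rcases lt_trichotomy t s with h1 | h1 | h1
    · have h2 := S.consecutive _ _ _ hq'
      have h3 : t' ≤ s := by by_contra h; exact h2 ⟨h1, by linarith⟩
      exact S.end_mem_vertices H (Or.inr (S.eq_right hP (by linarith)))
    · subst h1
      exfalso
      have h2 : t' = s' := by
        rcases lt_trichotomy t' s' with h2 | h2 | h2
        · exact absurd ⟨hs, h2⟩ (S'.consecutive _ _ _ hp)
        · exact h2
        · exact absurd ⟨hs', h2⟩ (S.consecutive _ _ _ hp')
      subst h2
      have h3 := (hq.unique H S.mem hq').2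
      have h4 := (hp.unique H S.mem hp').1
      subst h3; subst h4
      exact hne rfl
    · have h2 := S'.consecutive _ _ _ hq
      have h3 : s' ≤ t := by by_contra h; exact h2 ⟨h1, by linarith⟩
      exact S.end_mem_vertices H (Or.inl (S.eq_left hP (by linarith)))
  · rcases S.point H hε hP with R | R <;> rcases S'.point H hε hP' with R' | R'
    · exfalso
      obtain ⟨e, g1, g2, g3, -⟩ := R.deviation
      obtain ⟨f, k1, k2, k3, -⟩ := R'.deviation
      refine hab (H.start_inj a S.mem b S'.mem (int_eq_of_mul_lt hm (δ := e - f) ?_ ?_ ?_))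
      · have := g1.symm.trans k1; linarith
      · linarith
      · linarith
    · exact fall_rise H hε hεm (Ne.symm hab) S' S hP' hP R' R
    · exact fall_rise H hε hεm hab S S' hP hP' R R'
    · exfalso
      obtain ⟨e, g1, g2, g3, -⟩ := R.deviation
      obtain ⟨f, k1, k2, k3, -⟩ := R'.deviation
      refine hab (H.finish_inj a S.mem b S'.mem (int_eq_of_mul_lt hm (δ := f - e) ?_ ?_ ?_))
      · have := g1.symm.trans k1; linarith
      · linarith
      · linarith

theorem vertical_segment {x y₀ y₁ : ℝ} {P : ℝ × ℝ} (h : y₀ ≤ y₁)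
    (hP : P ∈ segment ℝ (x, y₀) (x, y₁)) : P.1 = x ∧ y₀ ≤ P.2 ∧ P.2 ≤ y₁ := by
  obtain ⟨u, v, hu, hv, huv, rfl⟩ := hP
  have : u = 1 - v := by linarith
  subst this
  simp only [Prod.fst_add, Prod.smul_fst, smul_eq_mul, Prod.snd_add, Prod.smul_snd]
  refine ⟨by ring, ?_, ?_⟩ <;> nlinarith

/-- The points of the vertical edge at a crossing. -/
theorem dumbbell_point (hε : 0 < ε) {a b : ColoredArc} {P : ℝ × ℝ}
    (hP : P ∈ segment ℝ (crossingPoint m (-ε) a b) (crossingPoint m ε a b)) :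
    P.1 = ((b.start : ℝ) + a.finish) / 2 ∧ m * ((a.finish : ℝ) - b.start) / 2 - ε ≤ P.2 ∧
      P.2 ≤ m * ((a.finish : ℝ) - b.start) / 2 + ε := by
  have := vertical_segment (by linarith) hP
  exact ⟨this.1, by linarith [this.2.1], this.2.2⟩

theorem crossing_high (hε : 0 < ε) (hεm : ε < m / 4) {a b : ColoredArc} (h : a.Crosses b) :
    ε < m * ((a.finish : ℝ) - b.start) / 2 - ε := by
  have h1 : (b.start : ℝ) + 1 ≤ a.finish := by exact_mod_cast h.2.1
  have : 0 ≤ m * ((a.finish : ℝ) - b.start - 1) := mul_nonneg (by linarith) (by linarith)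
  linarith

/-- Vertical edges of different crossings are far from each other. -/
theorem crossing_unique (H : ArcSystem n N M) (hε : 0 < ε) (hεm : ε < m / 4) {a b c d : ColoredArc}
    (ha : a ∈ M) (hb : b ∈ M) (hc : c ∈ M) (hd : d ∈ M)
    (h1 : ((b.start : ℝ) + a.finish) / 2 = ((d.start : ℝ) + c.finish) / 2)
    (h2 : m * ((a.finish : ℝ) - b.start) / 2 - ε ≤ m * ((c.finish : ℝ) - d.start) / 2 + ε)
    (h3 : m * ((c.finish : ℝ) - d.start) / 2 - ε ≤ m * ((a.finish : ℝ) - b.start) / 2 + ε) :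
    a = c ∧ b = d := by
  have hm : 0 < m := by linarith
  have h4 : a.finish = c.finish := by
    refine int_eq_of_mul_lt hm (δ := m * ((a.finish : ℝ) - b.start) / 2 -
      m * ((c.finish : ℝ) - d.start) / 2) ?_ (by linarith) (by linarith)
    have : (b.start : ℝ) = d.start + c.finish - a.finish := by linarith
    rw [this]; ring
  have h5 : b.start = d.start := by
    have h6 : (a.finish : ℝ) = c.finish := by exact_mod_cast h4
    have : (b.start : ℝ) = d.start := by linarith
    exact_mod_cast this
  exact ⟨H.finish_inj a ha c hc h4, H.start_inj b hb d hd h5⟩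

theorem verticalEdge_curve (bot top : ℝ × ℝ) (x y : ℤ) :
    (verticalEdge bot top x y).curve = segment ℝ bot top := by
  unfold verticalEdge; split_ifs <;> rfl

theorem verticalEdge_ends (bot top : ℝ × ℝ) (x y : ℤ) :
    ((verticalEdge bot top x y).src = bot ∧ (verticalEdge bot top x y).tgt = top) ∨
      ((verticalEdge bot top x y).src = top ∧ (verticalEdge bot top x y).tgt = bot) := by
  unfold verticalEdge; split_ifs <;> simp

/-- The curves of two different edges meet in vertices only. -/
theorem preWeb_planar (H : ArcSystem n N M) (hε : 0 < ε) (hεm : ε < m / 4) {e f : WebEdge}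
    (he : e ∈ (preWeb N m ε M).edges) (hf : f ∈ (preWeb N m ε M).edges) (hne : e ≠ f) {P : ℝ × ℝ}
    (hP : P ∈ e.curve) (hP' : P ∈ f.curve) : P ∈ webVertices N m ε M := by
  have arc_y : ∀ e ∈ arcEdges m ε M, ∀ f ∈ yEdges ε M, P ∈ e.curve → P ∈ f.curve →
      P ∈ webVertices N m ε M := by
    intro e he f hf hP hP'
    obtain ⟨a, t, q, t', p, S, rfl⟩ := mem_arcEdges.1 he
    obtain ⟨c, hc, d, hd, hcd, rfl⟩ := hf
    rw [verticalEdge_curve] at hP'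
    have h1 := vertical_segment hε.le hP'
    exact S.end_mem_vertices H (S.low_point H hε hεm hP h1.1 h1.2.2)
  have arc_d : ∀ e ∈ arcEdges m ε M, ∀ f ∈ dumbbellEdges m ε M, P ∈ e.curve → P ∈ f.curve →
      P ∈ webVertices N m ε M := by
    intro e he f hf hP hP'
    obtain ⟨a, t, q, t', p, S, rfl⟩ := mem_arcEdges.1 he
    obtain ⟨c, hc, d, hd, hcd, rfl⟩ := hf
    rw [verticalEdge_curve] at hP'
    have h1 := dumbbell_point hε hP'
    exact S.end_mem_vertices H (S.near_crossing H hε hεm hP hc hd hcd h1.1 h1.2.1 h1.2.2)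
  have y_d : ∀ e ∈ yEdges ε M, ∀ f ∈ dumbbellEdges m ε M, P ∈ e.curve → P ∈ f.curve → False := by
    intro e he f hf hP hP'
    obtain ⟨a, ha, b, hb, hab, rfl⟩ := he
    obtain ⟨c, hc, d, hd, hcd, rfl⟩ := hf
    rw [verticalEdge_curve] at hP hP'
    have h1 := dumbbell_point hε hP'
    have h2 := vertical_segment hε.le hP
    have h3 := crossing_high hε hεm hcd
    linarith [h1.2.1, h2.2.2]
  rcases he with (he | he) | he <;> rcases hf with (hf | hf) | hf
  · obtain ⟨a, t, q, t', p, S, rfl⟩ := mem_arcEdges.1 he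
    obtain ⟨b, s, q', s', p', S', rfl⟩ := mem_arcEdges.1 hf
    exact arc_planar H hε hεm S S' hne hP hP'
  · exact arc_y e he f hf hP hP'
  · exact arc_d e he f hf hP hP'
  · exact arc_y f hf e he hP' hP
  · exfalso
    obtain ⟨a, ha, b, hb, hab, rfl⟩ := he
    obtain ⟨c, hc, d, hd, hcd, rfl⟩ := hf
    rw [verticalEdge_curve] at hP hP'
    have h1 := (vertical_segment hε.le hP).1.symm.trans (vertical_segment hε.le hP').1
    have h2 : b.start = d.start := by exact_mod_cast h1
    have h3 := H.start_inj b hb d hd h2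
    have h4 := H.finish_inj a ha c hc (by rw [hab, hcd, h2])
    subst h3; subst h4
    exact hne rfl
  · exact (y_d e he f hf hP hP').elim
  · exact arc_d f hf e he hP' hP
  · exact (y_d f hf e he hP' hP).elim
  · exfalso
    obtain ⟨a, ha, b, hb, hab, rfl⟩ := he
    obtain ⟨c, hc, d, hd, hcd, rfl⟩ := hf
    rw [verticalEdge_curve] at hP hP'
    have h1 := dumbbell_point hε hP
    have h2 := dumbbell_point hε hP'
    obtain ⟨rfl, rfl⟩ := crossing_unique H hε hεm ha hb hc hd (h1.1.symm.trans h2.1)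
      (h1.2.1.trans h2.2.2) (h2.2.1.trans h1.2.2)
    exact hne rfl

theorem IsArcStep.vertex_eq_end (H : ArcSystem n N M) (hε : 0 < ε) (hεm : ε < m / 4)
    {a : ColoredArc} {t t' : ℝ} {q p P : ℝ × ℝ} (S : IsArcStep m ε M a t q t' p)
    (hP : P ∈ arcPiece m a t t' q p) (hv : P ∈ webVertices N m ε M) : P = q ∨ P = p := by
  rcases hv with ⟨i, -, -, rfl⟩ | ⟨i, -, rfl⟩ | ⟨c, hc, d, hd, hcd, h⟩
  · exact S.low_point H hε hεm hP (i := i) rfl hε.le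
  · exact S.low_point H hε hεm hP (i := i) rfl le_rfl
  · refine S.near_crossing H hε hεm hP hc hd hcd ?_ ?_ ?_ <;>
    · rcases h with rfl | rfl <;> simp only [crossingPoint] <;> linarith

theorem preWeb_avoids (H : ArcSystem n N M) (hε : 0 < ε) (hεm : ε < m / 4) {e : WebEdge}
    (he : e ∈ (preWeb N m ε M).edges) {P : ℝ × ℝ} (hP : P ∈ e.curve)
    (hv : P ∈ webVertices N m ε M) : P = e.src ∨ P = e.tgt := by
  rcases he with (he | he) | he
  · obtain ⟨a, t, q, t', p, S, rfl⟩ := mem_arcEdges.1 he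
    exact S.vertex_eq_end H hε hεm hP hv
  · obtain ⟨a, ha, b, hb, hab, rfl⟩ := he
    rw [verticalEdge_curve] at hP
    have h1 := vertical_segment hε.le hP
    have key : P = ((b.start : ℝ), 0) ∨ P = ((b.start : ℝ), ε) := by
      rcases hv with ⟨i, -, -, rfl⟩ | ⟨i, -, rfl⟩ | ⟨c, hc, d, hd, hcd, h⟩
      · exact Or.inl (Prod.ext h1.1 rfl)
      · exact Or.inr (Prod.ext h1.1 rfl)
      · exfalso
        have h3 := crossing_high hε hεm hcd
        have h4 := h1.2.2
        rcases h with rfl | rfl <;> simp only [crossingPoint] at h4 <;> linarith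
    rcases verticalEdge_ends ((b.start : ℝ), (0 : ℝ)) ((b.start : ℝ), ε) b.color a.color
      with h | h <;> rw [h.1, h.2]
    · exact key
    · exact key.symm
  · obtain ⟨a, ha, b, hb, hab, rfl⟩ := he
    rw [verticalEdge_curve] at hP
    have h1 := dumbbell_point hε hP
    have h3 := crossing_high hε hεm hab
    have key : P = crossingPoint m (-ε) a b ∨ P = crossingPoint m ε a b := by
      rcases hv with ⟨i, -, -, rfl⟩ | ⟨i, -, rfl⟩ | ⟨c, hc, d, hd, hcd, h⟩
      · exfalso; have := h1.2.1; simp only at this; linarith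
      · exfalso; have := h1.2.1; simp only at this; linarith
      · have h4 := h1.1
        have h5 := h1.2.1
        have h6 := h1.2.2
        obtain ⟨rfl, rfl⟩ : a = c ∧ b = d := by
          rcases h with rfl | rfl <;> simp only [crossingPoint] at h4 h5 h6
          · exact crossing_unique H hε hεm ha hb hc hd h4.symm (by linarith) (by linarith)
          · exact crossing_unique H hε hεm ha hb hc hd h4.symm (by linarith) (by linarith)
        exact h.symm
    rcases verticalEdge_ends (crossingPoint m (-ε) a b) (crossingPoint m ε a b) b.color a.color
      with h | h <;> rw [h.1, h.2]
    · exact key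
    · exact key.symm

theorem interior_height (hε : 0 < ε) (hεm : ε < m / 4) {P : ℝ × ℝ}
    (hP : P ∈ (preWeb N m ε M).interior) : 0 < P.2 := by
  rcases hP with ⟨i, -, rfl⟩ | ⟨c, hc, d, hd, hcd, h⟩
  · exact hε
  · have h3 := crossing_high hε hεm hcd
    rcases h with rfl | rfl <;> simp only [crossingPoint] <;> linarith

/-- Away from the feet, a side of slope `m` beats a deviation that falls with slope at most `4 * ε`
from a nonnegative value at the foot. -/
theorem preWeb_upper (H : ArcSystem n N M) (hε : 0 < ε) (hεm : ε < m / 4) {e : WebEdge}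
    (he : e ∈ (preWeb N m ε M).edges) {P : ℝ × ℝ} (hP : P ∈ e.curve) :
    P ∈ (preWeb N m ε M).boundary ∨ 0 < P.2 := by
  have hV : ∀ Q ∈ webVertices N m ε M, Q ∈ (preWeb N m ε M).boundary ∨ 0 < Q.2 := by
    rintro Q (h | h)
    · exact Or.inl h
    · exact Or.inr (interior_height hε hεm h)
  rcases he with (he | he) | he
  · obtain ⟨a, t, q, t', p, S, rfl⟩ := mem_arcEdges.1 he
    change P ∈ arcPiece m a t t' q p at hP
    have hr := S.range H hP
    rcases eq_or_lt_of_le hr.1 with h1 | h1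
    · exact hV _ (S.end_mem_vertices H (S.eq_end hP (by rw [← h1]; exact ArcNode.first)))
    rcases eq_or_lt_of_le hr.2 with h2 | h2
    · exact hV _ (S.end_mem_vertices H (S.eq_end hP (by rw [h2]; exact ArcNode.last)))
    right
    rcases S.point H hε hP with R | R
    · obtain ⟨e, g1, g2, g3, -, -, g4⟩ := R.deviation
      have h3 := (foot_snd_bounds hε M a.start).1
      have : 0 < (m - 4 * ε) * (P.1 - a.start) := mul_pos (by linarith) (by linarith)
      nlinarith
    · obtain ⟨e, g1, g2, g3, -, -, g4⟩ := R.deviation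
      have h3 := (foot_snd_bounds hε M a.finish).1
      have : 0 < (m - 4 * ε) * (a.finish - P.1) := mul_pos (by linarith) (by linarith)
      nlinarith
  · obtain ⟨a, ha, b, hb, hab, rfl⟩ := he
    rw [verticalEdge_curve] at hP
    have h1 := vertical_segment hε.le hP
    rcases eq_or_lt_of_le h1.2.1 with h2 | h2
    · left
      have := H.arc b hb
      exact ⟨b.start, this.1, by omega, Prod.ext h1.1 h2.symm⟩
    · exact Or.inr h2
  · obtain ⟨a, ha, b, hb, hab, rfl⟩ := he
    rw [verticalEdge_curve] at hP
    have h1 := dumbbell_point hε hP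
    have h3 := crossing_high hε hεm hab
    right; linarith [h1.2.1]

end Planarity

/-! ## The web of an arc system is a web -/

theorem isSimpleCurve_segment {A B : ℝ × ℝ} (h : A ≠ B) (x : ℤ) :
    (⟨A, B, segment ℝ A B, x⟩ : WebEdge).IsSimpleCurve := by
  have hinj := AffineMap.lineMap_injective ℝ h
  exact ⟨AffineMap.lineMap A B, AffineMap.lineMap_continuous.continuousOn,
    AffineMap.lineMap_apply_zero _ _, AffineMap.lineMap_apply_one _ _,
    (segment_eq_image_lineMap ℝ A B).symm, hinj.injOn, hinj.injOn⟩

/-- The abscissa increases strictly along the curve, which makes the piecewise affine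
parametrization injective. -/
theorem isSimpleCurve_bent {A C B : ℝ × ℝ} (hAC : A.1 < C.1) (hCB : C.1 < B.1) (x : ℤ) :
    (⟨A, B, segment ℝ A C ∪ segment ℝ C B, x⟩ : WebEdge).IsSimpleCurve := by
  let γ : ℝ → ℝ × ℝ := fun t =>
    if t ≤ 1 / 2 then AffineMap.lineMap A C (2 * t) else AffineMap.lineMap C B (2 * t - 1)
  have h1 : ∀ t ≤ 1 / 2, γ t = AffineMap.lineMap A C (2 * t) := fun t ht => if_pos ht
  have h2 : ∀ t, 1 / 2 < t → γ t = AffineMap.lineMap C B (2 * t - 1) :=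
    fun t ht => if_neg (not_le.2 ht)
  have h2' : ∀ t, 1 / 2 ≤ t → γ t = AffineMap.lineMap C B (2 * t - 1) := by
    intro t ht
    rcases eq_or_lt_of_le ht with h | h
    · rw [← h, h1 _ le_rfl]; norm_num
    · exact h2 t h
  have hfst : ∀ (P Q : ℝ × ℝ) (s : ℝ), (AffineMap.lineMap P Q s).1 = P.1 + s * (Q.1 - P.1) := by
    intro P Q s
    simp [AffineMap.lineMap_apply]; ring
  have hmono : StrictMono fun t => (γ t).1 := by
    intro s t hst
    simp only
    rcases le_or_gt t (1 / 2) with ht | ht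
    · rw [h1 t ht, h1 s (by linarith), hfst, hfst]
      have := mul_pos (sub_pos.2 hst) (sub_pos.2 hAC)
      nlinarith
    · rcases le_or_gt s (1 / 2) with hs | hs
      · rw [h1 s hs, h2 t ht, hfst, hfst]
        have := mul_pos (sub_pos.2 ht) (sub_pos.2 hCB)
        have := mul_nonneg (sub_nonneg.2 hs) (sub_pos.2 hAC).le
        nlinarith
      · rw [h2 s hs, h2 t ht, hfst, hfst]
        have := mul_pos (sub_pos.2 hst) (sub_pos.2 hCB)
        nlinarith
  have hinj : Function.Injective γ := fun s t h => hmono.injective (congrArg Prod.fst h)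
  have hcont : Continuous γ := by
    refine Continuous.if_le ?_ ?_ continuous_id continuous_const ?_
    · exact AffineMap.lineMap_continuous.comp (by fun_prop)
    · exact AffineMap.lineMap_continuous.comp (by fun_prop)
    · intro t ht
      have ht' : t = 1 / 2 := ht
      rw [ht']; norm_num
  refine ⟨γ, hcont.continuousOn, ?_, ?_, ?_, hinj.injOn, hinj.injOn⟩
  · rw [h1 0 (by norm_num)]; simp
  · rw [h2 1 (by norm_num)]; norm_num
  · ext P
    simp only [segment_eq_image_lineMap, Set.mem_union, Set.mem_image]
    constructor
    · rintro ⟨t, ht, rfl⟩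
      rcases le_or_gt t (1 / 2) with h | h
      · exact Or.inl ⟨2 * t, ⟨by linarith [ht.1], by linarith⟩, (h1 t h).symm⟩
      · exact Or.inr ⟨2 * t - 1, ⟨by linarith, by linarith [ht.2]⟩, (h2 t h).symm⟩
    · rintro (⟨t, ht, rfl⟩ | ⟨t, ht, rfl⟩)
      · refine ⟨t / 2, ⟨by linarith [ht.1], by linarith [ht.2]⟩, ?_⟩
        rw [h1 _ (by linarith [ht.2])]
        congr 1; ring
      · refine ⟨(t + 1) / 2, ⟨by linarith [ht.1], by linarith [ht.2]⟩, ?_⟩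
        rw [h2' _ (by linarith [ht.1])]
        congr 1; ring

section Web

variable {n N : ℕ} {M : Set ColoredArc} {m ε : ℝ}

theorem IsArcStep.fst (H : ArcSystem n N M) {a : ColoredArc} {t t' : ℝ} {q p : ℝ × ℝ}
    (S : IsArcStep m ε M a t q t' p) :
    q.1 = t ∧ p.1 = t' ∧ (a.start : ℝ) ≤ t ∧ t' ≤ a.finish := by
  obtain ⟨p₀, hq⟩ := S.left
  obtain ⟨q₀, hp⟩ := S.right
  have hs := (H.arc a S.mem).2.1
  exact ⟨hq.fst.2, hp.fst.1, (hq.mem_Icc hs).1, (hp.mem_Icc hs).2⟩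

theorem IsArcStep.isSimpleCurve (H : ArcSystem n N M) {a : ColoredArc} {t t' : ℝ} {q p : ℝ × ℝ}
    (S : IsArcStep m ε M a t q t' p) : (stepEdge m a t q t' p).IsSimpleCurve := by
  obtain ⟨h1, h2, -, -⟩ := S.fst H
  have hlt := S.lt
  unfold stepEdge arcPiece
  split_ifs with h
  · exact isSimpleCurve_bent (by rw [h1]; exact h.1) (by rw [h2]; exact h.2) _
  · refine isSimpleCurve_segment (fun e => ?_) _
    rw [e] at h1; linarith

theorem verticalEdge_isSimpleCurve {bot top : ℝ × ℝ} (h : bot ≠ top) (x y : ℤ) :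
    (verticalEdge bot top x y).IsSimpleCurve := by
  unfold verticalEdge
  split_ifs
  · exact isSimpleCurve_segment h _
  · rw [segment_symm]; exact isSimpleCurve_segment h.symm _

theorem nodes_finite (H : ArcSystem n N M) (a : ColoredArc) :
    {s | ∃ u v, ArcNode m ε M a s u v}.Finite := by
  have h1 : ({(a.start : ℝ), (a.finish : ℝ)} ∪
      ((fun b : ColoredArc => ((a.start : ℝ) + b.finish) / 2) '' M ∪
        (fun b : ColoredArc => ((b.start : ℝ) + a.finish) / 2) '' M)).Finite :=
    (Set.toFinite _).union ((H.finite.image _).union (H.finite.image _))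
  refine h1.subset ?_
  rintro s ⟨u, v, h⟩
  cases h with
  | first => exact Or.inl (Or.inl rfl)
  | rising b hb h => exact Or.inr (Or.inl ⟨b, hb, rfl⟩)
  | falling b hb h => exact Or.inr (Or.inr ⟨b, hb, rfl⟩)
  | last => exact Or.inl (Or.inr rfl)

theorem ArcNode.exists_next (H : ArcSystem n N M) {a : ColoredArc} (ha : a ∈ M) {t : ℝ}
    {p₀ q : ℝ × ℝ} (h : ArcNode m ε M a t p₀ q) (ht : t < a.finish) :
    ∃ t' p, IsArcStep m ε M a t q t' p := by
  have hfin : ({s | ∃ u v, ArcNode m ε M a s u v} ∩ Set.Ioi t).Finite :=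
    (nodes_finite H a).inter_of_left _
  obtain ⟨s, ⟨⟨u, v, hs⟩, hts⟩, hmin⟩ := Set.exists_min_image _ id hfin
    ⟨(a.finish : ℝ), ⟨_, _, ArcNode.last⟩, ht⟩
  refine ⟨s, u, ha, ⟨p₀, h⟩, ⟨v, hs⟩, hts, ?_⟩
  rintro s' u' v' hs' ⟨h1, h2⟩
  have := hmin s' ⟨⟨u', v', hs'⟩, h1⟩
  simp only [id] at this
  linarith

theorem ArcNode.exists_prev (H : ArcSystem n N M) {a : ColoredArc} (ha : a ∈ M) {t' : ℝ}
    {p q₀ : ℝ × ℝ} (h : ArcNode m ε M a t' p q₀) (ht : a.start < t') :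
    ∃ t q, IsArcStep m ε M a t q t' p := by
  have hfin : ({s | ∃ u v, ArcNode m ε M a s u v} ∩ Set.Iio t').Finite :=
    (nodes_finite H a).inter_of_left _
  obtain ⟨s, ⟨⟨u, v, hs⟩, hts⟩, hmax⟩ := Set.exists_max_image _ id hfin
    ⟨(a.start : ℝ), ⟨_, _, ArcNode.first⟩, ht⟩
  refine ⟨s, v, ha, ⟨u, hs⟩, ⟨q₀, h⟩, hts, ?_⟩
  rintro s' u' v' hs' ⟨h1, h2⟩
  have := hmax s' ⟨⟨u', v', hs'⟩, h2⟩
  simp only [id] at this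
  linarith

theorem IsArcStep.eq_of_left (H : ArcSystem n N M) {a : ColoredArc} {t t' s' : ℝ}
    {q p q' p' : ℝ × ℝ} (S : IsArcStep m ε M a t q t' p) (S' : IsArcStep m ε M a t q' s' p') :
    stepEdge m a t q t' p = stepEdge m a t q' s' p' := by
  obtain ⟨p₀, hq⟩ := S.left
  obtain ⟨q₀, hp⟩ := S.right
  obtain ⟨p₁, hq'⟩ := S'.left
  obtain ⟨q₁, hp'⟩ := S'.right
  have h2 : t' = s' := by
    rcases lt_trichotomy t' s' with h2 | h2 | h2
    · exact absurd ⟨S.lt, h2⟩ (S'.consecutive _ _ _ hp)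
    · exact h2
    · exact absurd ⟨S'.lt, h2⟩ (S.consecutive _ _ _ hp')
  subst h2
  rw [(hq.unique H S.mem hq').2, (hp.unique H S.mem hp').1]

theorem IsArcStep.eq_of_right (H : ArcSystem n N M) {a : ColoredArc} {t t' s : ℝ}
    {q p q' p' : ℝ × ℝ} (S : IsArcStep m ε M a t q t' p) (S' : IsArcStep m ε M a s q' t' p') :
    stepEdge m a t q t' p = stepEdge m a s q' t' p' := by
  obtain ⟨p₀, hq⟩ := S.left
  obtain ⟨p₁, hq'⟩ := S'.left
  have h2 : t = s := by
    rcases lt_trichotomy t s with h2 | h2 | h2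
    · exact absurd ⟨h2, S'.lt⟩ (S.consecutive _ _ _ hq')
    · exact h2
    · exact absurd ⟨h2, S.lt⟩ (S'.consecutive _ _ _ hq)
  subst h2
  exact S.eq_of_left H S'

theorem arcEdges_finite (H : ArcSystem n N M) : (arcEdges m ε M).Finite := by
  have h1 : (⋃ a ∈ M, ⋃ t ∈ {s | ∃ u v, ArcNode m ε M a s u v},
      {e | ∃ q t' p, IsArcStep m ε M a t q t' p ∧ e = stepEdge m a t q t' p}).Finite := by
    refine H.finite.biUnion fun a _ => (nodes_finite H a).biUnion fun t _ => ?_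
    refine Set.Subsingleton.finite ?_
    rintro _ ⟨q, t', p, S, rfl⟩ _ ⟨q', s', p', S', rfl⟩
    exact S.eq_of_left H S'
  refine h1.subset fun e he => ?_
  obtain ⟨a, t, q, t', p, S, rfl⟩ := mem_arcEdges.1 he
  obtain ⟨p₀, hq⟩ := S.left
  simp only [Set.mem_iUnion]
  exact ⟨a, S.mem, t, ⟨p₀, q, hq⟩, q, t', p, S, rfl⟩

/-- The left ends of the edges of an arc. -/
theorem IsArcStep.left_cases (H : ArcSystem n N M) {a : ColoredArc} {t t' : ℝ}
    {q p : ℝ × ℝ} (S : IsArcStep m ε M a t q t' p) :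
    q = foot ε M a.start ∨ (q = (t, m * (t - a.start) + ε) ∧ (a.start : ℝ) + 1 / 2 ≤ t) ∨
      (q = (t, m * (a.finish - t) - ε) ∧ t + 1 / 2 ≤ a.finish) := by
  obtain ⟨p₀, hq⟩ := S.left
  have hs := (H.arc a S.mem).2.1
  have h1 := S.lt.trans_le (S.fst H).2.2.2
  rcases hq.cases' hs with ⟨-, ⟨-, -, h⟩ | ⟨h2, -, h⟩⟩ | ⟨-, ⟨h2, -, -⟩ | ⟨h2, -, h⟩⟩
  · exact Or.inl h
  · exact Or.inr (Or.inl ⟨h, half_int_gap (start_half_int _) hq.half_int h2⟩)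
  · linarith
  · exact Or.inr (Or.inr ⟨h, half_int_gap hq.half_int (start_half_int _) h2⟩)

/-- The right ends of the edges of an arc. -/
theorem IsArcStep.right_cases (H : ArcSystem n N M) {a : ColoredArc} {t t' : ℝ}
    {q p : ℝ × ℝ} (S : IsArcStep m ε M a t q t' p) :
    p = foot ε M a.finish ∨ (p = (t', m * (t' - a.start) - ε) ∧ (a.start : ℝ) + 1 / 2 ≤ t') ∨
      (p = (t', m * (a.finish - t') + ε) ∧ t' + 1 / 2 ≤ a.finish) := by
  obtain ⟨q₀, hp⟩ := S.right
  have hs := (H.arc a S.mem).2.1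
  have h1 := (S.fst H).2.2.1.trans_lt S.lt
  rcases hp.cases' hs with ⟨-, ⟨h2, -, -⟩ | ⟨h2, h, -⟩⟩ | ⟨-, ⟨-, h, -⟩ | ⟨h2, h, -⟩⟩
  · linarith
  · exact Or.inr (Or.inl ⟨h, half_int_gap (start_half_int _) hp.half_int h2⟩)
  · exact Or.inl h
  · exact Or.inr (Or.inr ⟨h, half_int_gap hp.half_int (start_half_int _) h2⟩)

theorem mul_half_le {x : ℝ} (hm : 0 < m) (h : 1 / 2 ≤ x) : m / 2 ≤ m * x := by nlinarith

/-- Feet have height at most `ε`, the other left ends at least `m / 2 - ε > ε`. Among the latter, a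
rising and a falling one cannot coincide, and two of the same kind share a start or a finish, hence
the arc. -/
theorem IsArcStep.left_unique (H : ArcSystem n N M) (hε : 0 < ε) (hεm : ε < m / 4)
    {a b : ColoredArc} {t t' s s' : ℝ} {q p p' : ℝ × ℝ} (S : IsArcStep m ε M a t q t' p)
    (S' : IsArcStep m ε M b s q s' p') : stepEdge m a t q t' p = stepEdge m b s q s' p' := by
  have hm : 0 < m := by linarith
  have hts : s = t := (S'.fst H).1.symm.trans (S.fst H).1
  subst hts
  suffices hab : a = b by subst hab; exact S.eq_of_left H S'
  obtain ⟨p₀, hq⟩ := S.left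
  obtain ⟨z, hz⟩ := hq.half_int
  have fa := foot_snd_bounds hε M a.start
  have fb := foot_snd_bounds hε M b.start
  rcases S.left_cases H with h | ⟨h, g⟩ | ⟨h, g⟩ <;>
    rcases S'.left_cases H with k | ⟨k, l⟩ | ⟨k, l⟩
  · have := congrArg Prod.fst (h.symm.trans k)
    rw [foot_fst, foot_fst] at this
    exact H.start_inj _ S.mem _ S'.mem (by exact_mod_cast this)
  · have e := congrArg Prod.snd (h.symm.trans k)
    have := mul_half_le hm (show 1 / 2 ≤ s - b.start by linarith)
    simp only at e
    linarith
  · have e := congrArg Prod.snd (h.symm.trans k)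
    have := mul_half_le hm (show 1 / 2 ≤ b.finish - s by linarith)
    simp only at e
    linarith
  · have e := congrArg Prod.snd (h.symm.trans k)
    have := mul_half_le hm (show 1 / 2 ≤ s - a.start by linarith)
    simp only at e
    linarith
  · have e := congrArg Prod.snd (h.symm.trans k)
    simp only at e
    exact H.start_inj _ S.mem _ S'.mem
      (int_eq_of_mul_lt hm (δ := 0) (by linarith) (by linarith) (by linarith))
  · exfalso
    have e := congrArg Prod.snd (h.symm.trans k)
    simp only at e
    -- With `s = z / 2`, the equality of heights makes an integral multiple of `m` equal to `-2 *
    -- ε`, which is nonzero and too small.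
    have e' : m * ((z : ℝ) - ((a.start + b.finish : ℤ) : ℝ)) = - 2 * ε := by
      rw [hz] at e; push_cast; linarith
    have := int_eq_of_mul_lt hm e' (by linarith) (by linarith)
    rw [this] at e'
    linarith
  · have e := congrArg Prod.snd (h.symm.trans k)
    have := mul_half_le hm (show 1 / 2 ≤ a.finish - s by linarith)
    simp only at e
    linarith
  · exfalso
    have e := congrArg Prod.snd (h.symm.trans k)
    simp only at e
    have e' : m * ((z : ℝ) - ((b.start + a.finish : ℤ) : ℝ)) = - 2 * ε := by
      rw [hz] at e; push_cast; linarith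
    have := int_eq_of_mul_lt hm e' (by linarith) (by linarith)
    rw [this] at e'
    linarith
  · have e := congrArg Prod.snd (h.symm.trans k)
    simp only at e
    exact H.finish_inj _ S.mem _ S'.mem
      (int_eq_of_mul_lt hm (δ := 0) (by linarith) (by linarith) (by linarith))

theorem IsArcStep.right_unique (H : ArcSystem n N M) (hε : 0 < ε) (hεm : ε < m / 4)
    {a b : ColoredArc} {t t' s s' : ℝ} {q q' p : ℝ × ℝ} (S : IsArcStep m ε M a t q t' p)
    (S' : IsArcStep m ε M b s q' s' p) : stepEdge m a t q t' p = stepEdge m b s q' s' p := by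
  have hm : 0 < m := by linarith
  have hts : s' = t' := (S'.fst H).2.1.symm.trans (S.fst H).2.1
  subst hts
  suffices hab : a = b by subst hab; exact S.eq_of_right H S'
  obtain ⟨q₀, hp⟩ := S.right
  obtain ⟨z, hz⟩ := hp.half_int
  have fa := foot_snd_bounds hε M a.finish
  have fb := foot_snd_bounds hε M b.finish
  rcases S.right_cases H with h | ⟨h, g⟩ | ⟨h, g⟩ <;>
    rcases S'.right_cases H with k | ⟨k, l⟩ | ⟨k, l⟩
  · have := congrArg Prod.fst (h.symm.trans k)
    rw [foot_fst, foot_fst] at this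
    exact H.finish_inj _ S.mem _ S'.mem (by exact_mod_cast this)
  · have e := congrArg Prod.snd (h.symm.trans k)
    have := mul_half_le hm (show 1 / 2 ≤ s' - b.start by linarith)
    simp only at e
    linarith
  · have e := congrArg Prod.snd (h.symm.trans k)
    have := mul_half_le hm (show 1 / 2 ≤ b.finish - s' by linarith)
    simp only at e
    linarith
  · have e := congrArg Prod.snd (h.symm.trans k)
    have := mul_half_le hm (show 1 / 2 ≤ s' - a.start by linarith)
    simp only at e
    linarith
  · have e := congrArg Prod.snd (h.symm.trans k)
    simp only at e
    exact H.start_inj _ S.mem _ S'.mem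
      (int_eq_of_mul_lt hm (δ := 0) (by linarith) (by linarith) (by linarith))
  · exfalso
    have e := congrArg Prod.snd (h.symm.trans k)
    simp only at e
    have e' : m * ((z : ℝ) - ((a.start + b.finish : ℤ) : ℝ)) = 2 * ε := by
      rw [hz] at e; push_cast; linarith
    have := int_eq_of_mul_lt hm e' (by linarith) (by linarith)
    rw [this] at e'
    linarith
  · have e := congrArg Prod.snd (h.symm.trans k)
    have := mul_half_le hm (show 1 / 2 ≤ a.finish - s' by linarith)
    simp only at e
    linarith
  · exfalso
    have e := congrArg Prod.snd (h.symm.trans k)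
    simp only at e
    have e' : m * ((z : ℝ) - ((b.start + a.finish : ℤ) : ℝ)) = 2 * ε := by
      rw [hz] at e; push_cast; linarith
    have := int_eq_of_mul_lt hm e' (by linarith) (by linarith)
    rw [this] at e'
    linarith
  · have e := congrArg Prod.snd (h.symm.trans k)
    simp only at e
    exact H.finish_inj _ S.mem _ S'.mem
      (int_eq_of_mul_lt hm (δ := 0) (by linarith) (by linarith) (by linarith))

/-! ### Degrees and flow at the vertices -/

theorem arcEdges_src (H : ArcSystem n N M) (hε : 0 < ε) (hεm : ε < m / 4) {a : ColoredArc}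
    {t t' : ℝ} {q p : ℝ × ℝ} (S : IsArcStep m ε M a t q t' p) :
    {e | e ∈ arcEdges m ε M ∧ e.src = q} = {stepEdge m a t q t' p} := by
  ext e
  constructor
  · rintro ⟨he, h⟩
    obtain ⟨b, s, q', s', p', S', rfl⟩ := mem_arcEdges.1 he
    change q' = q at h
    subst h
    exact S'.left_unique H hε hεm S
  · rintro rfl
    exact ⟨mem_arcEdges.2 ⟨a, t, q, t', p, S, rfl⟩, rfl⟩

theorem arcEdges_tgt (H : ArcSystem n N M) (hε : 0 < ε) (hεm : ε < m / 4) {a : ColoredArc}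
    {t t' : ℝ} {q p : ℝ × ℝ} (S : IsArcStep m ε M a t q t' p) :
    {e | e ∈ arcEdges m ε M ∧ e.tgt = p} = {stepEdge m a t q t' p} := by
  ext e
  constructor
  · rintro ⟨he, h⟩
    obtain ⟨b, s, q', s', p', S', rfl⟩ := mem_arcEdges.1 he
    change p' = p at h
    subst h
    exact S'.right_unique H hε hεm S
  · rintro rfl
    exact ⟨mem_arcEdges.2 ⟨a, t, q, t', p, S, rfl⟩, rfl⟩

theorem arcEdges_fst_lt (H : ArcSystem n N M) {e : WebEdge} (he : e ∈ arcEdges m ε M) :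
    e.src.1 < e.tgt.1 := by
  obtain ⟨a, t, q, t', p, S, rfl⟩ := mem_arcEdges.1 he
  obtain ⟨h1, h2, -⟩ := S.fst H
  have := S.lt
  simp only [stepEdge]
  rw [h1, h2]
  exact this

/-- At an interior vertex one edge of an arc arrives, one leaves, and there is one vertical edge. -/
theorem star_of_triple {A B : Set WebEdge} {v : ℝ × ℝ} {e₁ e₂ g : WebEdge}
    (h1 : {e | e ∈ A ∧ e.src = v} = {e₁}) (h2 : {e | e ∈ A ∧ e.tgt = v} = {e₂}) (hg : g ∈ B)
    (hgA : g ∉ A) (huniq : ∀ e ∈ B, e.src = v ∨ e.tgt = v → e = g)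
    (hcase : (g.src = v ∧ g.tgt ≠ v ∧ e₂.weight = e₁.weight + g.weight) ∨
      (g.tgt = v ∧ g.src ≠ v ∧ e₂.weight + g.weight = e₁.weight)) :
    {e | e ∈ A ∪ B ∧ e.src = v}.ncard + {e | e ∈ A ∪ B ∧ e.tgt = v}.ncard = 3 ∧
      (∑ᶠ e ∈ {e | e ∈ A ∪ B ∧ e.tgt = v}, e.weight) -
        (∑ᶠ e ∈ {e | e ∈ A ∪ B ∧ e.src = v}, e.weight) = 0 := by
  have m1 : ∀ e, e ∈ A ∧ e.src = v ↔ e = e₁ := fun e => Set.ext_iff.1 h1 e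
  have m2 : ∀ e, e ∈ A ∧ e.tgt = v ↔ e = e₂ := fun e => Set.ext_iff.1 h2 e
  have n1 : e₁ ≠ g := fun h => hgA (h ▸ ((m1 e₁).2 rfl).1)
  have n2 : e₂ ≠ g := fun h => hgA (h ▸ ((m2 e₂).2 rfl).1)
  rcases hcase with ⟨k1, k2, k3⟩ | ⟨k1, k2, k3⟩
  · have s1 : {e | e ∈ A ∪ B ∧ e.src = v} = {e₁, g} := by
      ext e
      constructor
      · rintro ⟨h | h, h'⟩
        · exact Or.inl ((m1 e).1 ⟨h, h'⟩)
        · exact Or.inr (huniq e h (Or.inl h'))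
      · rintro (rfl | rfl)
        · exact ⟨Or.inl ((m1 _).2 rfl).1, ((m1 _).2 rfl).2⟩
        · exact ⟨Or.inr hg, k1⟩
    have s2 : {e | e ∈ A ∪ B ∧ e.tgt = v} = {e₂} := by
      ext e
      constructor
      · rintro ⟨h | h, h'⟩
        · exact (m2 e).1 ⟨h, h'⟩
        · exact absurd (huniq e h (Or.inr h') ▸ h') k2
      · rintro rfl
        exact ⟨Or.inl ((m2 _).2 rfl).1, ((m2 _).2 rfl).2⟩
    rw [s1, s2, Set.ncard_pair n1, Set.ncard_singleton, finsum_mem_pair n1, finsum_mem_singleton]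
    exact ⟨rfl, by rw [k3]; ring⟩
  · have s1 : {e | e ∈ A ∪ B ∧ e.src = v} = {e₁} := by
      ext e
      constructor
      · rintro ⟨h | h, h'⟩
        · exact (m1 e).1 ⟨h, h'⟩
        · exact absurd (huniq e h (Or.inl h') ▸ h') k2
      · rintro rfl
        exact ⟨Or.inl ((m1 _).2 rfl).1, ((m1 _).2 rfl).2⟩
    have s2 : {e | e ∈ A ∪ B ∧ e.tgt = v} = {e₂, g} := by
      ext e
      constructor
      · rintro ⟨h | h, h'⟩
        · exact Or.inl ((m2 e).1 ⟨h, h'⟩)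
        · exact Or.inr (huniq e h (Or.inr h'))
      · rintro (rfl | rfl)
        · exact ⟨Or.inl ((m2 _).2 rfl).1, ((m2 _).2 rfl).2⟩
        · exact ⟨Or.inr hg, k1⟩
    rw [s1, s2, Set.ncard_pair n2, Set.ncard_singleton, finsum_mem_pair n2, finsum_mem_singleton]
    exact ⟨rfl, by rw [k3]; ring⟩

/-- The vertical edge of a Y. -/
theorem yEdge_eq (H : ArcSystem n N M) {a b : ColoredArc} (ha : a ∈ M) (hb : b ∈ M)
    (h : a.finish = b.start) :
    verticalEdge ((b.start : ℝ), 0) ((b.start : ℝ), ε) b.color a.color =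
      ⟨((b.start : ℝ), 0), ((b.start : ℝ), ε),
        segment ℝ ((b.start : ℝ), (0 : ℝ)) ((b.start : ℝ), ε), 1⟩ := by
  have := H.color_succ a ha b hb h
  unfold verticalEdge
  rw [if_pos (by omega), this]
  simp

theorem verticalEdge_end {bot top v : ℝ × ℝ} {x y : ℤ}
    (h : (verticalEdge bot top x y).src = v ∨ (verticalEdge bot top x y).tgt = v) :
    v = bot ∨ v = top := by
  rcases verticalEdge_ends bot top x y with h' | h' <;> rw [h'.1, h'.2] at h
  · exact h.imp Eq.symm Eq.symm
  · exact (h.imp Eq.symm Eq.symm).symm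

theorem vertical_notMem_arcEdges (H : ArcSystem n N M) {bot top : ℝ × ℝ} {x y : ℤ}
    (h : bot.1 = top.1) : verticalEdge bot top x y ∉ arcEdges m ε M := by
  intro he
  have := arcEdges_fst_lt H he
  rcases verticalEdge_ends bot top x y with h' | h' <;> rw [h'.1, h'.2, h] at this <;>
    exact lt_irrefl _ this

/-- Degree and flow at the upper end of a Y. -/
theorem star_y (H : ArcSystem n N M) (hε : 0 < ε) (hεm : ε < m / 4) {i : ℤ} (hY : HasY M i)
    {E : Set WebEdge} (hE : E = arcEdges m ε M ∪ (yEdges ε M ∪ dumbbellEdges m ε M)) :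
    {e | e ∈ E ∧ e.src = ((i : ℝ), ε)}.ncard + {e | e ∈ E ∧ e.tgt = ((i : ℝ), ε)}.ncard = 3 ∧
      (∑ᶠ e ∈ {e | e ∈ E ∧ e.tgt = ((i : ℝ), ε)}, e.weight) -
        (∑ᶠ e ∈ {e | e ∈ E ∧ e.src = ((i : ℝ), ε)}, e.weight) = 0 := by
  subst hE
  obtain ⟨⟨a, ha, hai⟩, b, hb, hbi⟩ := id hY
  have hab : a.finish = b.start := hai.trans hbi.symm
  have hfoot := foot_of_hasY (ε := ε) hY
  have fa : foot ε M a.finish = ((i : ℝ), ε) := by rw [hai, hfoot]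
  have fb : foot ε M b.start = ((i : ℝ), ε) := by rw [hbi, hfoot]
  have n1 : ArcNode m ε M b b.start _ _ := ArcNode.first
  have n2 : ArcNode m ε M a a.finish _ _ := ArcNode.last
  obtain ⟨t', p, S⟩ := n1.exists_next H hb (by exact_mod_cast (H.arc b hb).2.1)
  obtain ⟨t, q, S'⟩ := n2.exists_prev H ha (by exact_mod_cast (H.arc a ha).2.1)
  rw [fb] at S
  rw [fa] at S'
  have hg : verticalEdge ((b.start : ℝ), 0) ((b.start : ℝ), ε) b.color a.color ∈ yEdges ε M :=
    ⟨a, ha, b, hb, hab, rfl⟩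
  refine star_of_triple (arcEdges_src H hε hεm S) (arcEdges_tgt H hε hεm S') (Or.inl hg)
    (vertical_notMem_arcEdges H rfl) ?_ (Or.inr ?_)
  · rintro e (⟨c, hc, d, hd, hcd, rfl⟩ | ⟨c, hc, d, hd, hcd, rfl⟩) h
    · rcases verticalEdge_end h with h | h
      · have := congrArg Prod.snd h
        simp only at this
        linarith
      · have := congrArg Prod.fst h
        simp only at this
        have h2 : i = d.start := by exact_mod_cast this
        obtain rfl := H.start_inj b hb d hd (hbi.trans h2)
        obtain rfl := H.finish_inj a ha c hc (hab.trans hcd.symm)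
        rfl
    · exfalso
      have h3 := crossing_high hε hεm hcd
      rcases verticalEdge_end h with h | h <;>
      · have := congrArg Prod.snd h
        simp only [crossingPoint] at this
        linarith
  · rw [yEdge_eq H ha hb hab]
    refine ⟨by rw [hbi], ?_, ?_⟩
    · intro h
      have := congrArg Prod.snd h
      simp only at this
      linarith
    · have := H.color_succ a ha b hb hab
      simp only [stepEdge]; omega

/-- Degree and flow at the ends of the vertical edge of a crossing. -/
theorem star_crossing (H : ArcSystem n N M) (hε : 0 < ε) (hεm : ε < m / 4) {a b : ColoredArc}
    (ha : a ∈ M) (hb : b ∈ M) (hab : a.Crosses b) {v : ℝ × ℝ}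
    (hv : v = crossingPoint m ε a b ∨ v = crossingPoint m (-ε) a b)
    {E : Set WebEdge} (hE : E = arcEdges m ε M ∪ (yEdges ε M ∪ dumbbellEdges m ε M)) :
    {e | e ∈ E ∧ e.src = v}.ncard + {e | e ∈ E ∧ e.tgt = v}.ncard = 3 ∧
      (∑ᶠ e ∈ {e | e ∈ E ∧ e.tgt = v}, e.weight) -
        (∑ᶠ e ∈ {e | e ∈ E ∧ e.src = v}, e.weight) = 0 := by
  subst hE
  have r1 : (a.start : ℝ) < b.start := by exact_mod_cast hab.1
  have r2 : (b.start : ℝ) < a.finish := by exact_mod_cast hab.2.1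
  have r3 : (a.finish : ℝ) < b.finish := by exact_mod_cast hab.2.2
  have hcol := H.cross_color a ha b hb hab
  have hhigh := crossing_high hε hεm hab
  have na : ArcNode m ε M a (((b.start : ℝ) + a.finish) / 2) _ _ := ArcNode.falling b hb hab
  have nb : ArcNode m ε M b (((b.start : ℝ) + a.finish) / 2) _ _ := ArcNode.rising a ha hab
  have hg : verticalEdge (crossingPoint m (-ε) a b) (crossingPoint m ε a b) b.color a.color ∈
      dumbbellEdges m ε M := ⟨a, ha, b, hb, hab, rfl⟩
  have hne : crossingPoint m ε a b ≠ crossingPoint m (-ε) a b := by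
    intro h
    have := congrArg Prod.snd h
    simp only [crossingPoint] at this
    linarith
  have huniq : ∀ e ∈ yEdges ε M ∪ dumbbellEdges m ε M, e.src = v ∨ e.tgt = v →
      e = verticalEdge (crossingPoint m (-ε) a b) (crossingPoint m ε a b) b.color a.color := by
    have hv1 : v.1 = ((b.start : ℝ) + a.finish) / 2 := by rcases hv with rfl | rfl <;> rfl
    have hv2 : m * ((a.finish : ℝ) - b.start) / 2 - ε ≤ v.2 ∧
        v.2 ≤ m * ((a.finish : ℝ) - b.start) / 2 + ε := by
      rcases hv with rfl | rfl <;> simp only [crossingPoint] <;> constructor <;> linarith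
    rintro e (⟨c, hc, d, hd, hcd, rfl⟩ | ⟨c, hc, d, hd, hcd, rfl⟩) h
    · exfalso
      have h1 := verticalEdge_end h
      rcases h1 with h1 | h1 <;>
      · rw [h1] at hv2
        simp only at hv2
        linarith
    · have h1 := verticalEdge_end h
      have hw : v.1 = ((d.start : ℝ) + c.finish) / 2 ∧
          m * ((c.finish : ℝ) - d.start) / 2 - ε ≤ v.2 ∧
          v.2 ≤ m * ((c.finish : ℝ) - d.start) / 2 + ε := by
        rcases h1 with h1 | h1 <;> rw [h1] <;> refine ⟨rfl, ?_, ?_⟩ <;>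
          simp only [crossingPoint] <;> linarith
      obtain ⟨rfl, rfl⟩ := crossing_unique H hε hεm ha hb hc hd (hv1.symm.trans hw.1)
        (hv2.1.trans hw.2.2) (hw.2.1.trans hv2.2)
      rfl
  rcases hv with rfl | rfl
  -- At the upper vertex `a` arrives, falling, and `b` leaves, rising; at the lower vertex `b`
  -- arrives and `a` leaves. The vertical edge carries the difference of the colors.
  · obtain ⟨t', p, S⟩ := nb.exists_next H hb (by linarith)
    obtain ⟨t, q, S'⟩ := na.exists_prev H ha (by linarith)
    refine star_of_triple (arcEdges_src H hε hεm S) (arcEdges_tgt H hε hεm S') (Or.inr hg)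
      (vertical_notMem_arcEdges H rfl) huniq ?_
    by_cases h : a.color < b.color
    · right
      unfold verticalEdge
      rw [if_pos h]
      exact ⟨rfl, hne.symm, by simp only [stepEdge]; omega⟩
    · left
      unfold verticalEdge
      rw [if_neg h]
      exact ⟨rfl, hne.symm, by simp only [stepEdge]; omega⟩
  · obtain ⟨t', p, S⟩ := na.exists_next H ha (by linarith)
    obtain ⟨t, q, S'⟩ := nb.exists_prev H hb (by linarith)
    refine star_of_triple (arcEdges_src H hε hεm S) (arcEdges_tgt H hε hεm S') (Or.inr hg)
      (vertical_notMem_arcEdges H rfl) huniq ?_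
    by_cases h : a.color < b.color
    · left
      unfold verticalEdge
      rw [if_pos h]
      exact ⟨rfl, hne, by simp only [stepEdge]; omega⟩
    · right
      unfold verticalEdge
      rw [if_neg h]
      exact ⟨rfl, hne, by simp only [stepEdge]; omega⟩

theorem IsArcStep.left_bottom (H : ArcSystem n N M) (hε : 0 < ε) (hεm : ε < m / 4)
    {a : ColoredArc} {t t' : ℝ} {q p : ℝ × ℝ} (S : IsArcStep m ε M a t q t' p) {i : ℤ}
    (h : q = ((i : ℝ), 0)) : a.start = i ∧ ¬ HasY M i := by
  have hm : 0 < m := by linarith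
  rcases S.left_cases H with k | ⟨k, l⟩ | ⟨k, l⟩
  · have h1 := congrArg Prod.fst (k.symm.trans h)
    rw [foot_fst] at h1
    simp only at h1
    have h2 : a.start = i := by exact_mod_cast h1
    refine ⟨h2, fun hY => ?_⟩
    rw [h2, foot_of_hasY hY] at k
    have := congrArg Prod.snd (k.symm.trans h)
    simp only at this
    linarith
  · have e := congrArg Prod.snd (k.symm.trans h)
    have := mul_half_le hm (show 1 / 2 ≤ t - a.start by linarith)
    simp only at e
    linarith
  · have e := congrArg Prod.snd (k.symm.trans h)
    have := mul_half_le hm (show 1 / 2 ≤ a.finish - t by linarith)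
    simp only at e
    linarith

theorem IsArcStep.right_bottom (H : ArcSystem n N M) (hε : 0 < ε) (hεm : ε < m / 4)
    {a : ColoredArc} {t t' : ℝ} {q p : ℝ × ℝ} (S : IsArcStep m ε M a t q t' p) {i : ℤ}
    (h : p = ((i : ℝ), 0)) : a.finish = i ∧ ¬ HasY M i := by
  have hm : 0 < m := by linarith
  rcases S.right_cases H with k | ⟨k, l⟩ | ⟨k, l⟩
  · have h1 := congrArg Prod.fst (k.symm.trans h)
    rw [foot_fst] at h1
    simp only at h1
    have h2 : a.finish = i := by exact_mod_cast h1
    refine ⟨h2, fun hY => ?_⟩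
    rw [h2, foot_of_hasY hY] at k
    have := congrArg Prod.snd (k.symm.trans h)
    simp only at this
    linarith
  · have e := congrArg Prod.snd (k.symm.trans h)
    have := mul_half_le hm (show 1 / 2 ≤ t' - a.start by linarith)
    simp only at e
    linarith
  · have e := congrArg Prod.snd (k.symm.trans h)
    have := mul_half_le hm (show 1 / 2 ≤ a.finish - t' by linarith)
    simp only at e
    linarith

theorem vertical_bottom (H : ArcSystem n N M) (hε : 0 < ε) (hεm : ε < m / 4) {e : WebEdge}
    (he : e ∈ yEdges ε M ∪ dumbbellEdges m ε M) {i : ℤ}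
    (h : e.src = ((i : ℝ), 0) ∨ e.tgt = ((i : ℝ), 0)) :
    HasY M i ∧ e.src = ((i : ℝ), 0) ∧ e.tgt ≠ ((i : ℝ), 0) ∧
      ∃ a ∈ M, ∃ b ∈ M, a.finish = i ∧ b.start = i ∧
        e = verticalEdge ((b.start : ℝ), 0) ((b.start : ℝ), ε) b.color a.color := by
  rcases he with ⟨c, hc, d, hd, hcd, rfl⟩ | ⟨c, hc, d, hd, hcd, rfl⟩
  · have hd' : d.start = i := by
      rcases verticalEdge_end h with h | h
      · have := congrArg Prod.fst h
        simp only at this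
        exact_mod_cast this.symm
      · have := congrArg Prod.snd h
        simp only at this
        linarith
    refine ⟨⟨⟨c, hc, hcd.trans hd'⟩, d, hd, hd'⟩, ?_, ?_, c, hc, d, hd, hcd.trans hd', hd', rfl⟩
    · rw [yEdge_eq H hc hd hcd]; simp only; rw [hd']
    · rw [yEdge_eq H hc hd hcd]
      intro h
      have := congrArg Prod.snd h
      simp only at this
      linarith
  · exfalso
    have h3 := crossing_high hε hεm hcd
    rcases verticalEdge_end h with h | h <;>
    · have := congrArg Prod.snd h
      simp only [crossingPoint] at this
      linarith

/-- With a Y, only its vertical edge reaches the bottom. Without one, some arc covers `i`, and all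
arcs at `i` start there or all end there, so there is just one. -/
theorem degree_bottom (H : ArcSystem n N M) (hε : 0 < ε) (hεm : ε < m / 4) {i : ℤ} (h1 : 1 ≤ i)
    (h2 : i ≤ N) {E : Set WebEdge}
    (hE : E = arcEdges m ε M ∪ (yEdges ε M ∪ dumbbellEdges m ε M)) :
    {e | e ∈ E ∧ e.src = ((i : ℝ), (0 : ℝ))}.ncard +
      {e | e ∈ E ∧ e.tgt = ((i : ℝ), (0 : ℝ))}.ncard = 1 := by
  subst hE
  by_cases hY : HasY M i
  · obtain ⟨⟨a, ha, hai⟩, b, hb, hbi⟩ := id hY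
    have s1 : {e | e ∈ arcEdges m ε M ∪ (yEdges ε M ∪ dumbbellEdges m ε M) ∧
        e.src = ((i : ℝ), (0 : ℝ))} =
        {verticalEdge ((b.start : ℝ), 0) ((b.start : ℝ), ε) b.color a.color} := by
      ext e
      constructor
      · rintro ⟨he | he, h⟩
        · obtain ⟨c, t, q, t', p, S, rfl⟩ := mem_arcEdges.1 he
          exact absurd hY (S.left_bottom H hε hεm h).2
        · obtain ⟨-, -, -, c, hc, d, hd, h3, h4, rfl⟩ := vertical_bottom H hε hεm he (Or.inl h)
          rw [H.finish_inj c hc a ha (h3.trans hai.symm), H.start_inj d hd b hb (h4.trans hbi.symm)]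
          rfl
      · rintro rfl
        refine ⟨Or.inr (Or.inl ⟨a, ha, b, hb, hai.trans hbi.symm, rfl⟩), ?_⟩
        rw [yEdge_eq H ha hb (hai.trans hbi.symm)]
        simp only; rw [hbi]
    have s2 : {e | e ∈ arcEdges m ε M ∪ (yEdges ε M ∪ dumbbellEdges m ε M) ∧
        e.tgt = ((i : ℝ), (0 : ℝ))} = ∅ := by
      rw [Set.eq_empty_iff_forall_notMem]
      rintro e ⟨he | he, h⟩
      · obtain ⟨c, t, q, t', p, S, rfl⟩ := mem_arcEdges.1 he
        exact absurd hY (S.right_bottom H hε hεm h).2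
      · exact (vertical_bottom H hε hεm he (Or.inr h)).2.2.1 h
    rw [s1, s2]; simp
  · have hv : ∀ e ∈ yEdges ε M ∪ dumbbellEdges m ε M,
        ¬ (e.src = ((i : ℝ), (0 : ℝ)) ∨ e.tgt = ((i : ℝ), (0 : ℝ))) := fun e he h =>
      hY (vertical_bottom H hε hεm he h).1
    have hfoot := foot_of_not_hasY (ε := ε) hY
    obtain ⟨a, ha, hai | hai⟩ := H.covers i h1 h2
    · have n1 : ArcNode m ε M a a.start _ _ := ArcNode.first
      obtain ⟨t', p, S⟩ := n1.exists_next H ha (by exact_mod_cast (H.arc a ha).2.1)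
      rw [hai, hfoot] at S
      have s1 : {e | e ∈ arcEdges m ε M ∪ (yEdges ε M ∪ dumbbellEdges m ε M) ∧
          e.src = ((i : ℝ), (0 : ℝ))} = {stepEdge m a i (i, 0) t' p} := by
        rw [← arcEdges_src H hε hεm S]
        ext e
        exact ⟨fun h => ⟨h.1.resolve_right fun h' => hv e h' (Or.inl h.2), h.2⟩,
          fun h => ⟨Or.inl h.1, h.2⟩⟩
      have s2 : {e | e ∈ arcEdges m ε M ∪ (yEdges ε M ∪ dumbbellEdges m ε M) ∧
          e.tgt = ((i : ℝ), (0 : ℝ))} = ∅ := by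
        rw [Set.eq_empty_iff_forall_notMem]
        rintro e ⟨he | he, h⟩
        · obtain ⟨c, t, q, t', p, S, rfl⟩ := mem_arcEdges.1 he
          exact hY ⟨⟨c, S.mem, (S.right_bottom H hε hεm h).1⟩, a, ha, hai⟩
        · exact hv e he (Or.inr h)
      rw [s1, s2]; simp
    · have n1 : ArcNode m ε M a a.finish _ _ := ArcNode.last
      obtain ⟨t, q, S⟩ := n1.exists_prev H ha (by exact_mod_cast (H.arc a ha).2.1)
      rw [hai, hfoot] at S
      have s1 : {e | e ∈ arcEdges m ε M ∪ (yEdges ε M ∪ dumbbellEdges m ε M) ∧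
          e.tgt = ((i : ℝ), (0 : ℝ))} = {stepEdge m a t q i (i, 0)} := by
        rw [← arcEdges_tgt H hε hεm S]
        ext e
        exact ⟨fun h => ⟨h.1.resolve_right fun h' => hv e h' (Or.inr h.2), h.2⟩,
          fun h => ⟨Or.inl h.1, h.2⟩⟩
      have s2 : {e | e ∈ arcEdges m ε M ∪ (yEdges ε M ∪ dumbbellEdges m ε M) ∧
          e.src = ((i : ℝ), (0 : ℝ))} = ∅ := by
        rw [Set.eq_empty_iff_forall_notMem]
        rintro e ⟨he | he, h⟩
        · obtain ⟨c, t, q, t', p, S, rfl⟩ := mem_arcEdges.1 he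
          exact hY ⟨⟨a, ha, hai⟩, c, S.mem, (S.left_bottom H hε hεm h).1⟩
        · exact hv e he (Or.inl h)
      rw [s1, s2]; simp

theorem preWeb_edges : (preWeb N m ε M).edges =
    arcEdges m ε M ∪ (yEdges ε M ∪ dumbbellEdges m ε M) :=
  Set.union_assoc _ _ _

/-- Before normalization the flow at interior vertices is exactly `0`; the modulus `n` enters only
through flips. -/
theorem ArcSystem.isWeb_preWeb (H : ArcSystem n N M) (hε : 0 < ε) (hεm : ε < m / 4) :
    IsWeb n N (preWeb N m ε M) := by
  have hhigh := fun (a b : ColoredArc) (h : a.Crosses b) => crossing_high hε hεm h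
  have hint : ∀ v ∈ (preWeb N m ε M).interior, (preWeb N m ε M).degree v = 3 ∧
      (∑ᶠ e ∈ {e | e ∈ (preWeb N m ε M).edges ∧ e.tgt = v}, e.weight) -
        (∑ᶠ e ∈ {e | e ∈ (preWeb N m ε M).edges ∧ e.src = v}, e.weight) = 0 := by
    rintro v (⟨i, hY, rfl⟩ | ⟨a, ha, b, hb, hab, hv⟩)
    · exact star_y H hε hεm hY preWeb_edges
    · exact star_crossing H hε hεm ha hb hab hv preWeb_edges
  constructor
  · rfl
  · exact fun p hp => interior_height hε hεm hp
  · refine Set.Finite.union ?_ ?_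
    · refine (H.finite.image fun b : ColoredArc => ((b.start : ℝ), ε)).subset ?_
      rintro p ⟨i, ⟨-, b, hb, rfl⟩, rfl⟩
      exact ⟨b, hb, rfl⟩
    · refine (((H.finite.prod H.finite).image fun x : ColoredArc × ColoredArc =>
        crossingPoint m ε x.1 x.2).union ((H.finite.prod H.finite).image
          fun x : ColoredArc × ColoredArc => crossingPoint m (-ε) x.1 x.2)).subset ?_
      rintro p ⟨a, ha, b, hb, hab, rfl | rfl⟩
      · exact Or.inl ⟨(a, b), ⟨ha, hb⟩, rfl⟩
      · exact Or.inr ⟨(a, b), ⟨ha, hb⟩, rfl⟩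
  · refine ((arcEdges_finite H).union ?_).union ?_
    · refine ((H.finite.prod H.finite).image fun x : ColoredArc × ColoredArc =>
        verticalEdge ((x.2.start : ℝ), 0) ((x.2.start : ℝ), ε) x.2.color x.1.color).subset ?_
      rintro e ⟨a, ha, b, hb, hab, rfl⟩
      exact ⟨(a, b), ⟨ha, hb⟩, rfl⟩
    · refine ((H.finite.prod H.finite).image fun x : ColoredArc × ColoredArc =>
        verticalEdge (crossingPoint m (-ε) x.1 x.2) (crossingPoint m ε x.1 x.2) x.2.color
          x.1.color).subset ?_
      rintro e ⟨a, ha, b, hb, hab, rfl⟩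
      exact ⟨(a, b), ⟨ha, hb⟩, rfl⟩
  · rintro e ((he | he) | he)
    · obtain ⟨a, t, q, t', p, S, rfl⟩ := mem_arcEdges.1 he
      exact S.mem_vertices H
    · obtain ⟨a, ha, b, hb, hab, rfl⟩ := he
      have h1 := H.arc b hb
      rw [yEdge_eq H ha hb hab]
      exact ⟨Or.inl ⟨b.start, h1.1, by omega, rfl⟩,
        Or.inr (Or.inl ⟨b.start, ⟨⟨a, ha, hab⟩, b, hb, rfl⟩, rfl⟩)⟩
    · obtain ⟨a, ha, b, hb, hab, rfl⟩ := he
      have h1 := crossingPoint_mem (N := N) (m := m) (ε := ε) ha hb hab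
      rcases verticalEdge_ends (crossingPoint m (-ε) a b) (crossingPoint m ε a b) b.color a.color
        with h | h <;> rw [h.1, h.2]
      · exact h1.symm
      · exact h1
  · rintro e ((he | he) | he)
    · obtain ⟨a, t, q, t', p, S, rfl⟩ := mem_arcEdges.1 he
      exact S.isSimpleCurve H
    · obtain ⟨a, ha, b, hb, hab, rfl⟩ := he
      refine verticalEdge_isSimpleCurve (fun h => ?_) _ _
      have := congrArg Prod.snd h
      simp only at this
      linarith
    · obtain ⟨a, ha, b, hb, hab, rfl⟩ := he
      refine verticalEdge_isSimpleCurve (fun h => ?_) _ _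
      have := congrArg Prod.snd h
      simp only [crossingPoint] at this
      linarith
  · exact fun e he p hp => preWeb_upper H hε hεm he hp
  · exact fun e he p hp hv => preWeb_avoids H hε hεm he hp hv
  · exact fun e he f hf hne p hp => preWeb_planar H hε hεm he hf hne hp.1 hp.2
  · rintro v ⟨i, h1, h2, rfl⟩
    exact degree_bottom H hε hεm h1 h2 preWeb_edges
  · exact fun v hv => (hint v hv).1
  · rintro e ((he | he) | he)
    · obtain ⟨a, t, q, t', p, S, rfl⟩ := mem_arcEdges.1 he
      exact H.color a S.mem
    · obtain ⟨a, ha, b, hb, hab, rfl⟩ := he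
      have h1 := H.color a ha
      have h2 := H.color b hb
      have h3 := H.color_succ a ha b hb hab
      rw [yEdge_eq H ha hb hab]
      simp only; omega
    · obtain ⟨a, ha, b, hb, hab, rfl⟩ := he
      have h1 := H.color a ha
      have h2 := H.color b hb
      have h3 := H.cross_color a ha b hb hab
      unfold verticalEdge
      split_ifs <;> simp only <;> omega
  · intro v hv
    rw [(hint v hv).2]

end Web

/-! ## Reflection of the web of a matching -/

theorem reflectPoint_segment (N : ℕ) (A B : ℝ × ℝ) :
    reflectPoint N '' segment ℝ A B = segment ℝ (reflectPoint N A) (reflectPoint N B) := by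
  have h : ∀ A B P : ℝ × ℝ, P ∈ segment ℝ A B →
      reflectPoint N P ∈ segment ℝ (reflectPoint N A) (reflectPoint N B) := by
    rintro A B _ ⟨u, v, hu, hv, huv, rfl⟩
    refine ⟨u, v, hu, hv, huv, ?_⟩
    ext
    · simp only [reflectPoint, Prod.fst_add, Prod.smul_fst, smul_eq_mul]
      linear_combination ((N : ℝ) + 1) * huv
    · simp [reflectPoint]
  ext P
  constructor
  · rintro ⟨Q, hQ, rfl⟩
    exact h A B Q hQ
  · intro hP
    have := h _ _ P hP
    rw [reflectPoint_reflectPoint, reflectPoint_reflectPoint] at this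
    exact ⟨_, this, reflectPoint_reflectPoint N P⟩

section Reflect

variable {n N : ℕ} {M : Set ColoredArc} {m ε : ℝ}

theorem foot_reflect (p : ℤ) :
    foot ε (reflectMatching n N M) ((N : ℤ) + 1 - p) = reflectPoint N (foot ε M p) := by
  by_cases h : HasY M p
  · rw [foot_of_hasY h, foot_of_hasY h.reflect]; simp [reflectPoint]
  · rw [foot_of_not_hasY h, foot_of_not_hasY (mt hasY_reflectMatching.1 h)]; simp [reflectPoint]

theorem crossingPoint_reflect (h : ℝ) (a b : ColoredArc) :
    crossingPoint m h (b.reflect n N) (a.reflect n N) = reflectPoint N (crossingPoint m h a b) := by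
  ext <;> simp only [crossingPoint, ColoredArc.reflect, reflectPoint] <;> push_cast <;> ring

theorem apex_reflect (a : ColoredArc) :
    (a.reflect n N).apex m = reflectPoint N (a.apex m) := by
  ext <;> simp only [ColoredArc.apex, ColoredArc.reflect, reflectPoint] <;> push_cast <;> ring

/-- Reflection reverses the direction of travel: first and last, rising and falling, arrival and
departure are exchanged. -/
theorem ArcNode.reflect {a : ColoredArc} {t : ℝ} {p q : ℝ × ℝ} (h : ArcNode m ε M a t p q) :
    ArcNode m ε (reflectMatching n N M) (a.reflect n N) ((N : ℝ) + 1 - t) (reflectPoint N q)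
      (reflectPoint N p) := by
  cases h with
  | first =>
    have k := ArcNode.last (m := m) (ε := ε) (M := reflectMatching n N M) (a := a.reflect n N)
    simp only [ColoredArc.reflect, foot_reflect] at k ⊢
    push_cast at k
    exact k
  | rising b hb h =>
    have k := ArcNode.falling (m := m) (ε := ε) (b.reflect n N) (mem_reflectMatching hb)
      (h.reflect (n := n) (N := N))
    rw [crossingPoint_reflect, crossingPoint_reflect] at k
    convert k using 1
    simp only [ColoredArc.reflect]; push_cast; ring
  | falling b hb h =>
    have k := ArcNode.rising (m := m) (ε := ε) (b.reflect n N) (mem_reflectMatching hb)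
      (h.reflect (n := n) (N := N))
    rw [crossingPoint_reflect, crossingPoint_reflect] at k
    convert k using 1
    simp only [ColoredArc.reflect]; push_cast; ring
  | last =>
    have k := ArcNode.first (m := m) (ε := ε) (M := reflectMatching n N M) (a := a.reflect n N)
    simp only [ColoredArc.reflect, foot_reflect] at k ⊢
    push_cast at k
    exact k

theorem IsArcStep.reflect {a : ColoredArc} {t t' : ℝ} {q p : ℝ × ℝ}
    (S : IsArcStep m ε M a t q t' p) :
    IsArcStep m ε (reflectMatching n N M) (a.reflect n N) ((N : ℝ) + 1 - t') (reflectPoint N p)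
      ((N : ℝ) + 1 - t) (reflectPoint N q) := by
  obtain ⟨p₀, hq⟩ := S.left
  obtain ⟨q₀, hp⟩ := S.right
  refine ⟨mem_reflectMatching S.mem, ⟨_, hp.reflect⟩, ⟨_, hq.reflect⟩, by linarith [S.lt], ?_⟩
  rintro s u v h ⟨h1, h2⟩
  have k := h.reflect (n := n) (N := N)
  rw [reflectMatching_reflectMatching, ColoredArc.reflect_reflect] at k
  exact S.consecutive _ _ _ k ⟨by linarith, by linarith⟩

/-- The clockwise direction of the reflected arc runs against the mirrored direction, and its color
is `n - x`. These are the two effects of a flip. -/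
theorem stepEdge_reflect (a : ColoredArc) (t t' : ℝ) (q p : ℝ × ℝ) :
    stepEdge m (a.reflect n N) ((N : ℝ) + 1 - t') (reflectPoint N p) ((N : ℝ) + 1 - t)
      (reflectPoint N q) = ((stepEdge m a t q t' p).reflect N).flip n := by
  have h : arcPiece m (a.reflect n N) ((N : ℝ) + 1 - t') ((N : ℝ) + 1 - t) (reflectPoint N p)
      (reflectPoint N q) = reflectPoint N '' arcPiece m a t t' q p := by
    have h1 : ((N : ℝ) + 1 - t' < (reflectPoint N (a.apex m)).1 ∧
        (reflectPoint N (a.apex m)).1 < (N : ℝ) + 1 - t) ↔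
          (t < (a.apex m).1 ∧ (a.apex m).1 < t') := by
      simp only [reflectPoint]
      constructor <;> rintro ⟨h1, h2⟩ <;> constructor <;> linarith
    unfold arcPiece
    rw [apex_reflect]
    by_cases h2 : t < (a.apex m).1 ∧ (a.apex m).1 < t'
    · rw [if_pos h2, if_pos (h1.2 h2), Set.image_union, reflectPoint_segment,
        reflectPoint_segment, Set.union_comm, segment_symm ℝ _ (reflectPoint N q),
        segment_symm ℝ (reflectPoint N p)]
    · rw [if_neg h2, if_neg (mt h1.1 h2), reflectPoint_segment, segment_symm]
  unfold stepEdge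
  rw [h]
  rfl

theorem arcEdges_reflect :
    arcEdges m ε (reflectMatching n N M) = (fun e => (e.reflect N).flip n) '' arcEdges m ε M := by
  have h : ∀ M, ∀ e ∈ arcEdges m ε M,
      (e.reflect N).flip n ∈ arcEdges m ε (reflectMatching n N M) := by
    intro M e he
    obtain ⟨a, t, q, t', p, S, rfl⟩ := mem_arcEdges.1 he
    exact mem_arcEdges.2 ⟨_, _, _, _, _, S.reflect, (stepEdge_reflect a t t' q p).symm⟩
  ext e
  constructor
  · intro he
    have := h _ e he
    rw [reflectMatching_reflectMatching] at this
    refine ⟨_, this, ?_⟩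
    simp only [WebEdge.reflect_flip, WebEdge.flip_flip, WebEdge.reflect_reflect]
  · rintro ⟨f, hf, rfl⟩
    exact h M f hf

/-- The mirror image of the descending arc ascends, so the complemented colors trade places and keep
their difference. No flip is needed here. -/
theorem verticalEdge_reflect (bot top : ℝ × ℝ) (x y : ℤ) :
    (verticalEdge bot top x y).reflect N =
      verticalEdge (reflectPoint N bot) (reflectPoint N top) ((n : ℤ) - y) ((n : ℤ) - x) := by
  unfold verticalEdge
  by_cases h : y < x
  · rw [if_pos h, if_pos (by omega)]
    ext1 <;> simp only [WebEdge.reflect, reflectPoint_segment]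
    ring
  · rw [if_neg h, if_neg (by omega)]
    ext1 <;> simp only [WebEdge.reflect, reflectPoint_segment]
    ring

theorem verticalEdges_reflect :
    yEdges ε (reflectMatching n N M) ∪ dumbbellEdges m ε (reflectMatching n N M) =
      WebEdge.reflect N '' (yEdges ε M ∪ dumbbellEdges m ε M) := by
  have h : ∀ M, ∀ e ∈ yEdges ε M ∪ dumbbellEdges m ε M, e.reflect N ∈
      yEdges ε (reflectMatching n N M) ∪ dumbbellEdges m ε (reflectMatching n N M) := by
    rintro M e (⟨a, ha, b, hb, hab, rfl⟩ | ⟨a, ha, b, hb, hab, rfl⟩)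
    · refine Or.inl ⟨_, mem_reflectMatching hb, _, mem_reflectMatching ha, ?_, ?_⟩
      · simp [ColoredArc.reflect, hab]
      · rw [verticalEdge_reflect (n := n)]
        simp [ColoredArc.reflect, reflectPoint, hab]
    · refine Or.inr ⟨_, mem_reflectMatching hb, _, mem_reflectMatching ha, hab.reflect, ?_⟩
      rw [verticalEdge_reflect (n := n), crossingPoint_reflect, crossingPoint_reflect]
      rfl
  ext e
  constructor
  · intro he
    have := h _ e he
    rw [reflectMatching_reflectMatching] at this
    exact ⟨_, this, WebEdge.reflect_reflect N e⟩
  · rintro ⟨f, hf, rfl⟩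
    exact h M f hf

theorem preWeb_boundary_reflect :
    reflectPoint N '' (preWeb N m ε M).boundary = (preWeb N m ε M).boundary := by
  ext p
  constructor
  · rintro ⟨_, ⟨i, h1, h2, rfl⟩, rfl⟩
    exact ⟨N + 1 - i, by omega, by omega, by simp [reflectPoint]⟩
  · rintro ⟨i, h1, h2, rfl⟩
    exact ⟨_, ⟨N + 1 - i, by omega, by omega, rfl⟩, by simp [reflectPoint]⟩

theorem preWeb_interior_reflect :
    (preWeb N m ε (reflectMatching n N M)).interior =
      reflectPoint N '' (preWeb N m ε M).interior := by
  have h : ∀ M, ∀ p ∈ (preWeb N m ε M).interior,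
      reflectPoint N p ∈ (preWeb N m ε (reflectMatching n N M)).interior := by
    rintro M p (⟨i, hY, rfl⟩ | ⟨a, ha, b, hb, hab, hp⟩)
    · exact Or.inl ⟨_, hY.reflect, by simp [reflectPoint]⟩
    · refine Or.inr ⟨_, mem_reflectMatching hb, _, mem_reflectMatching ha, hab.reflect, ?_⟩
      rw [crossingPoint_reflect, crossingPoint_reflect]
      exact hp.imp (congrArg _) (congrArg _)
  ext p
  constructor
  · intro hp
    have := h _ p hp
    rw [reflectMatching_reflectMatching] at this
    exact ⟨_, this, reflectPoint_reflectPoint N p⟩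
  · rintro ⟨q, hq, rfl⟩
    exact h M q hq

/-! ### Boundary edges -/

theorem WebEdge.isBoundaryEdge_flip (B : Set (ℝ × ℝ)) (e : WebEdge) :
    (e.flip n).IsBoundaryEdge B ↔ e.IsBoundaryEdge B := by
  simp only [WebEdge.IsBoundaryEdge, WebEdge.flip]; tauto

theorem WebEdge.isBoundaryEdge_reflect {B : Set (ℝ × ℝ)} (hB : reflectPoint N '' B = B)
    (e : WebEdge) : (e.reflect N).IsBoundaryEdge B ↔ e.IsBoundaryEdge B := by
  have h : ∀ p, reflectPoint N p ∈ B ↔ p ∈ B := fun p => by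
    conv_lhs => rw [← hB]
    exact (reflectPoint_injective N).mem_set_image
  simp only [WebEdge.IsBoundaryEdge, WebEdge.reflect, h]

theorem WebEdge.normalize_of_not {B : Set (ℝ × ℝ)} {e : WebEdge} (h : ¬ e.IsBoundaryEdge B) :
    e.normalize B = e := if_neg h

theorem WebEdge.isBoundaryEdge_normalize (B : Set (ℝ × ℝ)) (e : WebEdge) :
    (e.normalize B).IsBoundaryEdge B ↔ e.IsBoundaryEdge B := by
  unfold WebEdge.normalize
  split_ifs with h h1
  · rfl
  · simp only [WebEdge.IsBoundaryEdge]; tauto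
  · rfl

/-- Normalization forgets the direction and the weight of a boundary edge, so the flips caused by
reflection become invisible there. -/
theorem WebEdge.normalize_flip {B : Set (ℝ × ℝ)} {e : WebEdge} (h : e.IsBoundaryEdge B) :
    (e.flip n).normalize B = e.normalize B := by
  unfold WebEdge.normalize
  rw [if_pos h, if_pos ((WebEdge.isBoundaryEdge_flip B e).2 h)]
  rcases h with h | h <;> simp [WebEdge.flip, h.1, h.2]

theorem WebEdge.normalize_reflect {B : Set (ℝ × ℝ)} (hB : reflectPoint N '' B = B) (e : WebEdge) :
    (e.reflect N).normalize B = (e.normalize B).reflect N := by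
  have h : (e.reflect N).src ∈ B ↔ e.src ∈ B := by
    conv_lhs => rw [← hB]
    exact (reflectPoint_injective N).mem_set_image
  unfold WebEdge.normalize
  by_cases h1 : e.IsBoundaryEdge B
  · rw [if_pos h1, if_pos ((WebEdge.isBoundaryEdge_reflect hB e).2 h1)]
    by_cases h2 : e.src ∈ B
    · rw [if_pos h2, if_pos (h.2 h2)]; rfl
    · rw [if_neg h2, if_neg (mt h.1 h2)]; rfl
  · rw [if_neg h1, if_neg (mt (WebEdge.isBoundaryEdge_reflect hB e).1 h1)]

/-- Normalization is a flip of the boundary edges that end on the boundary: these come from arcs of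
color `n - 1`, and flipping gives weight `1`. Boundary edges that leave the boundary are arcs of
color `1` or stems of Y's and have weight `1` already. -/
theorem ArcSystem.isWeb_webOf (H : ArcSystem n N M) (hε : 0 < ε) (hεm : ε < m / 4) :
    IsWeb n N (webOf N m ε M) := by
  set B := (preWeb N m ε M).boundary with hB
  have h : webOf N m ε M = (preWeb N m ε M).flip n {e | e.IsBoundaryEdge B ∧ e.src ∉ B} := by
    unfold webOf PlaneGraph.flip
    congr 1
    refine Set.image_congr fun e he => ?_
    rw [← hB]
    by_cases hb : e.IsBoundaryEdge B
    · unfold WebEdge.normalize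
      rw [if_pos hb]
      by_cases hs : e.src ∈ B
      · rw [if_pos hs, if_neg fun h => h.2 hs]
        obtain ⟨i, -, -, hi⟩ := id hs
        ext1
        · rfl
        · rfl
        · rfl
        rw [preWeb_edges] at he
        rcases he with he | he
        · obtain ⟨a, t, q, t', p, S, rfl⟩ := mem_arcEdges.1 he
          have h1 := S.left_bottom H hε hεm hi
          exact (H.start_color a S.mem (by rw [h1.1]; exact h1.2)).symm
        · obtain ⟨-, -, -, a, ha, b, hb', h1, h2, rfl⟩ :=
            vertical_bottom H hε hεm he (Or.inl hi)
          rw [yEdge_eq H ha hb' (h1.trans h2.symm)]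
      · rw [if_neg hs, if_pos ⟨hb, hs⟩]
        have ht := (hb.resolve_left fun h => hs h.1).2
        obtain ⟨i, -, -, hi⟩ := id ht
        ext1
        · rfl
        · rfl
        · rfl
        rw [preWeb_edges] at he
        rcases he with he | he
        · obtain ⟨a, t, q, t', p, S, rfl⟩ := mem_arcEdges.1 he
          have h1 := S.right_bottom H hε hεm hi
          have h2 := H.finish_color a S.mem (by rw [h1.1]; exact h1.2)
          simp only [WebEdge.flip, stepEdge]
          omega
        · have h1 := vertical_bottom H hε hεm he (Or.inr hi)
          exact absurd hi h1.2.2.1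
    · rw [WebEdge.normalize_of_not hb, if_neg fun h => hb h.1]
  rw [h]
  exact (H.isWeb_preWeb hε hεm).flip _

/-! ### Comparison of the two webs -/

theorem internalArcEdges_reflect :
    internalArcEdges N m ε (reflectMatching n N M) =
      (fun e => (e.reflect N).flip n) '' internalArcEdges N m ε M := by
  have hB := preWeb_boundary_reflect (N := N) (m := m) (ε := ε) (M := M)
  have hb : ∀ e : WebEdge,
      ((e.reflect N).flip n).IsBoundaryEdge (preWeb N m ε (reflectMatching n N M)).boundary ↔
        e.IsBoundaryEdge (preWeb N m ε M).boundary := fun e =>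
    (WebEdge.isBoundaryEdge_flip _ _).trans (WebEdge.isBoundaryEdge_reflect hB e)
  ext e
  simp only [internalArcEdges, arcEdges_reflect, Set.mem_ofPred_eq, Set.mem_image]
  constructor
  · rintro ⟨⟨f, hf, rfl⟩, h⟩
    exact ⟨f, ⟨hf, fun h' => h ((hb f).2 h')⟩, rfl⟩
  · rintro ⟨f, ⟨hf, h⟩, rfl⟩
    exact ⟨⟨f, hf, rfl⟩, fun h' => h ((hb f).1 h')⟩

theorem internalArcEdges_subset :
    internalArcEdges N m ε M ⊆ (webOf N m ε M).edges := fun e he =>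
  ⟨e, Or.inl (Or.inl he.1), WebEdge.normalize_of_not he.2⟩

/-- Three kinds of edges are compared: internal arc edges are flipped by reflection, boundary edges
are made equal by normalization, and internal vertical edges agree as they are. Vertical edges are
never among the flipped ones, because the ends of an arc edge have different abscissae. -/
theorem ArcSystem.webOf_reflectMatching (H : ArcSystem n N M) :
    ((webOf N m ε M).reflect N).flip n (WebEdge.reflect N '' internalArcEdges N m ε M) =
      webOf N m ε (reflectMatching n N M) := by
  classical
  have hB := preWeb_boundary_reflect (N := N) (m := m) (ε := ε) (M := M)
  set B := (preWeb N m ε M).boundary with hBdef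
  have hbd : ∀ e : WebEdge, e.IsBoundaryEdge B → e.normalize B ∉ internalArcEdges N m ε M :=
    fun e h h' => h'.2 ((WebEdge.isBoundaryEdge_normalize B e).2 h)
  have harc : ∀ e ∈ arcEdges m ε M,
      (if e.normalize B ∈ internalArcEdges N m ε M then ((e.normalize B).reflect N).flip n
        else (e.normalize B).reflect N) = ((e.reflect N).flip n).normalize B := by
    intro e he
    by_cases h : e.IsBoundaryEdge B
    · rw [if_neg (hbd e h), WebEdge.normalize_flip ((WebEdge.isBoundaryEdge_reflect hB e).2 h),
        WebEdge.normalize_reflect hB]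
    · have h1 : ¬ ((e.reflect N).flip n).IsBoundaryEdge B := by
        rwa [WebEdge.isBoundaryEdge_flip, WebEdge.isBoundaryEdge_reflect hB]
      rw [WebEdge.normalize_of_not h, WebEdge.normalize_of_not h1, if_pos ⟨he, h⟩]
  have hvert : ∀ e ∈ yEdges ε M ∪ dumbbellEdges m ε M,
      (if e.normalize B ∈ internalArcEdges N m ε M then ((e.normalize B).reflect N).flip n
        else (e.normalize B).reflect N) = (e.reflect N).normalize B := by
    intro e he
    rw [WebEdge.normalize_reflect hB, if_neg]
    by_cases h : e.IsBoundaryEdge B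
    · exact hbd e h
    · rw [WebEdge.normalize_of_not h]
      rcases he with ⟨a, ha, b, hb, hab, rfl⟩ | ⟨a, ha, b, hb, hab, rfl⟩
      · exact fun h' => vertical_notMem_arcEdges H (by rfl) h'.1
      · exact fun h' => vertical_notMem_arcEdges H (by rfl) h'.1
  -- The boundary does not depend on the matching, so the same `B` serves for both webs.
  have hedges : (webOf N m ε (reflectMatching n N M)).edges = WebEdge.normalize B ''
      ((fun e => (e.reflect N).flip n) '' arcEdges m ε M ∪
        WebEdge.reflect N '' (yEdges ε M ∪ dumbbellEdges m ε M)) := by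
    rw [← arcEdges_reflect, ← verticalEdges_reflect, ← preWeb_edges]
    rfl
  ext1
  · exact hB
  · exact preWeb_interior_reflect.symm
  · rw [hedges]
    simp only [PlaneGraph.flip, PlaneGraph.reflect, webOf, preWeb_edges, Set.image_union,
      Set.image_image, (WebEdge.reflect_injective N).mem_set_image]
    simp only [← Set.image_union]
    rw [Set.image_union, Set.image_congr harc, Set.image_congr hvert]

end Reflect

theorem mainTheorem1 (n : ℕ) (hn : 2 ≤ n) (m ε : ℝ) (hm : 0 < m) (hε : 0 < ε) (hεm : ε < m / 4) :
    (∀ (N : ℕ) (M : Set ColoredArc), IsMulticoloredNCM n N M → IsStandardRectangular n M →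
      ((webOf N m ε M).reflect N).undirected =
          (webOf N m ε (reflectMatching n N M)).undirected ∧
        EdgeFlipEquiv n N ((webOf N m ε M).reflect N) (webOf N m ε (reflectMatching n N M))) ∧
    (∀ (k : ℕ) (T : ℕ → ℕ → ℤ), IsRectSYT n k T →
      WebEdge.shape '' (WebEdge.reflect (n * k) '' tableauArcEdges n k m ε T) =
          WebEdge.shape '' tableauArcEdges n k m ε (evacuation n k T) ∧
        ((tableauWeb n k m ε T).reflect (n * k)).flip n
            (WebEdge.reflect (n * k) '' tableauArcEdges n k m ε T) =
          ((tableauWeb n k m ε T).flip n (tableauArcEdges n k m ε T)).reflect (n * k) ∧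
        ((tableauWeb n k m ε T).flip n (tableauArcEdges n k m ε T)).reflect (n * k) =
          tableauWeb n k m ε (evacuation n k T) ∧
        EdgeFlipEquiv n (n * k) ((tableauWeb n k m ε T).reflect (n * k))
          (tableauWeb n k m ε (evacuation n k T))) := by
  have hequiv : ∀ (N : ℕ) (M : Set ColoredArc), ArcSystem n N M →
      EdgeFlipEquiv n N ((webOf N m ε M).reflect N) (webOf N m ε (reflectMatching n N M)) :=
    fun N M H => ⟨(H.isWeb_webOf hε hεm).reflect, H.reflect.isWeb_webOf hε hεm, _,
      Set.image_mono internalArcEdges_subset, H.webOf_reflectMatching⟩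
  constructor
  · intro N M H S
    have A := S.arcSystem H
    exact ⟨by rw [← A.webOf_reflectMatching, PlaneGraph.undirected_flip], hequiv N M A⟩
  · intro k T H
    have A := H.isStandardRectangular.arcSystem (H.isMulticoloredNCM hn)
    unfold tableauArcEdges tableauWeb
    -- Tableaux enter only through their matchings from here on, and the second part becomes a case
    -- of the first with its flip set made explicit.
    rw [H.tableauMatching_evacuation, internalArcEdges_reflect]
    refine ⟨?_, PlaneGraph.reflect_flip _ _ _ _, ?_, hequiv _ _ A⟩
    · simp only [Set.image_image, WebEdge.shape_flip]
    · rw [← PlaneGraph.reflect_flip, A.webOf_reflectMatching]
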